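/- Let $G$ be a totally disconnected, locally compact (Hausdorff) group. Say that $G$ has property (LD) if for every closed subgroup $K$ of $G$ whose normalizer in $G$ is open, there is an open subgroup $L$ of $K$ that is a direct factor of an open subgroup of $G$; that is, there are a subgroup $M$ of $G$ and an open subgroup $O$ of $G$ such that $(l,m)\mapsto lm$ is an isomorphism of topological groups from $L\times M$ (with the product topology) onto $O$. A topological group is just infinite if it is infinite and each of its nontrivial closed normal subgroups has finite index. Two totally disconnected, locally compact groups $H_1$ and $H_2$ are locally isomorphic if there is a continuous injective open homomorphism $U\to H_2$ for some open subgroup $U$ of $H_1$. Then the following are equivalent: (i) $G$ has property (LD); (ii) $G$ is locally isomorphic to a profinite group of the form $\prod_{i\in I}L_i$ (with the product topology, $I$ a possibly infinite, possibly empty set), where finitely many of the factors $L_i$ (possibly none) are just infinite profinite groups and all the remaining factors are finite simple groups (groups of prime order included). -/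

import Mathlib

/-- A topological group is *just infinite* if it is infinite and every nontrivial closed normal
subgroup has finite index. -/
def IsJustInfinite (G : Type*) [Group G] [TopologicalSpace G] : Prop :=
  Infinite G ∧
    ∀ N : Subgroup G, N.Normal → IsClosed (N : Set G) → N ≠ ⊥ → N.FiniteIndex

/-- `A` is a *direct factor of an open subgroup* of `G`: there are an open subgroup `O` and a
subgroup `B` of `G` such that multiplication `(a, b) ↦ a * b` is an isomorphism of topological
groups from `A × B` (with the product topology) onto `O`. -/
def IsLocalDirectFactor {G : Type*} [Group G] [TopologicalSpace G] (A : Subgroup G) : Prop :=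
  ∃ O : Subgroup G, IsOpen (O : Set G) ∧
    ∃ B : Subgroup G, ∃ e : (A × B) ≃ₜ* O, ∀ p : A × B, (e p : G) = (p.1 : G) * (p.2 : G)

/-- Property (LD): every closed subgroup `K` with open normalizer has an open subgroup `L`
that is a direct factor of an open subgroup of `G`. -/
def PropertyLD (G : Type*) [Group G] [TopologicalSpace G] : Prop :=
  ∀ K : Subgroup G, IsClosed (K : Set G) → IsOpen (Subgroup.normalizer (K : Set G) : Set G) →
    ∃ L : Subgroup G, L ≤ K ∧ IsOpen (L.subgroupOf K : Set K) ∧ IsLocalDirectFactor L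

/-- `G` and `H` are *locally isomorphic*: there is a continuous injective open homomorphism
from an open subgroup of `G` to `H`. -/
def LocallyIsomorphic (G H : Type*) [Group G] [TopologicalSpace G]
    [Group H] [TopologicalSpace H] : Prop :=
  ∃ U : Subgroup G, IsOpen (U : Set G) ∧
    ∃ θ : U →* H, Continuous θ ∧ Function.Injective θ ∧ IsOpenMap θ

/-!
Property (LD) is equivalent to a statement about compact subgroups, `HasLocalComplements`: each
closed subgroup `K` with open normalizer contains a compact subgroup `L` that commutes with some
compact subgroup `B`, such that `K ∩ B = 1` and `L B` is open. This only depends on the local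
isomorphism class of the group and passes to the factors `L` and `B`, so that one may work with
profinite groups.

*Products have (LD).* It suffices to find small open subgroups in which every closed normal
subgroup `K` has a closed normal virtual complement, and this property is stable under finite direct
products. In a product of simple groups, a minimal subproduct that generates the group together with
`K` is a complement. In a small open normal subgroup of a just infinite group without abelian normal
subgroups, the centralizer of `K` is a virtual complement
(`IsJustInfinite.normallyComplemented_of_not_commute`). An abelian open normal subgroup of a just
infinite group is virtually generated by finitely many conjugate procyclic pro-`p` subgroups, and a
minimal set of these that is virtually generating together with `K` does it
(`IsJustInfinite.normallyComplemented_of_commute`).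

*Groups with (LD) are products.* The elements of finite order with open centralizer form a normal
subgroup of a profinite group, by Dicman's lemma. A local complement for its closure splits the
group, locally, into a factor with dense quasi-central torsion and a factor without quasi-central
torsion (`HasLocalComplements.exists_isOpenDirectProduct`).

In the first factor, some open normal subgroup has finite Melnikov subgroup, the intersection of the
maximal open normal subgroups (`HasLocalComplements.exists_finite_melnikov`). So an open subgroup
embeds as an open subgroup in the quotient by the Melnikov subgroup, which is a product of finite
simple groups.

In the second factor, the quasi-center is abelian. The factor is locally the product of an abelian
group and a group with trivial quasi-center, and these have virtual normal complements. An infinite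
product of finite simple groups has quasi-central torsion, so Melnikov subgroups are open here. It
follows that a directed family of closed normal subgroups generates an open subgroup topologically
only if it has an open member (`HasLocalComplements.exists_isOpen_of_directedOn`). This finiteness
condition has two uses: by Zorn's lemma there are maximal closed normal subgroups of infinite index,
whose quotients are just infinite, and finitely many of their normal complements virtually generate
the group (`HasLocalComplements.exists_finset_justInfiniteFactors`). A minimal such set of
complements gives an open embedding into a finite product of just infinite quotients.
-/

open Topology Pointwise
open scoped commutatorElement

universe u

/-! ### Local isomorphisms and open direct products -/

section LocalIsomorphism

variable {G H K G' H' : Type*} [Group G] [TopologicalSpace G] [Group H] [TopologicalSpace H]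
  [Group K] [TopologicalSpace K] [Group G'] [TopologicalSpace G'] [Group H'] [TopologicalSpace H']

theorem LocallyIsomorphic.of_isOpenMap (f : G →* H) (hf : Continuous f)
    (hi : Function.Injective f) (ho : IsOpenMap f) : LocallyIsomorphic G H :=
  ⟨⊤, isOpen_univ, f.comp (Subgroup.subtype ⊤), hf.comp continuous_subtype_val,
    hi.comp Subtype.val_injective, ho.comp isOpen_univ.isOpenMap_subtype_val⟩

theorem isOpenMap_of_comp_injective {X Y Z : Type*} [TopologicalSpace X] [TopologicalSpace Y]
    [TopologicalSpace Z] {f : X → Y} {g : Y → Z} (hg : Continuous g) (hi : Function.Injective g)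
    (h : IsOpenMap (g ∘ f)) : IsOpenMap f := fun s hs => by
  rw [← hi.preimage_image (f '' s), ← Set.image_comp]
  exact (h s hs).preimage hg

theorem LocallyIsomorphic.symm (h : LocallyIsomorphic G H) : LocallyIsomorphic H G := by
  obtain ⟨U, hU, θ, hc, hi, ho⟩ := h
  let e : θ.range ≃* U := (MonoidHom.ofInjective hi).symm
  have he : ∀ x, θ (e x) = x := fun x =>
    congrArg Subtype.val ((MonoidHom.ofInjective hi).apply_symm_apply x)
  have he' : ∀ y, e ⟨θ y, ⟨y, rfl⟩⟩ = y := fun y => hi (he _)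
  refine ⟨θ.range, by simpa using ho.isOpen_range, U.subtype.comp e.toMonoidHom, ?_, ?_, ?_⟩
  · refine continuous_subtype_val.comp (continuous_def.2 fun s hs => ⟨θ '' s, ho s hs, ?_⟩)
    apply Set.ext
    rintro ⟨_, x, rfl⟩
    change θ x ∈ θ '' s ↔ e ⟨θ x, _⟩ ∈ s
    rw [he', hi.mem_set_image]
  · exact Subtype.val_injective.comp e.injective
  · refine hU.isOpenMap_subtype_val.comp fun s hs => ?_
    obtain ⟨t, ht, rfl⟩ := hs
    have : e '' (Subtype.val ⁻¹' t) = θ ⁻¹' t := by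
      ext x
      constructor
      · rintro ⟨y, hy, rfl⟩
        exact Set.mem_preimage.2 ((he y).symm ▸ hy)
      · intro hx
        exact ⟨⟨θ x, ⟨x, rfl⟩⟩, hx, he' x⟩
    exact this ▸ ht.preimage hc

theorem LocallyIsomorphic.trans (h : LocallyIsomorphic G H) (h' : LocallyIsomorphic H K) :
    LocallyIsomorphic G K := by
  obtain ⟨U, hU, θ, hc, hi, ho⟩ := h
  obtain ⟨V, hV, φ, hc', hi', ho'⟩ := h'
  have hle : (V.comap θ).map U.subtype ≤ U := Subgroup.map_subtype_le _
  have hmem : ∀ x (hx : x ∈ (V.comap θ).map U.subtype), θ ⟨x, hle hx⟩ ∈ V := by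
    rintro _ ⟨y, hy, rfl⟩; exact hy
  let ψ : ((V.comap θ).map U.subtype : Subgroup G) →* V :=
    (θ.comp (Subgroup.inclusion hle)).codRestrict V fun x => hmem x x.2
  have hW : IsOpen (((V.comap θ).map U.subtype : Subgroup G) : Set G) :=
    hU.isOpenMap_subtype_val _ (hV.preimage hc)
  have hcont : Continuous (Subgroup.inclusion hle) := continuous_subtype_val.subtype_mk _
  refine ⟨_, hW, φ.comp ψ, hc'.comp ((hc.comp hcont).subtype_mk _), hi'.comp ?_, ho'.comp ?_⟩
  · intro x y hxy
    exact Subgroup.inclusion_injective hle (hi (congrArg Subtype.val hxy))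
  · exact isOpenMap_of_comp_injective continuous_subtype_val Subtype.val_injective
      (ho.comp (isOpenMap_of_comp_injective continuous_subtype_val Subtype.val_injective
        hW.isOpenMap_subtype_val))

theorem LocallyIsomorphic.prod (h : LocallyIsomorphic G H) (h' : LocallyIsomorphic G' H') :
    LocallyIsomorphic (G × G') (H × H') := by
  obtain ⟨U, hU, θ, hc, hi, ho⟩ := h
  obtain ⟨V, hV, φ, hc', hi', ho'⟩ := h'
  have hopen : IsOpen ((U.prod V : Subgroup (G × G')) : Set (G × G')) := by
    rw [Subgroup.coe_prod]; exact hU.prod hV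
  let p : U.prod V →* U := ((MonoidHom.fst G G').comp (U.prod V).subtype).codRestrict U
    fun x => x.2.1
  let q : U.prod V →* V := ((MonoidHom.snd G G').comp (U.prod V).subtype).codRestrict V
    fun x => x.2.2
  have hp : Continuous p := (continuous_fst.comp continuous_subtype_val).subtype_mk _
  have hq : Continuous q := (continuous_snd.comp continuous_subtype_val).subtype_mk _
  refine ⟨U.prod V, hopen, (θ.comp p).prod (φ.comp q), (hc.comp hp).prodMk (hc'.comp hq), ?_, ?_⟩
  · intro x y hxy
    have h1 := hi (congrArg Prod.fst hxy)
    have h2 := hi' (congrArg Prod.snd hxy)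
    exact Subtype.ext (Prod.ext (congrArg Subtype.val h1) (congrArg Subtype.val h2))
  · have : IsOpenMap fun x : U.prod V => (p x, q x) :=
      isOpenMap_of_comp_injective (g := Prod.map Subtype.val Subtype.val)
        (continuous_subtype_val.prodMap continuous_subtype_val)
        (Subtype.val_injective.prodMap Subtype.val_injective) hopen.isOpenMap_subtype_val
    exact (ho.prodMap ho').comp this

/-- An injective continuous map from a compact space with open range is open. -/
theorem isOpenMap_of_injective_of_isOpen_range {X Y : Type*} [TopologicalSpace X]
    [TopologicalSpace Y] [CompactSpace X] [T2Space Y] {f : X → Y} (hf : Continuous f)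
    (hi : Function.Injective f) (ho : IsOpen (Set.range f)) : IsOpenMap f :=
  (Topology.IsOpenEmbedding.mk (hf.isClosedEmbedding hi).isEmbedding ho).isOpenMap

theorem LocallyIsomorphic.of_isOpen_range [CompactSpace G] [T2Space H] (f : G →* H)
    (hf : Continuous f) (hi : Function.Injective f) (ho : IsOpen (Set.range f)) :
    LocallyIsomorphic G H :=
  .of_isOpenMap f hf hi (isOpenMap_of_injective_of_isOpen_range hf hi ho)

end LocalIsomorphism

section OpenDirectProduct

variable {G : Type*} [Group G]

theorem coe_sup_of_commute {L B : Subgroup G} (h : ∀ l ∈ L, ∀ b ∈ B, l * b = b * l) :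
    ((L ⊔ B : Subgroup G) : Set G) = L * B := by
  refine Subgroup.coe_mul_of_right_le_normalizer_left L B fun b hb => ?_
  rw [Subgroup.mem_normalizer_iff]
  intro l
  constructor
  · intro hl
    rwa [← h l hl b hb, mul_inv_cancel_right]
  · intro hl
    have := h _ hl b hb
    rw [inv_mul_cancel_right, mul_assoc, mul_left_cancel_iff] at this
    rw [this]
    rwa [← mul_assoc]

theorem mem_sup_of_commute {L B : Subgroup G} (h : ∀ l ∈ L, ∀ b ∈ B, l * b = b * l) {x : G} :
    x ∈ L ⊔ B ↔ ∃ l ∈ L, ∃ b ∈ B, l * b = x := by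
  rw [← SetLike.mem_coe, coe_sup_of_commute h, Set.mem_mul]
  rfl

theorem eq_and_eq_of_mul_eq_mul {L B : Subgroup G} (h : L ⊓ B = ⊥) {l l' b b' : G} (hl : l ∈ L)
    (hl' : l' ∈ L) (hb : b ∈ B) (hb' : b' ∈ B) (e : l * b = l' * b') : l = l' ∧ b = b' := by
  have e' : l'⁻¹ * l = b' * b⁻¹ := by
    rw [inv_mul_eq_iff_eq_mul, ← mul_assoc, ← e, mul_inv_cancel_right]
  have h1 : l'⁻¹ * l ∈ L ⊓ B :=
    ⟨L.mul_mem (L.inv_mem hl') hl, e' ▸ B.mul_mem hb' (B.inv_mem hb)⟩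
  rw [h, Subgroup.mem_bot] at h1
  have h2 : l = l' := (inv_mul_eq_one.1 h1).symm
  subst h2
  exact ⟨rfl, mul_left_cancel e⟩

variable [TopologicalSpace G]

/-- The compact subgroups `L` and `B` commute, meet trivially, and generate an open subgroup,
which is then their direct product, algebraically and topologically. -/
structure IsOpenDirectProduct (L B : Subgroup G) : Prop where
  isCompact_left : IsCompact (L : Set G)
  isCompact_right : IsCompact (B : Set G)
  comm : ∀ l ∈ L, ∀ b ∈ B, l * b = b * l
  disjoint : L ⊓ B = ⊥
  isOpen_sup : IsOpen ((L ⊔ B : Subgroup G) : Set G)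

/-- A compact reformulation of property (LD): every closed subgroup `K` with open normalizer
contains a compact subgroup `L` that has a complementary direct factor `B` in some open subgroup,
where moreover `B` avoids `K`. -/
def HasLocalComplements (G : Type*) [Group G] [TopologicalSpace G] : Prop :=
  ∀ K : Subgroup G, IsClosed (K : Set G) → IsOpen (Subgroup.normalizer (K : Set G) : Set G) →
    ∃ L B : Subgroup G, L ≤ K ∧ K ⊓ B = ⊥ ∧ IsOpenDirectProduct L B

namespace IsOpenDirectProduct

variable {L B : Subgroup G}

theorem mem_sup (h : IsOpenDirectProduct L B) {x : G} :
    x ∈ L ⊔ B ↔ ∃ l ∈ L, ∃ b ∈ B, l * b = x := mem_sup_of_commute h.comm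

theorem symm (h : IsOpenDirectProduct L B) : IsOpenDirectProduct B L :=
  ⟨h.2, h.1, fun b hb l hl => (h.comm l hl b hb).symm, inf_comm L B ▸ h.disjoint,
    sup_comm L B ▸ h.isOpen_sup⟩

/-- The multiplication map from the direct product onto an open subgroup. -/
def mulHom (h : IsOpenDirectProduct L B) : L × B →* G where
  toFun p := p.1 * p.2
  map_one' := by simp
  map_mul' p q := by
    simp only [Prod.fst_mul, Prod.snd_mul, Subgroup.coe_mul, mul_assoc]
    rw [← mul_assoc (q.1 : G), h.comm q.1 q.1.2 p.2 p.2.2, mul_assoc]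

theorem mulHom_injective (h : IsOpenDirectProduct L B) : Function.Injective h.mulHom := by
  intro p q e
  obtain ⟨h1, h2⟩ := eq_and_eq_of_mul_eq_mul h.disjoint p.1.2 q.1.2 p.2.2 q.2.2 e
  exact Prod.ext (Subtype.ext h1) (Subtype.ext h2)

theorem range_mulHom (h : IsOpenDirectProduct L B) : h.mulHom.range = L ⊔ B := by
  ext x
  rw [h.mem_sup]
  constructor
  · rintro ⟨⟨l, b⟩, rfl⟩; exact ⟨l, l.2, b, b.2, rfl⟩
  · rintro ⟨l, hl, b, hb, rfl⟩; exact ⟨⟨⟨l, hl⟩, ⟨b, hb⟩⟩, rfl⟩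

variable [IsTopologicalGroup G]

theorem continuous_mulHom (h : IsOpenDirectProduct L B) : Continuous h.mulHom :=
  (continuous_subtype_val.comp continuous_fst).mul (continuous_subtype_val.comp continuous_snd)

variable [T2Space G]

/-- Both factors of an open direct product may be replaced by relatively open subgroups. -/
theorem shrink (h : IsOpenDirectProduct L B) {L' B' : Subgroup G} (hL : L' ≤ L) (hB : B' ≤ B)
    {W : Set G} (hW : IsOpen W) (h1 : 1 ∈ W) (hLW : (L : Set G) ∩ W ⊆ L')
    (hBW : (B : Set G) ∩ W ⊆ B') : IsOpenDirectProduct L' B' := by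
  have key : ∀ A A' : Subgroup G, IsCompact (A : Set G) → A' ≤ A → (A : Set G) ∩ W ⊆ A' →
      IsCompact (A' : Set G) ∧ IsCompact ((A : Set G) \ A') := by
    intro A A' hA hle hAW
    have : IsOpen (A'.subgroupOf A : Set A) := by
      refine Subgroup.isOpen_of_mem_nhds (g := 1) _
        (Filter.mem_of_superset ((hW.preimage continuous_subtype_val).mem_nhds h1) ?_)
      intro x hx
      exact hAW ⟨x.2, hx⟩
    have hc : CompactSpace A := isCompact_iff_compactSpace.1 hA
    constructor
    · have := ((Subgroup.isClosed_of_isOpen _ this).isCompact).image continuous_subtype_val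
      convert this using 1
      ext x
      simp only [SetLike.mem_coe, Set.mem_image, Subtype.exists, Subgroup.mem_subgroupOf,
        exists_and_right, exists_eq_right]
      exact ⟨fun hx => ⟨hle hx, hx⟩, fun ⟨_, hx⟩ => hx⟩
    · have := (this.isClosed_compl.isCompact).image continuous_subtype_val
      convert this using 1
      ext x
      simp only [SetLike.mem_coe, Set.mem_image, Subtype.exists, Subgroup.mem_subgroupOf,
        exists_and_right, exists_eq_right, Set.mem_sdiff, Set.mem_compl_iff]
      exact ⟨fun hx => ⟨hx.1, hx.2⟩, fun ⟨h, hx⟩ => ⟨h, hx⟩⟩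
  obtain ⟨hL', hLd⟩ := key L L' h.1 hL hLW
  obtain ⟨hB', hBd⟩ := key B B' h.2 hB hBW
  have hcomm : ∀ l ∈ L', ∀ b ∈ B', l * b = b * l := fun l hl b hb => h.comm l (hL hl) b (hB hb)
  refine ⟨hL', hB', hcomm, le_bot_iff.1 (h.disjoint ▸ inf_le_inf hL hB), ?_⟩
  have heq : ((L' ⊔ B' : Subgroup G) : Set G) = ((L ⊔ B : Subgroup G) : Set G) ∩
      (((L : Set G) \ L') * B ∪ L * ((B : Set G) \ B'))ᶜ := by
    ext x
    constructor
    · intro hx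
      obtain ⟨l, hl, b, hb, rfl⟩ := (mem_sup_of_commute hcomm).1 hx
      refine ⟨sup_le_sup hL hB hx, ?_⟩
      rintro (⟨l', hl', b', hb', e⟩ | ⟨l', hl', b', hb', e⟩)
      · exact hl'.2 ((eq_and_eq_of_mul_eq_mul h.disjoint hl'.1 (hL hl) hb' (hB hb) e).1 ▸ hl)
      · exact hb'.2 ((eq_and_eq_of_mul_eq_mul h.disjoint hl' (hL hl) hb'.1 (hB hb) e).2 ▸ hb)
    · rintro ⟨hx, hn⟩
      obtain ⟨l, hl, b, hb, rfl⟩ := h.mem_sup.1 hx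
      have h1 : l ∈ L' := by
        by_contra hl'
        exact hn (Or.inl ⟨l, ⟨hl, hl'⟩, b, hb, rfl⟩)
      have h2 : b ∈ B' := by
        by_contra hb'
        exact hn (Or.inr ⟨l, hl, b, ⟨hb, hb'⟩, rfl⟩)
      exact Subgroup.mul_mem_sup h1 h2
  rw [heq]
  exact h.isOpen_sup.inter ((hLd.mul h.2).union (h.1.mul hBd)).isClosed.isOpen_compl

theorem inf_isOpen (h : IsOpenDirectProduct L B) {W : Subgroup G} (hW : IsOpen (W : Set G)) :
    IsOpenDirectProduct (L ⊓ W) (B ⊓ W) :=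
  h.shrink inf_le_left inf_le_left hW W.one_mem (fun _ hx => hx) (fun _ hx => hx)

theorem isOpenMap_mulHom (h : IsOpenDirectProduct L B) : IsOpenMap h.mulHom := by
  have := isCompact_iff_compactSpace.1 h.1
  have := isCompact_iff_compactSpace.1 h.2
  refine isOpenMap_of_injective_of_isOpen_range h.continuous_mulHom h.mulHom_injective ?_
  rw [← MonoidHom.coe_range, h.range_mulHom]
  exact h.isOpen_sup

theorem locallyIsomorphic (h : IsOpenDirectProduct L B) : LocallyIsomorphic (L × B) G :=
  .of_isOpenMap _ h.continuous_mulHom h.mulHom_injective h.isOpenMap_mulHom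

theorem isLocalDirectFactor (h : IsOpenDirectProduct L B) : IsLocalDirectFactor L := by
  have := isCompact_iff_compactSpace.1 h.1
  have := isCompact_iff_compactSpace.1 h.2
  let e : L × B ≃* (L ⊔ B : Subgroup G) :=
    (MonoidHom.ofInjective h.mulHom_injective).trans (MulEquiv.subgroupCongr h.range_mulHom)
  have he : Continuous e := h.continuous_mulHom.subtype_mk _
  let e' : L × B ≃ₜ (L ⊔ B : Subgroup G) := he.homeoOfEquivCompactToT2 (f := e.toEquiv)
  exact ⟨L ⊔ B, h.isOpen_sup, B, ⟨e, he, e'.continuous_symm⟩, fun p => rfl⟩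

end IsOpenDirectProduct

end OpenDirectProduct

/-! ### Local invariance of property (LD) -/

/-- Van Dantzig's theorem: compact open subgroups form a basis of neighbourhoods of `1`. -/
theorem exists_isCompact_isOpen_subgroup {G : Type*} [Group G] [TopologicalSpace G]
    [IsTopologicalGroup G] [T2Space G] [LocallyCompactSpace G] [TotallyDisconnectedSpace G]
    {W : Set G} (hW : W ∈ 𝓝 (1 : G)) :
    ∃ C : Subgroup G, IsCompact (C : Set G) ∧ IsOpen (C : Set G) ∧ (C : Set G) ⊆ W := by
  obtain ⟨A, hA, hAW, hAc⟩ := local_compact_nhds hW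
  obtain ⟨X, hX, h1X, hXA⟩ :=
    loc_compact_Haus_tot_disc_of_zero_dim.mem_nhds_iff.1 hA
  have hXc : IsCompact X := hAc.of_isClosed_subset hX.1 hXA
  obtain ⟨V, hV, hXV⟩ := compact_open_separated_mul_right hXc hX.2 le_rfl
  have hV' : V ∩ V⁻¹ ∈ 𝓝 (1 : G) := Filter.inter_mem hV (inv_mem_nhds_one G hV)
  have hsub : (Subgroup.closure (V ∩ V⁻¹) : Set G) ⊆ X := by
    intro x hx
    induction hx using Subgroup.closure_induction_right with
    | one => exact h1X
    | mul_right x _ y hy h => exact hXV ⟨x, h, y, hy.1, rfl⟩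
    | mul_inv_cancel x _ y hy h => exact hXV ⟨x, h, y⁻¹, hy.2, rfl⟩
  have hopen : IsOpen (Subgroup.closure (V ∩ V⁻¹) : Set G) :=
    Subgroup.isOpen_of_mem_nhds (g := 1) _ (Filter.mem_of_superset hV' Subgroup.subset_closure)
  exact ⟨_, hXc.of_isClosed_subset (Subgroup.isClosed_of_isOpen _ hopen) hsub, hopen,
    hsub.trans (hXA.trans hAW)⟩

variable {G H : Type*} [Group G] [TopologicalSpace G] [IsTopologicalGroup G]
  [Group H] [TopologicalSpace H]

theorem HasLocalComplements.propertyLD [T2Space G] (h : HasLocalComplements G) :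
    PropertyLD G := by
  intro K hK hN
  obtain ⟨L, B, hLK, hKB, hLB⟩ := h K hK hN
  refine ⟨L, hLK, ?_, hLB.isLocalDirectFactor⟩
  convert hLB.isOpen_sup.preimage (continuous_subtype_val (p := (· ∈ K))) using 1
  ext ⟨x, hx⟩
  constructor
  · exact fun hxL => (le_sup_left : L ≤ L ⊔ B) hxL
  · intro hxO
    obtain ⟨l, hl, b, hb, rfl⟩ := hLB.mem_sup.1 hxO
    have : b ∈ K ⊓ B := ⟨(K.mul_mem_cancel_left (hLK hl)).1 hx, hb⟩
    rw [hKB, Subgroup.mem_bot] at this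
    subst this
    simpa [Subgroup.mem_subgroupOf] using hl

theorem PropertyLD.hasLocalComplements [T2Space G] [LocallyCompactSpace G]
    [TotallyDisconnectedSpace G] (h : PropertyLD G) : HasLocalComplements G := by
  intro K hK hN
  obtain ⟨L, hLK, ⟨W, hW, hWL⟩, O, hO, B, e, he⟩ := h K hK hN
  have h1W : (1 : G) ∈ W := by
    have : (1 : K) ∈ (Subtype.val ⁻¹' W : Set K) := by rw [hWL]; exact one_mem _
    exact this
  obtain ⟨C, hC, hCo, hCW⟩ := exists_isCompact_isOpen_subgroup
    ((hW.inter hO).mem_nhds ⟨h1W, O.one_mem⟩)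
  have hOc : IsClosed (O : Set G) := Subgroup.isClosed_of_isOpen _ hO
  have heL : ∀ l : L, (e (l, 1) : G) = l := fun l => by simp [he]
  have heB : ∀ b : B, (e (1, b) : G) = b := fun b => by simp [he]
  have hcomm : ∀ l ∈ L, ∀ b ∈ B, l * b = b * l := by
    intro l hl b hb
    have h1 : e (⟨l, hl⟩, 1) * e (1, ⟨b, hb⟩) = e (1, ⟨b, hb⟩) * e (⟨l, hl⟩, 1) := by
      rw [← map_mul, ← map_mul]; simp
    simpa [heL, heB] using congrArg Subtype.val h1
  have hdisj : L ⊓ B = ⊥ := by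
    rw [eq_bot_iff]
    rintro x ⟨hxL, hxB⟩
    have h1 : e (⟨x, hxL⟩, ⟨x, hxB⟩⁻¹) = 1 := Subtype.ext (by rw [he]; simp)
    rw [map_eq_one_iff e e.injective] at h1
    exact congrArg Subtype.val (congrArg Prod.fst h1)
  have hLc : IsClosed (L : Set G) := by
    have : IsClosed {x : O | (e.symm x).2 = 1} :=
      isClosed_singleton.preimage (continuous_snd.comp e.symm.continuous)
    convert hOc.isClosedMap_subtype_val _ this using 1
    ext x
    constructor
    · intro hx
      exact ⟨e (⟨x, hx⟩, 1), by simp, heL ⟨x, hx⟩⟩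
    · rintro ⟨y, hy, rfl⟩
      obtain ⟨⟨l, b⟩, rfl⟩ := e.surjective y
      have : b = 1 := by simpa using hy
      subst this
      rw [heL]; exact l.2
  have hBc : IsClosed (B : Set G) := by
    have : IsClosed {x : O | (e.symm x).1 = 1} :=
      isClosed_singleton.preimage (continuous_fst.comp e.symm.continuous)
    convert hOc.isClosedMap_subtype_val _ this using 1
    ext x
    constructor
    · intro hx
      exact ⟨e (1, ⟨x, hx⟩), by simp, heB ⟨x, hx⟩⟩
    · rintro ⟨y, hy, rfl⟩
      obtain ⟨⟨l, b⟩, rfl⟩ := e.surjective y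
      have : l = 1 := by simpa using hy
      subst this
      rw [heB]; exact b.2
  refine ⟨L ⊓ C, B ⊓ C, inf_le_left.trans hLK, ?_, ?_, ?_, ?_, ?_, ?_⟩
  · rw [eq_bot_iff, ← hdisj]
    rintro x ⟨hxK, hxB, hxC⟩
    have : (⟨x, hxK⟩ : K) ∈ (L.subgroupOf K : Set K) := by rw [← hWL]; exact (hCW hxC).1
    exact ⟨this, hxB⟩
  · exact hC.inter_left hLc
  · exact hC.inter_left hBc
  · exact fun l hl b hb => hcomm l hl.1 b hb.1
  · exact le_bot_iff.1 (hdisj ▸ inf_le_inf inf_le_left inf_le_left)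
  · have hV : IsOpen {p : L × B | (p.1 : G) ∈ C ∧ (p.2 : G) ∈ C} :=
      (hCo.preimage (continuous_subtype_val.comp continuous_fst)).inter
        (hCo.preimage (continuous_subtype_val.comp continuous_snd))
    have := hO.isOpenMap_subtype_val _ (e.toHomeomorph.isOpenMap _ hV)
    refine Subgroup.isOpen_of_mem_nhds (g := 1) _ (Filter.mem_of_superset
      (this.mem_nhds ⟨1, ⟨1, ⟨C.one_mem, C.one_mem⟩, map_one e⟩, rfl⟩) ?_)
    rintro _ ⟨_, ⟨⟨l, b⟩, ⟨hl, hb⟩, rfl⟩, rfl⟩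
    change ((e (l, b) : O) : G) ∈ _
    rw [he]
    exact Subgroup.mul_mem_sup ⟨l.2, hl⟩ ⟨b.2, hb⟩

theorem HasLocalComplements.of_locallyIsomorphic [T2Space G] (h : HasLocalComplements G)
    (hGH : LocallyIsomorphic G H) : HasLocalComplements H := by
  obtain ⟨U, hU, θ, hc, hi, ho⟩ := hGH
  intro K hK hN
  set K' : Subgroup G := (K.comap θ).map U.subtype with hK'
  have hmem : ∀ x (hx : x ∈ U), x ∈ K' ↔ θ ⟨x, hx⟩ ∈ K := by
    intro x hx
    constructor
    · rintro ⟨y, hy, rfl⟩; exact hy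
    · intro h; exact ⟨⟨x, hx⟩, h, rfl⟩
  have hK'U : K' ≤ U := Subgroup.map_subtype_le _
  have hclosed : IsClosed (K' : Set G) :=
    (Subgroup.isClosed_of_isOpen _ hU).isClosedMap_subtype_val _ (hK.preimage hc)
  have hnorm : IsOpen (Subgroup.normalizer (K' : Set G) : Set G) := by
    have h1 : IsOpen ((((Subgroup.normalizer (K : Set H)).comap θ).map U.subtype : Subgroup G) :
      Set G) := hU.isOpenMap_subtype_val _ (hN.preimage hc)
    refine Subgroup.isOpen_mono ?_ h1
    rintro _ ⟨n, hn, rfl⟩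
    rw [Subgroup.mem_normalizer_iff]
    intro x
    have hn' := Subgroup.mem_normalizer_iff.1 (show θ n ∈ Subgroup.normalizer (K : Set H) from hn)
    have key : ∀ hx : x ∈ U, x ∈ K' ↔ (n : G) * x * (n : G)⁻¹ ∈ K' := by
      intro hx
      rw [hmem x hx, hmem _ (U.mul_mem (U.mul_mem n.2 hx) (U.inv_mem n.2)), hn']
      have : θ ⟨(n : G) * x * (n : G)⁻¹, U.mul_mem (U.mul_mem n.2 hx) (U.inv_mem n.2)⟩ =
          θ n * θ ⟨x, hx⟩ * (θ n)⁻¹ := by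
        rw [← map_inv, ← map_mul, ← map_mul]; rfl
      rw [this]
    refine ⟨fun hx => (key (hK'U hx)).1 hx, fun hx => (key ?_).2 hx⟩
    have h2 := U.mul_mem (U.mul_mem (U.inv_mem n.2) (hK'U hx)) n.2
    simpa [mul_assoc] using h2
  obtain ⟨L, B, hLK, hKB, hLB⟩ := h K' hclosed hnorm
  have hLB' := hLB.inf_isOpen hU
  have hcomp : ∀ A : Subgroup G, IsCompact (A : Set G) → A ≤ U →
      IsCompact (((A.subgroupOf U).map θ : Subgroup H) : Set H) := by
    intro A hA hAU
    refine IsCompact.image (Topology.IsInducing.subtypeVal.isCompact_preimage_iff ?_ |>.2 hA) hc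
    intro x hx; exact ⟨⟨x, hAU hx⟩, rfl⟩
  refine ⟨((L ⊓ U).subgroupOf U).map θ, ((B ⊓ U).subgroupOf U).map θ, ?_, ?_,
    hcomp _ hLB'.1 inf_le_right, hcomp _ hLB'.2 inf_le_right, ?_, ?_, ?_⟩
  · rintro _ ⟨x, hx, rfl⟩
    exact (hmem x x.2).1 (hLK hx.1)
  · rw [eq_bot_iff]
    rintro _ ⟨hxK, x, hx, rfl⟩
    have : (x : G) ∈ K' ⊓ B := ⟨(hmem x x.2).2 hxK, hx.1⟩
    rw [hKB, Subgroup.mem_bot] at this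
    rw [show x = 1 from Subtype.ext this, map_one]
    exact one_mem _
  · rintro _ ⟨x, hx, rfl⟩ _ ⟨y, hy, rfl⟩
    rw [← map_mul, ← map_mul]
    exact congrArg θ (Subtype.ext (hLB'.comm x hx y hy))
  · rw [← Subgroup.map_inf _ _ _ hi, Subgroup.subgroupOf, Subgroup.subgroupOf,
      ← Subgroup.comap_inf, hLB'.disjoint]
    simp
  · have h1 : IsOpen ((((L ⊓ U) ⊔ (B ⊓ U)).subgroupOf U).map θ : Set H) :=
      ho _ (hLB'.isOpen_sup.preimage continuous_subtype_val)
    rwa [Subgroup.subgroupOf_sup inf_le_right inf_le_right, Subgroup.map_sup] at h1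

/-- The direct factors of an open subgroup inherit local complements. -/
theorem HasLocalComplements.factor [T2Space G] (h : HasLocalComplements G) {L B : Subgroup G}
    (hLB : IsOpenDirectProduct L B) : HasLocalComplements L := by
  intro K hK hN
  have hLcl : IsClosed (L : Set G) := hLB.1.isClosed
  set K' : Subgroup G := K.map L.subtype with hK'
  have hclosed : IsClosed (K' : Set G) := hLcl.isClosedMap_subtype_val _ hK
  have hK'L : K' ≤ L := Subgroup.map_subtype_le _
  have hnorm : IsOpen (Subgroup.normalizer (K' : Set G) : Set G) := by
    obtain ⟨W, hW, hWN⟩ := hN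
    have h1 : (1 : L) ∈ (Subtype.val ⁻¹' W : Set L) := by rw [hWN]; exact one_mem _
    have h2 := hLB.shrink (L' := (Subgroup.normalizer (K : Set L)).map L.subtype) (B' := B)
      (Subgroup.map_subtype_le _) le_rfl hW h1 (fun x hx => by
        have : (⟨x, hx.1⟩ : L) ∈ (Subtype.val ⁻¹' W : Set L) := hx.2
        rw [hWN] at this
        exact ⟨_, this, rfl⟩) (fun x hx => hx.1)
    refine Subgroup.isOpen_mono (sup_le ?_ ?_) h2.isOpen_sup
    · exact Subgroup.le_normalizer_map _
    · intro b hb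
      rw [Subgroup.mem_normalizer_iff]
      intro x
      constructor
      · intro hx
        rwa [← hLB.comm x (hK'L hx) b hb, mul_inv_cancel_right]
      · intro hx
        have := hLB.comm _ (hK'L hx) b hb
        rw [inv_mul_cancel_right, mul_assoc, mul_left_cancel_iff] at this
        rw [this]
        rwa [← mul_assoc]
  obtain ⟨L₁, B₁, hLK, hKB, h₁⟩ := h K' hclosed hnorm
  have hL₁ : L₁ ≤ L := hLK.trans hK'L
  refine ⟨L₁.subgroupOf L, B₁.subgroupOf L, ?_, ?_, ?_, ?_, ?_, ?_, ?_⟩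
  · intro x hx
    obtain ⟨y, hy, hyx⟩ := hLK hx
    rwa [← show y = x from Subtype.ext hyx]
  · rw [eq_bot_iff]
    rintro x ⟨hxK, hxB⟩
    have : (x : G) ∈ K' ⊓ B₁ := ⟨⟨x, hxK, rfl⟩, hxB⟩
    rw [hKB] at this
    exact Subtype.ext this
  · exact (hLcl.isClosedEmbedding_subtypeVal).isCompact_preimage h₁.1
  · exact (hLcl.isClosedEmbedding_subtypeVal).isCompact_preimage h₁.2
  · exact fun l hl b hb => Subtype.ext (h₁.comm l hl b hb)
  · rw [Subgroup.subgroupOf, Subgroup.subgroupOf, ← Subgroup.comap_inf, h₁.disjoint]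
    simp
  · refine Subgroup.isOpen_mono (H₁ := (L₁ ⊔ B₁).subgroupOf L) ?_
      (h₁.isOpen_sup.preimage continuous_subtype_val)
    intro x hx
    obtain ⟨l, hl, b, hb, e⟩ := h₁.mem_sup.1 hx
    have hbL : b ∈ L := (L.mul_mem_cancel_left (hL₁ hl)).1 (e ▸ x.2)
    rw [show x = ⟨l, hL₁ hl⟩ * ⟨b, hbL⟩ from Subtype.ext e.symm]
    exact Subgroup.mul_mem_sup (show (⟨l, hL₁ hl⟩ : L) ∈ L₁.subgroupOf L from hl)
      (show (⟨b, hbL⟩ : L) ∈ B₁.subgroupOf L from hb)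

/-! ### Normally complemented groups -/

section Lattice

variable {U : Type*} [Group U]

theorem inf_sup_eq_sup_inf_of_le {F K : Subgroup U} (C : Subgroup U) [C.Normal] (h : F ≤ K) :
    K ⊓ (F ⊔ C) = F ⊔ (K ⊓ C) := by
  apply le_antisymm
  · rintro x ⟨hxK, hx⟩
    obtain ⟨f, hf, c, hc, rfl⟩ := Subgroup.mem_sup_of_normal_right.1 hx
    exact Subgroup.mul_mem_sup hf ⟨(K.mul_mem_cancel_left (h hf)).1 hxK, hc⟩
  · exact sup_le (le_inf h le_sup_left) (inf_le_inf_left _ le_sup_right)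

theorem relIndex_ne_zero_of_index {M : Subgroup U} (h : M.index ≠ 0) (A : Subgroup U) :
    M.relIndex A ≠ 0 := fun h0 => h (by
  rw [← Subgroup.relIndex_top_right]
  exact Subgroup.relIndex_eq_zero_of_le_right le_top h0)

theorem relIndex_sup_ne_zero (A : Subgroup U) {B' B : Subgroup U} [A.Normal] [B'.Normal]
    (h : B'.relIndex B ≠ 0) : (A ⊔ B').relIndex (A ⊔ B) ≠ 0 := by
  have h1 : (A ⊔ B').relIndex B ≠ 0 :=
    fun h0 => h (Subgroup.relIndex_eq_zero_of_le_left le_sup_right h0)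
  rw [← Subgroup.relIndex_sup_right] at h1
  exact fun h0 => h1 (Subgroup.relIndex_eq_zero_of_le_right
    (sup_le (le_sup_left.trans le_sup_right) le_sup_left) h0)

variable [TopologicalSpace U]

/-- Every closed normal subgroup of `U` inside `X` is complemented, up to finite index in `X`, by
another closed normal subgroup of `U` inside `X`. As indices are natural numbers and infinite ones
are `0`, a nonzero relative index is a finite one. -/
def NormallyComplementedIn (X : Subgroup U) : Prop :=
  ∀ K : Subgroup U, K.Normal → IsClosed (K : Set U) → K ≤ X →
    ∃ B : Subgroup U, B.Normal ∧ IsClosed (B : Set U) ∧ B ≤ X ∧ K ⊓ B = ⊥ ∧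
      (K ⊔ B).relIndex X ≠ 0

/-- Every closed normal subgroup of `U` is complemented, up to finite index, by another closed
normal subgroup. -/
def NormallyComplemented (U : Type*) [Group U] [TopologicalSpace U] : Prop :=
  NormallyComplementedIn (⊤ : Subgroup U)

variable [IsTopologicalGroup U]

theorem isOpen_of_isClosed_of_index_ne_zero {K : Subgroup U} (h : IsClosed (K : Set U))
    (hi : K.index ≠ 0) : IsOpen (K : Set U) :=
  have : K.FiniteIndex := ⟨hi⟩
  Subgroup.isOpen_of_isClosed_of_finiteIndex K h

variable [CompactSpace U]

theorem index_ne_zero_of_isOpen {K : Subgroup U} (h : IsOpen (K : Set U)) : K.index ≠ 0 := by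
  have := Subgroup.quotient_finite_of_isOpen K h
  exact Subgroup.index_ne_zero_of_finite

variable [T2Space U]

theorem isClosed_sup_of_normal {H K : Subgroup U} [K.Normal] (hH : IsClosed (H : Set U))
    (hK : IsClosed (K : Set U)) : IsClosed ((H ⊔ K : Subgroup U) : Set U) := by
  rw [Subgroup.mul_normal]
  exact (hH.isCompact.mul hK.isCompact).isClosed

theorem NormallyComplementedIn.sup {X Y : Subgroup U} [X.Normal] [Y.Normal]
    (hXc : IsClosed (X : Set U)) (hYc : IsClosed (Y : Set U)) (hX : NormallyComplementedIn X)
    (hY : NormallyComplementedIn Y) : NormallyComplementedIn (X ⊔ Y) := by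
  intro K hK hKc hKXY
  obtain ⟨C, hC, hCc, hCX, hKC, hCi⟩ := hX ((K ⊔ Y) ⊓ X) inferInstance
    ((isClosed_sup_of_normal hKc hYc).inter hXc) inf_le_right
  obtain ⟨D, hD, hDc, hDY, hKD, hDi⟩ := hY (K ⊓ Y) inferInstance (hKc.inter hYc) inf_le_right
  refine ⟨C ⊔ D, inferInstance, isClosed_sup_of_normal hCc hDc, sup_le_sup hCX hDY, ?_, ?_⟩
  · rw [eq_bot_iff]
    rintro x ⟨hxK, hx⟩
    obtain ⟨c, hc, d, hd, rfl⟩ := Subgroup.mem_sup_of_normal_right.1 hx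
    have h1 : c ∈ (K ⊔ Y) ⊓ X ⊓ C := by
      refine ⟨⟨?_, hCX hc⟩, hc⟩
      have := Subgroup.mul_mem_sup hxK (Y.inv_mem (hDY hd))
      rwa [mul_inv_cancel_right] at this
    rw [hKC, Subgroup.mem_bot] at h1
    subst h1
    rw [one_mul] at hxK ⊢
    rw [← hKD]
    exact ⟨⟨hxK, hDY hd⟩, hd⟩
  · have h1 : (K ⊔ C ⊔ D).relIndex (K ⊔ C ⊔ Y) ≠ 0 := by
      have := relIndex_sup_ne_zero (K ⊔ C) hDi
      rwa [← sup_assoc, sup_eq_left.2 (inf_le_left.trans le_sup_left : K ⊓ Y ≤ K ⊔ C)] at this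
    have h2 : (K ⊔ C ⊔ Y).relIndex (X ⊔ Y) ≠ 0 := by
      have := relIndex_sup_ne_zero Y hCi
      rw [sup_comm Y X] at this
      refine fun h0 => this (Subgroup.relIndex_eq_zero_of_le_left ?_ h0)
      refine sup_le le_sup_right (sup_le (inf_le_left.trans ?_) ?_)
      · exact sup_le (le_sup_left.trans le_sup_left) le_sup_right
      · exact le_sup_right.trans le_sup_left
    rw [← sup_assoc]
    exact Subgroup.relIndex_ne_zero_trans h1 h2

end Lattice

/-- Normal complements pass to the image of an injective homomorphism if the conjugations of the
target restrict to conjugations of the source. -/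
theorem NormallyComplemented.range {A U : Type*} [Group A] [TopologicalSpace A] [CompactSpace A]
    [Group U] [TopologicalSpace U] [T2Space U] (h : NormallyComplemented A) {f : A →* U}
    (hf : Continuous f) (hi : Function.Injective f)
    (hconj : ∀ u, ∃ a, ∀ x, u * f x * u⁻¹ = f (a * x * a⁻¹)) : NormallyComplementedIn f.range := by
  intro K hK hKc hKf
  obtain ⟨B, hB, hBc, -, hKB, hBi⟩ := h (K.comap f) inferInstance (hKc.preimage hf) le_top
  have hKeq : (K.comap f).map f = K := Subgroup.map_comap_eq_self hKf
  refine ⟨B.map f, ⟨?_⟩, (hBc.isCompact.image hf).isClosed, Subgroup.map_le_range _ _, ?_, ?_⟩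
  · rintro _ ⟨b, hb, rfl⟩ u
    obtain ⟨a, ha⟩ := hconj u
    exact ⟨_, hB.conj_mem b hb a, (ha b).symm⟩
  · rw [← hKeq, ← Subgroup.map_inf _ _ _ hi, hKB, Subgroup.map_bot]
  · rw [← hKeq, ← Subgroup.map_sup, MonoidHom.range_eq_map,
      Subgroup.relIndex_map_map_of_injective _ _ hi]
    exact hBi

/-- Local complements exist as soon as the compact groups that are normally complemented and embed
as open subgroups are arbitrarily small. -/
theorem HasLocalComplements.of_basis {P : Type*} [Group P] [TopologicalSpace P]
    (h : ∀ O : Subgroup P, IsOpen (O : Set P) → ∃ (W : Type*) (_ : Group W) (_ : TopologicalSpace W)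
      (_ : IsTopologicalGroup W) (_ : CompactSpace W) (_ : T2Space W) (ι : W →* P), Continuous ι ∧
      Function.Injective ι ∧ IsOpenMap ι ∧ ι.range ≤ O ∧ NormallyComplemented W) :
    HasLocalComplements P := by
  intro K hK hN
  obtain ⟨W, _, _, _, _, _, ι, hc, hi, ho, hr, hW⟩ := h _ hN
  have hKn : (K.comap ι).Normal := by
    refine ⟨fun n hn g => ?_⟩
    have hg : ι g ∈ Subgroup.normalizer (K : Set P) := hr ⟨g, rfl⟩
    rw [Subgroup.mem_comap, map_mul, map_mul, map_inv]
    exact (Subgroup.mem_normalizer_iff.1 hg _).1 hn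
  obtain ⟨B, hB, hBc, -, hKB, hBi⟩ := hW (K.comap ι) hKn (hK.preimage hc) le_top
  have hcomm := Subgroup.commute_of_normal_of_disjoint _ _ hKn hB (disjoint_iff.2 hKB)
  refine ⟨(K.comap ι).map ι, B.map ι, Subgroup.map_comap_le _ _, ?_,
    (hK.preimage hc).isCompact.image hc, hBc.isCompact.image hc, ?_, ?_, ?_⟩
  · rw [eq_bot_iff]
    rintro _ ⟨hxK, x, hx, rfl⟩
    have : x ∈ K.comap ι ⊓ B := ⟨hxK, hx⟩
    rw [hKB, Subgroup.mem_bot] at this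
    simp [this]
  · rintro _ ⟨x, hx, rfl⟩ _ ⟨y, hy, rfl⟩
    rw [← map_mul, ← map_mul]
    exact congrArg ι (hcomm x y hx hy)
  · rw [← Subgroup.map_inf _ _ _ hi, hKB, Subgroup.map_bot]
  · rw [← Subgroup.map_sup]
    rw [Subgroup.relIndex_top_right] at hBi
    exact ho _ (isOpen_of_isClosed_of_index_ne_zero
      (isClosed_sup_of_normal (hK.preimage hc) hBc) hBi)

section Pi

variable {I : Type*} {H : I → Type*} [∀ i, Group (H i)]

/-- The subgroup of a product of groups consisting of the elements supported on `S`. -/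
def supportedOn (H : I → Type*) [∀ i, Group (H i)] (S : Set I) : Subgroup (∀ i, H i) where
  carrier := {x | ∀ i ∉ S, x i = 1}
  mul_mem' hx hy i hi := by rw [Pi.mul_apply, hx i hi, hy i hi, one_mul]
  one_mem' _ _ := rfl
  inv_mem' hx i hi := by rw [Pi.inv_apply, hx i hi, inv_one]

theorem mem_supportedOn {S : Set I} {x : ∀ i, H i} :
    x ∈ supportedOn H S ↔ ∀ i ∉ S, x i = 1 := Iff.rfl

instance (S : Set I) : (supportedOn H S).Normal :=
  ⟨fun x hx g i hi => by simp [mem_supportedOn.1 hx i hi]⟩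

variable [∀ i, TopologicalSpace (H i)]

theorem isClosed_supportedOn [∀ i, T2Space (H i)] (S : Set I) :
    IsClosed (supportedOn H S : Set (∀ i, H i)) := by
  have : (supportedOn H S : Set (∀ i, H i)) = ⋂ i ∈ Sᶜ, {x | x i = 1} := by
    ext x; simp [mem_supportedOn]
  rw [this]
  exact isClosed_biInter fun i _ => isClosed_singleton.preimage (continuous_apply i)

variable [∀ i, CompactSpace (H i)] [∀ i, T2Space (H i)]

theorem normallyComplementedIn_supportedOn_singleton {j : I}
    (h : NormallyComplemented (H j)) : NormallyComplementedIn (supportedOn H {j}) := by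
  classical
  have hrange : (MonoidHom.mulSingle H j).range = supportedOn H {j} := by
    ext x
    constructor
    · rintro ⟨a, rfl⟩ i hi
      exact Pi.mulSingle_eq_of_ne hi _
    · intro hx
      refine ⟨x j, funext fun i => ?_⟩
      rcases eq_or_ne i j with rfl | hij
      · simp
      · simp [Pi.mulSingle_eq_of_ne hij, hx i hij]
  rw [← hrange]
  refine h.range (continuous_mulSingle j) (Pi.mulSingle_injective j) fun u =>
    ⟨u j, fun x => funext fun i => ?_⟩
  rcases eq_or_ne i j with rfl | hij
  · simp
  · simp [Pi.mulSingle_eq_of_ne hij]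

variable [∀ i, IsTopologicalGroup (H i)]

/-- In a product of groups without proper nontrivial normal subgroups, every closed normal subgroup
is complemented by a subproduct: a minimal one among those generating the whole product with it. -/
theorem normallyComplementedIn_supportedOn_of_simple {S₀ : Set I}
    (h : ∀ i ∈ S₀, ∀ N : Subgroup (H i), N.Normal → N = ⊥ ∨ N = ⊤) :
    NormallyComplementedIn (supportedOn H S₀) := by
  intro K hK hKc hKS
  obtain ⟨S, hS, hmin⟩ := zorn_superset_nonempty
    {S : Set I | S ⊆ S₀ ∧ supportedOn H S₀ ≤ K ⊔ supportedOn H S} (by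
      intro c hc hchain hne
      refine ⟨⋂₀ c, ⟨?_, ?_⟩, fun s hs => Set.sInter_subset_of_mem hs⟩
      · obtain ⟨s, hs⟩ := hne
        exact (Set.sInter_subset_of_mem hs).trans (hc hs).1
      · intro x hx
        have : Nonempty c := hne.to_subtype
        obtain ⟨k, hk⟩ := IsCompact.nonempty_iInter_of_directed_nonempty_isCompact_isClosed
          (fun s : c => (K : Set (∀ i, H i)) ∩ {k | k⁻¹ * x ∈ supportedOn H s.1}) (by
            intro s t
            rcases hchain.total s.2 t.2 with hst | hst
            · exact ⟨s, fun k hk => hk,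
                fun k hk => ⟨hk.1, fun i hi => hk.2 i fun h' => hi (hst h')⟩⟩
            · exact ⟨t, fun k hk => ⟨hk.1, fun i hi => hk.2 i fun h' => hi (hst h')⟩,
                fun k hk => hk⟩)
          (fun s => by
            obtain ⟨k, hk, y, hy, hky⟩ := Subgroup.mem_sup_of_normal_right.1 ((hc s.2).2 hx)
            exact ⟨k, hk, by rw [← hky]; simpa using hy⟩)
          (fun s => (hKc.inter ((isClosed_supportedOn s.1).preimage (by fun_prop))).isCompact)
          (fun s => hKc.inter ((isClosed_supportedOn s.1).preimage (by fun_prop)))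
        rw [Set.mem_iInter] at hk
        have hkK : k ∈ K := (hk (Classical.arbitrary c)).1
        have hkx : k⁻¹ * x ∈ supportedOn H (⋂₀ c) := by
          intro i hi
          simp only [Set.mem_sInter, not_forall] at hi
          obtain ⟨s, hs, his⟩ := hi
          exact (hk ⟨s, hs⟩).2 i his
        simpa using Subgroup.mul_mem_sup hkK hkx)
    S₀ ⟨le_rfl, le_sup_right⟩
  have hSS := hmin.prop
  refine ⟨supportedOn H S, inferInstance, isClosed_supportedOn S,
    fun x hx i hi => hx i fun h' => hi (hS h'), ?_, ?_⟩
  · rw [Subgroup.eq_bot_iff_forall]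
    rintro k hk
    by_contra hk1
    obtain ⟨j, hj⟩ := Function.ne_iff.1 hk1
    have hjS : j ∈ S := by
      by_contra hjS
      exact hj (hk.2 j hjS)
    have hsurj : Function.Surjective (Pi.evalMonoidHom H j) := Function.surjective_eval j
    have htop : (K ⊓ supportedOn H S).map (Pi.evalMonoidHom H j) = ⊤ := by
      refine (h j (hS hjS) _ ((inferInstance : (K ⊓ supportedOn H S).Normal).map _
        hsurj)).resolve_left fun hbot => hj ?_
      have : k j ∈ (K ⊓ supportedOn H S).map (Pi.evalMonoidHom H j) := ⟨k, hk, rfl⟩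
      rwa [hbot] at this
    have hmem : S \ {j} ∈ {S : Set I | S ⊆ S₀ ∧ supportedOn H S₀ ≤ K ⊔ supportedOn H S} := by
      refine ⟨Set.sdiff_subset.trans hS, hSS.2.trans (sup_le le_sup_left ?_)⟩
      intro x hx
      have : x j ∈ (K ⊓ supportedOn H S).map (Pi.evalMonoidHom H j) := by rw [htop]; trivial
      obtain ⟨y, hy, hyx⟩ := this
      have hy' : y⁻¹ * x ∈ supportedOn H (S \ {j}) := by
        intro i hi
        rcases eq_or_ne i j with rfl | hij
        · simpa using congrArg (fun z => z⁻¹ * x i) hyx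
        · have hiS : i ∉ S := fun h' => hi ⟨h', hij⟩
          simp [hy.2 i hiS, hx i hiS]
      simpa using Subgroup.mul_mem_sup hy.1 hy'
    exact (hmin.le_of_le hmem Set.sdiff_subset hjS).2 rfl
  · rw [Subgroup.relIndex_eq_one.2 hSS.2]
    exact one_ne_zero

theorem normallyComplemented_pi {J : Set I} (hJ : J.Finite)
    (h : ∀ i ∈ J, NormallyComplemented (H i))
    (h' : ∀ i ∉ J, ∀ N : Subgroup (H i), N.Normal → N = ⊥ ∨ N = ⊤) :
    NormallyComplemented (∀ i, H i) := by
  have key : ∀ T : Set I, T.Finite → T ⊆ J → NormallyComplementedIn (supportedOn H (Jᶜ ∪ T)) := by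
    intro T hT
    induction T, hT using Set.Finite.induction_on with
    | empty =>
      intro _
      rw [Set.union_empty]
      exact normallyComplementedIn_supportedOn_of_simple h'
    | @insert j T _ _ ih =>
      intro hTJ
      have hjJ : j ∈ J := hTJ (Set.mem_insert _ _)
      have h1 := ih ((Set.subset_insert _ _).trans hTJ)
      have h2 := normallyComplementedIn_supportedOn_singleton (h j hjJ)
      have h3 := NormallyComplementedIn.sup (isClosed_supportedOn _) (isClosed_supportedOn _) h1 h2
      convert h3 using 1
      classical
      apply le_antisymm
      · intro x hx
        have ha : x * (Pi.mulSingle j (x j))⁻¹ ∈ supportedOn H (Jᶜ ∪ T) := by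
          intro i hi
          rcases eq_or_ne i j with rfl | hij
          · simp
          · have : i ∉ Jᶜ ∪ insert j T := by
              rintro (hh | rfl | hh)
              · exact hi (Or.inl hh)
              · exact hij rfl
              · exact hi (Or.inr hh)
            simp [hx i this, Pi.mulSingle_eq_of_ne hij]
        have hb : Pi.mulSingle j (x j) ∈ supportedOn H {j} := fun i hi =>
          Pi.mulSingle_eq_of_ne hi _
        simpa using Subgroup.mul_mem_sup ha hb
      · refine sup_le (fun x hx i hi => hx i fun hh => hi ?_) fun x hx i hi => hx i fun hh => hi ?_
        · exact hh.imp_right fun hh => Or.inr hh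
        · exact Or.inr (Or.inl hh)
  have h1 := key J hJ le_rfl
  have h2 : supportedOn H (Jᶜ ∪ J) = ⊤ := by
    rw [Set.compl_union_self, eq_top_iff]
    exact fun x _ i hi => (hi trivial).elim
  rwa [h2] at h1

end Pi

/-! ### Elements with finitely many conjugates -/

section FiniteConjugacy

variable {G : Type*} [Group G]

theorem isOfFinOrder_coe_iff {H : Subgroup G} {x : H} : IsOfFinOrder (x : G) ↔ IsOfFinOrder x :=
  Submonoid.isOfFinOrder_coe (H := H.toSubmonoid) (x := x)

theorem finite_conjugates_of_index_ne_zero {x : G}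
    (h : (Subgroup.centralizer {x}).index ≠ 0) : {y | IsConj x y}.Finite := by
  have : Finite (G ⧸ Subgroup.centralizer {x}) :=
    have : (Subgroup.centralizer {x}).FiniteIndex := ⟨h⟩
    Subgroup.finite_quotient_of_finiteIndex
  refine (Set.finite_range fun q : G ⧸ Subgroup.centralizer {x} => q.out * x * q.out⁻¹).subset ?_
  intro y hy
  obtain ⟨c, rfl⟩ := isConj_iff.1 hy
  obtain ⟨d, hd⟩ := QuotientGroup.mk_out_eq_mul (Subgroup.centralizer {x}) c
  refine ⟨(c : G ⧸ Subgroup.centralizer {x}), ?_⟩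
  have : x * (d : G) = d * x := Subgroup.mem_centralizer_iff.1 d.2 x rfl
  simp only [hd, mul_inv_rev, mul_assoc]
  rw [← mul_assoc (d : G) x, ← this]
  simp

/-- A form of Schur's theorem: if `G / Z(G)` is finite, then so is the commutator subgroup. -/
theorem finite_commutator_of_index_center_ne_zero (h : (Subgroup.center G).index ≠ 0) :
    Finite (commutator G) := by
  have : Finite (G ⧸ Subgroup.center G) :=
    have : (Subgroup.center G).FiniteIndex := ⟨h⟩
    Subgroup.finite_quotient_of_finiteIndex
  have : Finite (commutatorSet G) := by
    refine ((Set.finite_range fun q : (G ⧸ Subgroup.center G) × (G ⧸ Subgroup.center G) =>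
      ⁅q.1.out, q.2.out⁆).subset ?_).to_subtype
    rintro _ ⟨a, b, rfl⟩
    refine ⟨(a, b), ?_⟩
    obtain ⟨c, hc⟩ := QuotientGroup.mk_out_eq_mul (Subgroup.center G) a
    obtain ⟨d, hd⟩ := QuotientGroup.mk_out_eq_mul (Subgroup.center G) b
    have hcc := Subgroup.mem_center_iff.1 c.2
    have hdc := Subgroup.mem_center_iff.1 d.2
    simp only [hc, hd, commutatorElement_def, mul_inv_rev]
    calc a * (c : G) * (b * d) * ((c : G)⁻¹ * a⁻¹) * ((d : G)⁻¹ * b⁻¹)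
        = a * ((c : G) * (b * d)) * (c : G)⁻¹ * a⁻¹ * (d : G)⁻¹ * b⁻¹ := by group
      _ = a * b * (d * a⁻¹) * (d : G)⁻¹ * b⁻¹ := by rw [← hcc]; group
      _ = a * b * a⁻¹ * b⁻¹ := by rw [← hdc]; group
  infer_instance

theorem index_center_closure_ne_zero {X : Set G} (hX : X.Finite)
    (h : ∀ x ∈ X, (Subgroup.centralizer {x}).index ≠ 0) :
    (Subgroup.center (Subgroup.closure X)).index ≠ 0 := by
  have := hX.to_subtype
  have h1 : (⨅ x : X, Subgroup.centralizer {(x : G)}).index ≠ 0 :=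
    Subgroup.index_iInf_ne_zero fun x => h x x.2
  have h2 : ((⨅ x : X, Subgroup.centralizer {(x : G)}).subgroupOf (Subgroup.closure X)).index ≠ 0 :=
    relIndex_ne_zero_of_index h1 _
  refine fun h0 => h2 (Subgroup.index_eq_zero_of_relIndex_eq_zero (K := ⊤) ?_)
  rw [Subgroup.relIndex_top_right]
  refine Nat.eq_zero_of_zero_dvd (h0 ▸ Subgroup.index_dvd_of_le ?_)
  intro z hz
  rw [Subgroup.mem_center_iff]
  have hz' : (z : G) ∈ Subgroup.centralizer (Subgroup.closure X : Set G) := by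
    rw [Subgroup.centralizer_closure, Subgroup.mem_centralizer_iff]
    intro x hx
    have : (z : G) ∈ ⨅ x : X, Subgroup.centralizer {(x : G)} := hz
    exact Subgroup.mem_centralizer_iff.1 (Subgroup.mem_iInf.1 this ⟨x, hx⟩) x rfl
  exact fun g => Subtype.ext (Subgroup.mem_centralizer_iff.1 hz' g g.2)

/-- Dicman's lemma: a finite set of elements of finite order, each with finitely many conjugates,
generates a finite subgroup. -/
theorem finite_closure_of_isOfFinOrder {X : Set G} (hX : X.Finite)
    (h : ∀ x ∈ X, (Subgroup.centralizer {x}).index ≠ 0) (ht : ∀ x ∈ X, IsOfFinOrder x) :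
    Finite (Subgroup.closure X) := by
  have := finite_commutator_of_index_center_ne_zero (index_center_closure_ne_zero hX h)
  have := hX.to_subtype
  have hfg : Group.FG (Subgroup.closure X) := Group.closure_finite_fg X
  have : Group.FG (Abelianization (Subgroup.closure X)) :=
    Group.fg_of_surjective (f := Abelianization.of) (QuotientGroup.mk'_surjective _)
  have htors : IsMulTorsion (Abelianization (Subgroup.closure X)) := by
    intro z
    obtain ⟨⟨g, hg⟩, rfl⟩ : ∃ y, Abelianization.of y = z := Quotient.exists_rep z
    induction hg using Subgroup.closure_induction with
    | mem x hx => exact MonoidHom.isOfFinOrder _ (isOfFinOrder_coe_iff.1 (ht x hx))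
    | one => exact (map_one Abelianization.of : Abelianization.of (1 : Subgroup.closure X) = 1) ▸
        IsOfFinOrder.one
    | mul x y hx hy h1 h2 => exact (Commute.all (Abelianization.of (⟨x, hx⟩ : Subgroup.closure X))
        (Abelianization.of ⟨y, hy⟩)).isOfFinOrder_mul h1 h2
    | inv x hx h1 => exact h1.inv
  have : Finite (Abelianization (Subgroup.closure X)) :=
    CommGroup.finite_of_fg_isMulTorsion _ htors
  have : Finite (Subgroup.closure X ⧸ commutator (Subgroup.closure X)) := this
  exact Finite.of_subgroup_quotient (commutator (Subgroup.closure X))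

theorem index_centralizer_ne_zero_of_isConj {x y : G} (h : IsConj x y)
    (hx : (Subgroup.centralizer {x}).index ≠ 0) : (Subgroup.centralizer {y}).index ≠ 0 := by
  obtain ⟨c, rfl⟩ := isConj_iff.1 h
  have : Subgroup.centralizer {c * x * c⁻¹} =
      (Subgroup.centralizer {x}).map (MulAut.conj c).toMonoidHom := by
    ext z
    rw [Subgroup.mem_map_equiv, Subgroup.mem_centralizer_singleton_iff,
      Subgroup.mem_centralizer_singleton_iff, MulAut.conj_symm_apply]
    constructor
    · intro h
      have : c⁻¹ * (z * (c * x * c⁻¹)) * c = c⁻¹ * ((c * x * c⁻¹) * z) * c := by rw [h]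
      simpa [mul_assoc] using this
    · intro h
      have : c * (c⁻¹ * z * c * x) * c⁻¹ = c * (x * (c⁻¹ * z * c)) * c⁻¹ := by rw [h]
      simpa [mul_assoc] using this
  rw [this]
  have := Subgroup.index_map_equiv (Subgroup.centralizer {x}) (MulAut.conj c)
  exact fun h0 => hx (this ▸ h0)

/-- The normal closure of an element of finite order with finitely many conjugates is finite. -/
theorem finite_normalClosure_singleton {x : G} (h : (Subgroup.centralizer {x}).index ≠ 0)
    (hx : IsOfFinOrder x) : Finite (Subgroup.normalClosure {x}) := by
  have : Group.conjugatesOfSet {x} = {y | IsConj x y} := by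
    ext y; simp [Group.mem_conjugatesOfSet_iff]
  rw [Subgroup.normalClosure, this]
  refine finite_closure_of_isOfFinOrder (finite_conjugates_of_index_ne_zero h)
    (fun y hy => index_centralizer_ne_zero_of_isConj hy h) fun y hy => ?_
  obtain ⟨c, rfl⟩ := isConj_iff.1 hy
  exact MonoidHom.isOfFinOrder (MulAut.conj c).toMonoidHom hx

end FiniteConjugacy

section QuasiCenter

variable {G : Type*} [Group G] [TopologicalSpace G] [IsTopologicalGroup G]

/-- The quasi-center of a topological group: the elements with open centralizer. -/
def quasiCenter (G : Type*) [Group G] [TopologicalSpace G] [IsTopologicalGroup G] :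
    Subgroup G where
  carrier := {x | IsOpen (Subgroup.centralizer {x} : Set G)}
  one_mem' := by
    have : Subgroup.centralizer {(1 : G)} = ⊤ := by
      rw [eq_top_iff]; intro x _; simp [Subgroup.mem_centralizer_singleton_iff]
    rw [Set.mem_ofPred_eq, this]
    exact isOpen_univ
  mul_mem' {x y} hx hy := by
    refine Subgroup.isOpen_mono (H₁ := Subgroup.centralizer {x} ⊓ Subgroup.centralizer {y}) ?_
      (hx.inter hy)
    rintro z ⟨h1, h2⟩
    replace h1 := Subgroup.mem_centralizer_singleton_iff.1 h1
    replace h2 := Subgroup.mem_centralizer_singleton_iff.1 h2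
    rw [Subgroup.mem_centralizer_singleton_iff, ← mul_assoc, h1, mul_assoc, h2, mul_assoc]
  inv_mem' {x} hx := by
    refine Subgroup.isOpen_mono (H₁ := Subgroup.centralizer {x}) (fun z hz => ?_) hx
    rw [Subgroup.mem_centralizer_singleton_iff] at hz ⊢
    exact (Commute.inv_right hz : Commute z x⁻¹)

theorem mem_quasiCenter {x : G} :
    x ∈ quasiCenter G ↔ IsOpen (Subgroup.centralizer {x} : Set G) := Iff.rfl

instance : (quasiCenter G).Normal := by
  refine ⟨fun x hx c => ?_⟩
  rw [mem_quasiCenter] at hx ⊢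
  have : (Subgroup.centralizer {c * x * c⁻¹} : Set G) =
      (fun z => c⁻¹ * z * c) ⁻¹' (Subgroup.centralizer {x} : Set G) := by
    ext z
    simp only [SetLike.mem_coe, Set.mem_preimage, Subgroup.mem_centralizer_singleton_iff]
    constructor
    · intro h
      have : c⁻¹ * (z * (c * x * c⁻¹)) * c = c⁻¹ * ((c * x * c⁻¹) * z) * c := by rw [h]
      simpa [mul_assoc] using this
    · intro h
      have : c * (c⁻¹ * z * c * x) * c⁻¹ = c * (x * (c⁻¹ * z * c)) * c⁻¹ := by rw [h]
      simpa [mul_assoc] using this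
  rw [this]
  exact hx.preimage (by fun_prop)

theorem mem_quasiCenter_of_commute {x : G} {O : Subgroup G} (hO : IsOpen (O : Set G))
    (h : ∀ o ∈ O, o * x = x * o) : x ∈ quasiCenter G :=
  Subgroup.isOpen_mono (fun o ho => Subgroup.mem_centralizer_singleton_iff.2 (h o ho)) hO

/-- A group has no quasi-central torsion if no nontrivial element of finite order has open
centralizer. -/
def NoQuasiCentralTorsion (G : Type*) [Group G] [TopologicalSpace G] [IsTopologicalGroup G] :
    Prop :=
  ∀ x ∈ quasiCenter G, IsOfFinOrder x → x = 1

theorem mem_quasiCenter_of_finite_normal [T1Space G] {N : Subgroup G} [N.Normal] [Finite N] {x : G}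
    (hx : x ∈ N) : x ∈ quasiCenter G := by
  have hfin : (N : Set G).Finite := Set.toFinite _
  have hcl : IsOpen ((fun z => z * x * z⁻¹) ⁻¹' ((N : Set G) \ {x})ᶜ) :=
    (hfin.subset Set.sdiff_subset).isClosed.isOpen_compl.preimage (by fun_prop)
  refine Subgroup.isOpen_of_mem_nhds (g := 1) _
    (Filter.mem_of_superset (hcl.mem_nhds (by simp)) ?_)
  intro z hz
  have h1 : z * x * z⁻¹ = x := by
    by_contra hne
    exact hz ⟨‹N.Normal›.conj_mem x hx z, hne⟩
  exact Subgroup.mem_centralizer_singleton_iff.2 (mul_inv_eq_iff_eq_mul.1 h1)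

theorem NoQuasiCentralTorsion.eq_bot_of_finite [T1Space G] (h : NoQuasiCentralTorsion G)
    (N : Subgroup G) [N.Normal] [Finite N] : N = ⊥ := by
  rw [Subgroup.eq_bot_iff_forall]
  intro x hx
  refine h x (mem_quasiCenter_of_finite_normal hx) ?_
  exact isOfFinOrder_coe_iff.2 (isOfFinOrder_of_finite (⟨x, hx⟩ : N))

theorem IsOpenDirectProduct.coe_mem_quasiCenter [T2Space G] {L B : Subgroup G}
    (h : IsOpenDirectProduct L B) {x : L} (hx : x ∈ quasiCenter L) : (x : G) ∈ quasiCenter G := by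
  rw [mem_quasiCenter] at hx
  obtain ⟨W, hW, hWc⟩ := hx
  have h1 : (1 : L) ∈ (Subtype.val ⁻¹' W : Set L) := by rw [hWc]; exact one_mem _
  have h2 := h.shrink (L' := (Subgroup.centralizer {x}).map L.subtype) (B' := B)
    (Subgroup.map_subtype_le _) le_rfl hW h1 (fun y hy => by
      have : (⟨y, hy.1⟩ : L) ∈ (Subtype.val ⁻¹' W : Set L) := hy.2
      rw [hWc] at this
      exact ⟨_, this, rfl⟩) (fun y hy => hy.1)
  refine Subgroup.isOpen_mono (sup_le ?_ fun b hb => ?_) h2.isOpen_sup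
  · rintro _ ⟨y, hy, rfl⟩
    exact Subgroup.mem_centralizer_singleton_iff.2
      (congrArg Subtype.val (Subgroup.mem_centralizer_singleton_iff.1 hy))
  · exact Subgroup.mem_centralizer_singleton_iff.2 (h.comm x x.2 b hb).symm

theorem NoQuasiCentralTorsion.of_isOpenDirectProduct [T2Space G] {L B : Subgroup G}
    (hG : NoQuasiCentralTorsion G) (h : IsOpenDirectProduct L B) : NoQuasiCentralTorsion L :=
  fun x hx ho => Subtype.ext (hG x (h.coe_mem_quasiCenter hx) (isOfFinOrder_coe_iff.2 ho))

/-- In the absence of quasi-central torsion, the quasi-center of a compact group is abelian. -/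
theorem NoQuasiCentralTorsion.commute [T2Space G] [CompactSpace G] (h : NoQuasiCentralTorsion G)
    {x y : G} (hx : x ∈ quasiCenter G) (hy : y ∈ quasiCenter G) : x * y = y * x := by
  set X : Set G := {z | IsConj x z} ∪ {z | IsConj y z} with hX
  have hx' := index_ne_zero_of_isOpen hx
  have hy' := index_ne_zero_of_isOpen hy
  have hXf : X.Finite := (finite_conjugates_of_index_ne_zero hx').union
    (finite_conjugates_of_index_ne_zero hy')
  have hfin := finite_commutator_of_index_center_ne_zero (index_center_closure_ne_zero hXf (by
    rintro z (hz | hz)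
    · exact index_centralizer_ne_zero_of_isConj hz hx'
    · exact index_centralizer_ne_zero_of_isConj hz hy'))
  have hn : (Subgroup.closure X).Normal := by
    have hXn : Group.conjugatesOfSet {x, y} = X := by
      ext z; simp [Group.mem_conjugatesOfSet_iff, hX]
    rw [← hXn]
    exact Subgroup.normalClosure_normal
  have hxX : x ∈ Subgroup.closure X := Subgroup.subset_closure (Or.inl (IsConj.refl x))
  have hyX : y ∈ Subgroup.closure X := Subgroup.subset_closure (Or.inr (IsConj.refl y))
  have hbot : ⁅Subgroup.closure X, Subgroup.closure X⁆ = ⊥ := by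
    have : Finite (⁅Subgroup.closure X, Subgroup.closure X⁆ : Subgroup G) := by
      rw [← Subgroup.map_subtype_commutator]
      exact Set.Finite.to_subtype ((Set.toFinite _).image _)
    exact h.eq_bot_of_finite _
  have := Subgroup.commutator_mem_commutator hxX hyX
  rw [hbot, Subgroup.mem_bot, commutatorElement_eq_one_iff_mul_comm] at this
  exact this

end QuasiCenter

/-! ### Abelian groups that are virtually generated by minimal procyclic subgroups -/

section Comm

variable {A : Type*} [CommGroup A]

/-- In a torsion-free group that is not `p`-divisible, the group of infinitely `p`-divisible
elements has infinite index. -/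
theorem index_iInf_range_powMonoidHom_eq_zero (htf : ∀ x : A, IsOfFinOrder x → x = 1) {p : ℕ}
    (hp : p.Prime) (hne : (powMonoidHom p : A →* A).range ≠ ⊤) :
    (⨅ k : ℕ, (powMonoidHom (p ^ k) : A →* A).range).index = 0 := by
  set D := ⨅ k : ℕ, (powMonoidHom (p ^ k) : A →* A).range with hD
  have hinj : ∀ (n : ℕ), 0 < n → ∀ x y : A, x ^ n = y ^ n → x = y := by
    intro n hn x y hxy
    refine div_eq_one.1 (htf _ (isOfFinOrder_iff_pow_eq_one.2 ⟨n, hn, ?_⟩))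
    rw [div_pow, hxy, div_self']
  have hroot : ∀ d ∈ D, ∃ e ∈ D, e ^ p = d := by
    intro d hd
    obtain ⟨e, he⟩ := Subgroup.mem_iInf.1 hd 1
    rw [powMonoidHom_apply, pow_one] at he
    refine ⟨e, Subgroup.mem_iInf.2 fun k => ?_, he⟩
    obtain ⟨f, hf⟩ := Subgroup.mem_iInf.1 hd (k + 1)
    refine ⟨f, hinj p hp.pos _ _ ?_⟩
    rw [he, ← hf, powMonoidHom_apply, powMonoidHom_apply, ← pow_mul, pow_succ]
  have hmem : ∀ k : ℕ, ∀ m : A, m ^ p ^ k ∈ D → m ∈ D := by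
    intro k
    induction k with
    | zero => intro m hm; simpa using hm
    | succ k ih =>
      intro m hm
      rw [pow_succ, pow_mul] at hm
      obtain ⟨e, he, hep⟩ := hroot _ hm
      exact ih m (hinj p hp.pos _ _ hep ▸ he)
  by_contra hi
  have : D.FiniteIndex := ⟨hi⟩
  refine hne (eq_top_iff.2 fun m _ => ?_)
  obtain ⟨i, j, hij, hmij⟩ := Finite.exists_ne_map_eq_of_infinite
    (fun i : ℕ => (QuotientGroup.mk (m ^ p ^ i) : A ⧸ D))
  wlog hlt : i < j generalizing i j
  · exact this j i hij.symm hmij.symm (lt_of_le_of_ne (not_lt.1 hlt) hij.symm)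
  have h1 : (m⁻¹ * m ^ p ^ (j - i)) ^ p ^ i ∈ D := by
    have := QuotientGroup.eq.1 hmij
    rwa [mul_pow, inv_pow, ← pow_mul, ← pow_add, Nat.sub_add_cancel hlt.le]
  obtain ⟨e, -, he⟩ := hroot _ (hmem i _ h1)
  refine ⟨m ^ p ^ (j - i - 1) * e⁻¹, ?_⟩
  rw [powMonoidHom_apply, mul_pow, inv_pow, he, ← pow_mul, ← pow_succ,
    show j - i - 1 + 1 = j - i by omega]
  simp

variable [TopologicalSpace A] [IsTopologicalGroup A]

/-- A closed subgroup containing a power of `t` has finite index in the group obtained by adjoining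
the closed subgroup generated by `t`. -/
theorem relIndex_topologicalClosure_zpowers_ne_zero {R : Subgroup A} (hR : IsClosed (R : Set A))
    {t : A} {n : ℕ} (hn : 0 < n) (h : t ^ n ∈ R) :
    R.relIndex (Subgroup.zpowers t).topologicalClosure ≠ 0 := by
  have hord : IsOfFinOrder (QuotientGroup.mk' R t) := by
    rw [isOfFinOrder_iff_pow_eq_one]
    exact ⟨n, hn, by rw [← map_pow]; exact (QuotientGroup.eq_one_iff _).2 h⟩
  have hfin : (Subgroup.zpowers (QuotientGroup.mk' R t) : Set (A ⧸ R)).Finite :=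
    hord.finite_zpowers
  have hT : T3Space (A ⧸ R) := QuotientGroup.instT3Space R (hN := hR)
  have hle : (Subgroup.zpowers t).topologicalClosure ≤
      (Subgroup.zpowers (QuotientGroup.mk' R t)).comap (QuotientGroup.mk' R) := by
    refine Subgroup.topologicalClosure_minimal _ ?_ (hfin.isClosed.preimage
      QuotientGroup.continuous_mk)
    rw [Subgroup.zpowers_le]
    exact Subgroup.mem_zpowers _
  have : Finite ((Subgroup.zpowers t).topologicalClosure.map (QuotientGroup.mk' R)) :=
    (hfin.subset (Subgroup.map_le_iff_le_comap.2 hle)).to_subtype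
  have hker := Subgroup.relIndex_ker (Subgroup.zpowers t).topologicalClosure (QuotientGroup.mk' R)
  rw [QuotientGroup.ker_mk'] at hker
  rw [hker]
  exact Nat.card_pos.ne'

/-- If the subgroups of `p ^ k`-th powers form a neighbourhood basis of `1` (so that the group is
pro-`p`), then the nontrivial closed subgroups of a procyclic subgroup have finite index in it. -/
theorem exists_pow_mem_topologicalClosure_zpowers [T2Space A] {p : ℕ} (hp : p.Prime)
    (ho : ∀ k : ℕ, IsOpen ((powMonoidHom (p ^ k) : A →* A).range : Set A))
    (hb : ∀ W ∈ 𝓝 (1 : A), ∃ k : ℕ, ((powMonoidHom (p ^ k) : A →* A).range : Set A) ⊆ W)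
    {x y : A} (hy : y ∈ (Subgroup.zpowers x).topologicalClosure) (hy1 : y ≠ 1) :
    ∃ n > 0, x ^ n ∈ (Subgroup.zpowers y).topologicalClosure := by
  obtain ⟨k, hk⟩ := hb {y}ᶜ (isOpen_compl_singleton.mem_nhds (by simpa using hy1.symm))
  have hyk : y ∉ (powMonoidHom (p ^ k) : A →* A).range := fun h => hk h rfl
  refine ⟨p ^ k, pow_pos hp.pos k, ?_⟩
  change _ ∈ closure _
  rw [mem_closure_iff_nhds]
  intro W hW
  obtain ⟨m, hm⟩ := hb ((fun z => x ^ p ^ k * z) ⁻¹' W)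
    (by
      have : ContinuousAt (fun z => x ^ p ^ k * z) 1 := by fun_prop
      exact this (by simpa using hW))
  -- approximate `y` by a power of `x` modulo `p ^ (k + m)`-th powers
  have hopen : IsOpen ((fun z => y⁻¹ * z) ⁻¹'
      ((powMonoidHom (p ^ (k + m)) : A →* A).range : Set A)) :=
    (ho (k + m)).preimage (by fun_prop)
  obtain ⟨_, ⟨w, hw⟩, ⟨n, rfl⟩⟩ := mem_closure_iff.1 hy _ hopen ⟨1, by simp⟩
  have hw' : x ^ n = y * w ^ p ^ (k + m) := by
    simpa [eq_inv_mul_iff_mul_eq, eq_comm] using hw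
  have hpn : ¬ ((p ^ k : ℕ) : ℤ) ∣ n := by
    rintro ⟨c, rfl⟩
    refine hyk ⟨x ^ c * (w ^ p ^ m)⁻¹, ?_⟩
    rw [zpow_mul', zpow_natCast, pow_add, mul_comm (p ^ k), pow_mul] at hw'
    rw [powMonoidHom_apply, mul_pow, inv_pow, hw', mul_inv_cancel_right]
  obtain ⟨a, ha, hga⟩ := (Nat.dvd_prime_pow hp).1
    (show Int.gcd n (p ^ (k + m) : ℕ) ∣ p ^ (k + m) by
      exact Int.natCast_dvd_natCast.1 (Int.gcd_dvd_right _ _))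
  have hak : a < k := by
    by_contra hak
    refine hpn (dvd_trans ?_ (Int.gcd_dvd_left n (p ^ (k + m) : ℕ)))
    rw [hga]
    exact_mod_cast pow_dvd_pow p (not_lt.1 hak)
  have hbez := Int.gcd_eq_gcd_ab n (p ^ (k + m) : ℕ)
  rw [hga] at hbez
  set s := Int.gcdA n (p ^ (k + m) : ℕ)
  set r := Int.gcdB n (p ^ (k + m) : ℕ)
  have h1 : x ^ p ^ a = y ^ s * (w ^ s * x ^ r) ^ p ^ (k + m) := by
    rw [← zpow_natCast x, hbez, zpow_add, zpow_mul, hw', mul_zpow, mul_pow, mul_assoc]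
    congr 2
    · rw [← zpow_natCast w, ← zpow_natCast (w ^ s), ← zpow_mul, ← zpow_mul, mul_comm]
    · rw [← zpow_natCast (x ^ r), ← zpow_mul, mul_comm]
  have h2 : x ^ p ^ k * ((((w ^ s * x ^ r) ^ p ^ (k - a)) ^ p ^ k)⁻¹) ^ p ^ m =
      (y ^ s) ^ p ^ (k - a) := by
    have : x ^ p ^ k = (x ^ p ^ a) ^ p ^ (k - a) := by
      rw [← pow_mul, ← pow_add, Nat.add_sub_cancel' hak.le]
    rw [this, h1, mul_pow, inv_pow, mul_inv_eq_iff_eq_mul]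
    congr 1
    rw [← pow_mul, ← pow_mul, ← pow_mul, ← pow_add, ← pow_add, ← pow_add]
    congr 2
    omega
  refine ⟨_, hm ⟨(((w ^ s * x ^ r) ^ p ^ (k - a)) ^ p ^ k)⁻¹, rfl⟩, ?_⟩
  change x ^ p ^ k * (_ : A) ^ p ^ m ∈ _
  rw [h2]
  exact Subgroup.pow_mem _ (Subgroup.zpow_mem _ (Subgroup.mem_zpowers y) s) _

variable [CompactSpace A]

/-- Some prime `p` is such that `A` is not `p`-divisible. -/
theorem exists_prime_range_powMonoidHom_ne_top [TotallyDisconnectedSpace A] [Nontrivial A] :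
    ∃ p : ℕ, p.Prime ∧ (powMonoidHom p : A →* A).range ≠ ⊤ := by
  by_contra! hcon
  have hdiv : ∀ n : ℕ, n ≠ 0 → (powMonoidHom n : A →* A).range = ⊤ := by
    intro n
    induction n using induction_on_primes with
    | zero => simp
    | one => intro _; rw [MonoidHom.range_eq_top]; exact fun x => ⟨x, pow_one x⟩
    | prime_mul p a hp ih =>
      intro hpa
      rw [MonoidHom.range_eq_top]
      intro x
      obtain ⟨y, hy⟩ := MonoidHom.range_eq_top.1 (hcon p hp) x
      obtain ⟨z, hz⟩ := MonoidHom.range_eq_top.1 (ih (right_ne_zero_of_mul hpa)) y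
      exact ⟨z, by rw [← hy, ← hz]; simp [pow_mul, mul_comm p a]⟩
  obtain ⟨x, hx⟩ := exists_ne (1 : A)
  obtain ⟨W, hW⟩ := ProfiniteGrp.exist_openNormalSubgroup_sub_open_nhds_of_one
    (isOpen_compl_singleton (x := x)) (by simpa using hx.symm)
  have hWi : (W : Subgroup A).index ≠ 0 := index_ne_zero_of_isOpen W.isOpen
  obtain ⟨y, rfl⟩ := MonoidHom.range_eq_top.1 (hdiv _ hWi) x
  exact hW (Subgroup.pow_index_mem (W : Subgroup A) y) rfl

variable [T2Space A]

theorem topologicalClosure_closure_insert (t : A) (T : Set A) :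
    (Subgroup.closure (insert t T)).topologicalClosure =
      (Subgroup.closure T).topologicalClosure ⊔ (Subgroup.zpowers t).topologicalClosure := by
  apply le_antisymm
  · refine Subgroup.topologicalClosure_minimal _ ((Subgroup.closure_le _).2 ?_)
      (isClosed_sup_of_normal (Subgroup.isClosed_topologicalClosure _)
        (Subgroup.isClosed_topologicalClosure _))
    rintro x (rfl | hx)
    · exact (le_sup_right : _ ≤ (Subgroup.closure T).topologicalClosure ⊔ _)
        (Subgroup.le_topologicalClosure _ (Subgroup.mem_zpowers x))
    · exact (le_sup_left : (Subgroup.closure T).topologicalClosure ≤ _)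
        (Subgroup.le_topologicalClosure _ (Subgroup.subset_closure hx))
  · refine sup_le (Subgroup.topologicalClosure_mono (Subgroup.closure_mono (Set.subset_insert _ _)))
      (Subgroup.topologicalClosure_mono ?_)
    rw [Subgroup.zpowers_le]
    exact Subgroup.subset_closure (Set.mem_insert _ _)

/-- If a compact abelian group is virtually generated by finitely many procyclic subgroups, each of
which has no closed subgroup of infinite index but the trivial one, then a minimal set of these
generating it virtually together with `K` yields a complement of the closed subgroup `K`. -/
theorem normallyComplemented_of_finite_procyclic {X : Set A} (hX : X.Finite)
    (hidx : (Subgroup.closure X).topologicalClosure.index ≠ 0)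
    (h : ∀ x ∈ X, ∀ y ∈ (Subgroup.zpowers x).topologicalClosure, y ≠ 1 →
      ∃ n > 0, x ^ n ∈ (Subgroup.zpowers y).topologicalClosure) : NormallyComplemented A := by
  intro K _ hKc _
  obtain ⟨T, hT⟩ := (hX.finite_subsets.subset (Set.sep_subset {T | T ⊆ X} fun T =>
    (K ⊔ (Subgroup.closure T).topologicalClosure).index ≠ 0)).exists_minimal
      ⟨X, Set.Subset.rfl, fun h0 => hidx (Nat.eq_zero_of_zero_dvd
        (h0 ▸ Subgroup.index_dvd_of_le le_sup_right))⟩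
  refine ⟨(Subgroup.closure T).topologicalClosure, inferInstance,
    Subgroup.isClosed_topologicalClosure _, le_top, ?_, by
      rw [Subgroup.relIndex_top_right]; exact hT.prop.2⟩
  rw [Subgroup.eq_bot_iff_forall]
  rintro k ⟨hkK, hkT⟩
  by_contra hk1
  have hTX : T ⊆ X := hT.prop.1
  obtain ⟨S, hS⟩ := (((hX.subset hTX).finite_subsets).subset (Set.sep_subset {S | S ⊆ T} fun S =>
    k ∈ (Subgroup.closure S).topologicalClosure)).exists_minimal ⟨T, Set.Subset.rfl, hkT⟩
  have hST : S ⊆ T := hS.prop.1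
  have hSne : S.Nonempty := by
    by_contra hne
    have h2 := hS.prop.2
    rw [Set.not_nonempty_iff_eq_empty.1 hne, Subgroup.closure_empty] at h2
    have : (⊥ : Subgroup A).topologicalClosure ≤ ⊥ :=
      Subgroup.topologicalClosure_minimal _ le_rfl (by simp)
    exact hk1 (this h2)
  obtain ⟨t, ht⟩ := hSne
  have hins : ∀ {S : Set A}, t ∈ S → insert t (S \ {t}) = S := fun ht => by
    rw [Set.insert_sdiff_singleton, Set.insert_eq_of_mem ht]
  have h1 := hS.prop.2
  rw [← hins ht, topologicalClosure_closure_insert] at h1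
  obtain ⟨z, hz, y, hy, hzy⟩ := Subgroup.mem_sup.1 h1
  have hy1 : y ≠ 1 := by
    rintro rfl
    rw [mul_one] at hzy
    have := hS.le_of_le (y := S \ {t}) ⟨Set.sdiff_subset.trans hST, hzy ▸ hz⟩ Set.sdiff_subset ht
    exact this.2 rfl
  obtain ⟨n, hn, hyn⟩ := h t (hTX (hST ht)) y hy hy1
  set R := K ⊔ (Subgroup.closure (T \ {t})).topologicalClosure with hR
  have hRc : IsClosed (R : Set A) :=
    isClosed_sup_of_normal hKc (Subgroup.isClosed_topologicalClosure _)
  have hyR : y ∈ R := by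
    have hzR : z ∈ R := (le_sup_right : (Subgroup.closure (T \ {t})).topologicalClosure ≤ R)
      (Subgroup.topologicalClosure_mono
        (Subgroup.closure_mono (Set.sdiff_subset_sdiff_left hST)) hz)
    have hkR : z * y ∈ R := (le_sup_left : K ≤ R) (hzy ▸ hkK)
    exact (R.mul_mem_cancel_left hzR).1 hkR
  have htR : t ^ n ∈ R := Subgroup.topologicalClosure_minimal _ (Subgroup.zpowers_le.2 hyR) hRc hyn
  have h2 := relIndex_topologicalClosure_zpowers_ne_zero hRc hn htR
  rw [← Subgroup.relIndex_sup_right, sup_comm, hR, sup_assoc, ← topologicalClosure_closure_insert,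
    hins (hST ht)] at h2
  have h3 : (K ⊔ (Subgroup.closure (T \ {t})).topologicalClosure).index ≠ 0 := by
    rw [← Subgroup.relIndex_mul_index (sup_le_sup_left (Subgroup.topologicalClosure_mono
      (Subgroup.closure_mono Set.sdiff_subset)) K)]
    exact mul_ne_zero h2 hT.prop.2
  have := hT.le_of_le (y := T \ {t}) ⟨Set.sdiff_subset.trans hTX, h3⟩ Set.sdiff_subset (hST ht)
  exact this.2 rfl

end Comm

/-! ### Just infinite groups are locally normally complemented -/

theorem finite_range_map_conjNormal {L : Type*} [Group L] {V : Subgroup L} [V.Normal]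
    (hV : V.index ≠ 0) (A : Subgroup V) [hA : A.Normal] :
    (Set.range fun g : L => A.map (MulAut.conjNormal g : V ≃* V).toMonoidHom).Finite := by
  have : V.FiniteIndex := ⟨hV⟩
  have : Finite (L ⧸ V) := Subgroup.finite_quotient_of_finiteIndex
  refine (Set.finite_range fun q : L ⧸ V =>
    A.map (MulAut.conjNormal q.out : V ≃* V).toMonoidHom).subset ?_
  rintro _ ⟨g, rfl⟩
  obtain ⟨v, hv⟩ := QuotientGroup.mk_out_eq_mul V g
  refine ⟨(g : L ⧸ V), ?_⟩
  ext x
  simp only [Subgroup.mem_map_equiv, hv]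
  have : (MulAut.conjNormal (g * (v : L)) : V ≃* V).symm x =
      v⁻¹ * (MulAut.conjNormal g : V ≃* V).symm x * v := by
    ext; simp [mul_assoc, -map_mul]
  rw [this]
  constructor
  · intro h
    have := hA.conj_mem _ h v
    simpa [mul_assoc] using this
  · intro h
    have := hA.conj_mem _ h v⁻¹
    simpa [mul_assoc] using this

/-- The intersection of two normal subgroups with trivial centralizer has trivial centralizer,
provided that there are no abelian normal subgroups. -/
theorem centralizer_inf_eq_bot {V : Type*} [Group V]
    (hV : ∀ A : Subgroup V, A.Normal → (∀ x ∈ A, ∀ y ∈ A, x * y = y * x) → A = ⊥)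
    {X Y : Subgroup V} [X.Normal] [Y.Normal] (hX : Subgroup.centralizer (X : Set V) = ⊥)
    (hY : Subgroup.centralizer (Y : Set V) = ⊥) :
    Subgroup.centralizer ((X ⊓ Y : Subgroup V) : Set V) = ⊥ := by
  set D := Subgroup.centralizer ((X ⊓ Y : Subgroup V) : Set V) with hD
  have h1 : D ⊓ (X ⊓ Y) = ⊥ := hV _ inferInstance fun x hx y hy =>
    Subgroup.mem_centralizer_iff.1 hy.1 x hx.2
  have h2 : D ⊓ X = ⊥ := by
    rw [eq_bot_iff, ← hY]
    intro x hx
    rw [Subgroup.mem_centralizer_iff]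
    exact fun y hy => (Subgroup.commute_of_normal_of_disjoint (D ⊓ X) Y inferInstance inferInstance
      (disjoint_iff.2 (by rw [inf_assoc, h1])) x y hx hy).symm
  rw [eq_bot_iff, ← hX]
  intro x hx
  rw [Subgroup.mem_centralizer_iff]
  exact fun y hy => (Subgroup.commute_of_normal_of_disjoint D X inferInstance inferInstance
    (disjoint_iff.2 h2) x y hx hy).symm

section JustInfinite

variable {L : Type*} [Group L] [TopologicalSpace L] [IsTopologicalGroup L]

theorem continuous_conjNormal {V : Subgroup L} [V.Normal] (g : L) :
    Continuous (MulAut.conjNormal g : V ≃* V) :=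
  ((continuous_const.mul continuous_subtype_val).mul continuous_const).subtype_mk _

/-- A nontrivial closed subgroup of an open normal subgroup of a just infinite group has finite
index if it is invariant under conjugation by the whole group. -/
theorem IsJustInfinite.index_ne_zero_of_conj_invariant (hL : IsJustInfinite L) {V : Subgroup L}
    [V.Normal] (hV : IsOpen (V : Set L)) {X : Subgroup V} (hX : IsClosed (X : Set V))
    (hinv : ∀ g : L, ∀ x ∈ X, MulAut.conjNormal g x ∈ X) (hne : X ≠ ⊥) : X.index ≠ 0 := by
  have h1 : (X.map V.subtype).FiniteIndex := by
    refine hL.2 _ ⟨?_⟩ ((Subgroup.isClosed_of_isOpen _ hV).isClosedMap_subtype_val _ hX) ?_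
    · rintro _ ⟨x, hx, rfl⟩ g
      exact ⟨_, hinv g x hx, by simp⟩
    · rwa [Ne, Subgroup.map_eq_bot_iff_of_injective _ V.subtype_injective]
  have h2 : (X.map V.subtype).subgroupOf V = X := by
    rw [Subgroup.subgroupOf, Subgroup.comap_map_eq_self_of_injective V.subtype_injective]
  rw [← h2]
  exact Subgroup.FiniteIndex.index_ne_zero

variable [CompactSpace L]

theorem IsJustInfinite.nontrivial_of_isOpen (hL : IsJustInfinite L) {V : Subgroup L}
    (hV : IsOpen (V : Set L)) : Nontrivial V := by
  rw [Subgroup.nontrivial_iff_ne_bot]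
  rintro rfl
  have := index_ne_zero_of_isOpen hV
  rw [Subgroup.index_bot] at this
  have := hL.1
  exact this.not_finite (Nat.finite_of_card_ne_zero ‹_›)

variable [T2Space L]

theorem IsJustInfinite.eq_one_of_isOfFinOrder (hL : IsJustInfinite L) {x : L}
    (hx : x ∈ quasiCenter L) (ho : IsOfFinOrder x) : x = 1 := by
  by_contra hne
  have hfin := finite_normalClosure_singleton (index_ne_zero_of_isOpen hx) ho
  have hcl : IsClosed (Subgroup.normalClosure {x} : Set L) := (Set.toFinite _).isClosed
  have := hL.2 _ Subgroup.normalClosure_normal hcl fun h => hne (by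
    have : x ∈ Subgroup.normalClosure {x} := Subgroup.subset_normalClosure rfl
    rwa [h] at this)
  have := hL.1
  exact this.not_finite (Finite.of_subgroup_quotient (Subgroup.normalClosure {x}))

/-- An open normal abelian subgroup of a just infinite profinite group is a torsion-free pro-`p`
group which is virtually generated by the conjugates of any nontrivial element. -/
theorem IsJustInfinite.normallyComplemented_of_commute [TotallyDisconnectedSpace L]
    (hL : IsJustInfinite L) {V : Subgroup L} [V.Normal] (hV : IsOpen (V : Set L))
    (hcomm : ∀ x ∈ V, ∀ y ∈ V, x * y = y * x) : NormallyComplemented V := by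
  have hVc : IsClosed (V : Set L) := Subgroup.isClosed_of_isOpen _ hV
  have : CompactSpace V := isCompact_iff_compactSpace.1 hVc.isCompact
  have hnt := hL.nontrivial_of_isOpen hV
  let _ : CommGroup V :=
    { (inferInstance : Group V) with mul_comm := fun x y => Subtype.ext (hcomm x x.2 y y.2) }
  have hqc : ∀ x ∈ V, x ∈ quasiCenter L := fun x hx =>
    mem_quasiCenter_of_commute hV fun o ho => hcomm o ho x hx
  have htf : ∀ x : V, IsOfFinOrder x → x = 1 := fun x hx =>
    Subtype.ext (hL.eq_one_of_isOfFinOrder (hqc x x.2) (isOfFinOrder_coe_iff.2 hx))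
  have hinv : ∀ (n : ℕ) (g : L), ∀ x ∈ (powMonoidHom n : V →* V).range,
      (MulAut.conjNormal g : V ≃* V) x ∈ (powMonoidHom n : V →* V).range := by
    rintro n g _ ⟨y, rfl⟩
    exact ⟨MulAut.conjNormal g y, (map_pow (MulAut.conjNormal g : V ≃* V) y n).symm⟩
  have hclosed : ∀ n : ℕ, IsClosed ((powMonoidHom n : V →* V).range : Set V) := fun n =>
    (isCompact_range (continuous_pow n)).isClosed
  have hopen : ∀ n : ℕ, 0 < n → IsOpen ((powMonoidHom n : V →* V).range : Set V) := by
    intro n hn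
    refine isOpen_of_isClosed_of_index_ne_zero (hclosed n)
      (hL.index_ne_zero_of_conj_invariant hV (hclosed n) (hinv n) fun hbot => ?_)
    obtain ⟨x, hx⟩ := exists_ne (1 : V)
    have : x ^ n ∈ (powMonoidHom n : V →* V).range := ⟨x, rfl⟩
    rw [hbot, Subgroup.mem_bot] at this
    exact hx (htf x (isOfFinOrder_iff_pow_eq_one.2 ⟨n, hn, this⟩))
  obtain ⟨p, hp, hpne⟩ := exists_prime_range_powMonoidHom_ne_top (A := V)
  have hD : (⨅ k : ℕ, (powMonoidHom (p ^ k) : V →* V).range) = ⊥ := by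
    by_contra hne
    refine hL.index_ne_zero_of_conj_invariant hV ?_ ?_ hne
      (index_iInf_range_powMonoidHom_eq_zero htf hp hpne)
    · rw [Subgroup.coe_iInf]
      exact isClosed_iInter fun k => hclosed _
    · intro g x hx
      rw [Subgroup.mem_iInf] at hx ⊢
      exact fun k => hinv _ g x (hx k)
  have hbasis : ∀ W ∈ 𝓝 (1 : V), ∃ k : ℕ, ((powMonoidHom (p ^ k) : V →* V).range : Set V) ⊆ W := by
    intro W hW
    refine exists_subset_nhds_of_compactSpace (directed_of_isDirected_le ?_) (fun k => hclosed _) ?_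
    · rintro i j hij _ ⟨x, rfl⟩
      refine ⟨x ^ p ^ (j - i), ?_⟩
      rw [powMonoidHom_apply, powMonoidHom_apply, ← pow_mul, ← pow_add, Nat.sub_add_cancel hij]
    · intro x hx
      rw [← Subgroup.coe_iInf, hD] at hx
      rw [show x = 1 from hx]
      exact hW
  obtain ⟨x, hx⟩ := exists_ne (1 : V)
  have hXfin : (Set.range fun g : L => (MulAut.conjNormal g : V ≃* V) x).Finite := by
    refine Set.Finite.of_finite_image (f := Subtype.val) ?_ Subtype.val_injective.injOn
    refine (finite_conjugates_of_index_ne_zero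
      (index_ne_zero_of_isOpen (hqc x x.2))).subset ?_
    rintro _ ⟨_, ⟨g, rfl⟩, rfl⟩
    exact isConj_iff.2 ⟨g, by simp⟩
  refine normallyComplemented_of_finite_procyclic hXfin ?_ fun x _ y hy hy1 =>
    exists_pow_mem_topologicalClosure_zpowers hp (fun k => hopen _ (pow_pos hp.pos k)) hbasis hy hy1
  refine hL.index_ne_zero_of_conj_invariant hV (Subgroup.isClosed_topologicalClosure _) ?_ ?_
  · intro g y hy
    refine Subgroup.topologicalClosure_minimal (t := (Subgroup.closure (Set.range fun g : L =>
      (MulAut.conjNormal g : V ≃* V) x)).topologicalClosure.comap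
        (MulAut.conjNormal g : V ≃* V).toMonoidHom) _ ?_ ?_ hy
    · rw [Subgroup.closure_le]
      rintro _ ⟨h, rfl⟩
      refine Subgroup.le_topologicalClosure _ (Subgroup.subset_closure ⟨g * h, ?_⟩)
      simp
    · exact (Subgroup.isClosed_topologicalClosure _).preimage (continuous_conjNormal g)
  · intro hbot
    have : x ∈ (Subgroup.closure (Set.range fun g : L =>
        (MulAut.conjNormal g : V ≃* V) x)).topologicalClosure :=
      Subgroup.le_topologicalClosure _ (Subgroup.subset_closure ⟨1, by simp⟩)
    rw [hbot] at this
    exact hx this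

/-- If a just infinite group `L` has no open normal abelian subgroup, then no open normal subgroup
`V` of `L` has a nontrivial abelian normal subgroup `A`: a minimal nontrivial intersection `B` of
conjugates of `A` commutes with all conjugates of `A`, so it is contained in a closed abelian normal
subgroup of `L`. -/
theorem IsJustInfinite.eq_bot_of_commute (hL : IsJustInfinite L)
    (hab : ∀ M : Subgroup L, M.Normal → IsOpen (M : Set L) → ¬ ∀ x ∈ M, ∀ y ∈ M, x * y = y * x)
    {V : Subgroup L} [V.Normal] (hV : IsOpen (V : Set L)) (A : Subgroup V) [A.Normal]
    (hA : ∀ x ∈ A, ∀ y ∈ A, x * y = y * x) : A = ⊥ := by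
  by_contra hne
  set 𝒜 := Set.range fun g : L => A.map (MulAut.conjNormal g : V ≃* V).toMonoidHom with h𝒜
  have hfin : 𝒜.Finite := finite_range_map_conjNormal (index_ne_zero_of_isOpen hV) A
  have hn : ∀ X ∈ 𝒜, X.Normal := by
    rintro _ ⟨g, rfl⟩
    exact Subgroup.Normal.map inferInstance _ (MulEquiv.surjective _)
  have hc : ∀ X ∈ 𝒜, ∀ x ∈ X, ∀ y ∈ X, x * y = y * x := by
    rintro _ ⟨g, rfl⟩ _ ⟨x, hx, rfl⟩ _ ⟨y, hy, rfl⟩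
    rw [← map_mul, ← map_mul, hA x hx y hy]
  have hA𝒜 : A ∈ 𝒜 := ⟨1, by ext; simp [Subgroup.mem_map]⟩
  obtain ⟨B, hB⟩ := ((hfin.finite_subsets.image sInf).subset
    (t := {X | X ≠ ⊥ ∧ ∃ 𝒮 ⊆ 𝒜, 𝒮.Nonempty ∧ X = sInf 𝒮}) (by
      rintro _ ⟨-, 𝒮, h𝒮, -, rfl⟩; exact ⟨𝒮, h𝒮, rfl⟩)).exists_minimal
    ⟨A, hne, {A}, Set.singleton_subset_iff.2 hA𝒜, Set.singleton_nonempty A, by simp⟩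
  obtain ⟨hBne, 𝒮, h𝒮, hne𝒮, hB𝒮⟩ := hB.prop
  have hBn : B.Normal := by
    rw [hB𝒮]
    refine ⟨fun x hx g => Subgroup.mem_sInf.2 fun X hX => ?_⟩
    exact (hn X (h𝒮 hX)).conj_mem x (Subgroup.mem_sInf.1 hx X hX) g
  have hBc : ∀ X ∈ 𝒜, ∀ b ∈ B, ∀ x ∈ X, b * x = x * b := by
    intro X hX b hb x hx
    by_cases hbot : B ⊓ X = ⊥
    · exact Subgroup.commute_of_normal_of_disjoint B X hBn (hn X hX) (disjoint_iff.2 hbot) b x hb hx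
    · have hle : B ≤ B ⊓ X := by
        refine hB.le_of_le ⟨hbot, insert X 𝒮, Set.insert_subset hX h𝒮, Set.insert_nonempty _ _, ?_⟩
          inf_le_left
        rw [sInf_insert, hB𝒮, inf_comm]
      exact hc X hX b (hle hb).2 x hx
  obtain ⟨⟨b, hb⟩, hb1'⟩ := B.ne_bot_iff_exists_ne_one.1 hBne
  have hb1 : b ≠ 1 := fun h => hb1' (Subtype.ext h)
  set F := Subgroup.normalClosure ((A.map V.subtype : Subgroup L) : Set L) with hF
  have hbF : ((b : V) : L) ∈ F := by
    obtain ⟨X, hX⟩ := hne𝒮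
    obtain ⟨g, rfl⟩ := h𝒮 hX
    have : (b : V) ∈ A.map (MulAut.conjNormal g : V ≃* V).toMonoidHom := by
      rw [hB𝒮] at hb; exact Subgroup.mem_sInf.1 hb _ hX
    obtain ⟨a, ha, hab⟩ := this
    have h1 : (a : L) ∈ F := Subgroup.subset_normalClosure ⟨a, ha, rfl⟩
    have h2 := Subgroup.normalClosure_normal.conj_mem _ h1 g
    have h3 : ((b : V) : L) = g * a * g⁻¹ := by rw [← hab]; simp
    rwa [h3]
  have hbC : ((b : V) : L) ∈ Subgroup.centralizer (F : Set L) := by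
    rw [hF, Subgroup.normalClosure, Subgroup.centralizer_closure, Subgroup.mem_centralizer_iff]
    intro y hy
    obtain ⟨_, ⟨a, ha, rfl⟩, hay⟩ := Group.mem_conjugatesOfSet_iff.1 hy
    obtain ⟨g, rfl⟩ := isConj_iff.1 hay
    have := hBc _ ⟨g, rfl⟩ b hb (MulAut.conjNormal g a) ⟨a, ha, rfl⟩
    have := congrArg Subtype.val this
    simpa using this.symm
  -- the center of the centralizer of `F` is a closed abelian normal subgroup of `L`
  set C := Subgroup.centralizer (F : Set L) with hC
  set Z := C ⊓ Subgroup.centralizer (C : Set L) with hZ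
  have hZn : Z.Normal := inferInstance
  have hZc : IsClosed (Z : Set L) :=
    (Set.isClosed_centralizer (F : Set L)).inter (Set.isClosed_centralizer (C : Set L))
  have hbZ : ((b : V) : L) ∈ Z := by
    refine ⟨hbC, Subgroup.mem_centralizer_iff.2 fun c hc => ?_⟩
    exact (Subgroup.mem_centralizer_iff.1 hc _ hbF).symm
  have hZfi := hL.2 Z hZn hZc fun hbot => hb1 (by
    rw [hbot, Subgroup.mem_bot] at hbZ
    exact Subtype.ext hbZ)
  refine hab Z hZn (isOpen_of_isClosed_of_index_ne_zero hZc hZfi.index_ne_zero) fun x hx y hy => ?_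
  exact Subgroup.mem_centralizer_iff.1 hy.2 x hx.1

/-- In the nonabelian case complements are given by centralizers. -/
theorem IsJustInfinite.normallyComplemented_of_not_commute (hL : IsJustInfinite L)
    (hab : ∀ M : Subgroup L, M.Normal → IsOpen (M : Set L) → ¬ ∀ x ∈ M, ∀ y ∈ M, x * y = y * x)
    {V : Subgroup L} [V.Normal] (hV : IsOpen (V : Set L)) : NormallyComplemented V := by
  have hVc : IsClosed (V : Set L) := Subgroup.isClosed_of_isOpen _ hV
  have : CompactSpace V := isCompact_iff_compactSpace.1 hVc.isCompact
  have hnt := hL.nontrivial_of_isOpen hV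
  have habV : ∀ A : Subgroup V, A.Normal → (∀ x ∈ A, ∀ y ∈ A, x * y = y * x) → A = ⊥ :=
    fun A _ hA => hL.eq_bot_of_commute hab hV A hA
  intro K hK hKc _
  have hBc : IsClosed (Subgroup.centralizer (K : Set V) : Set V) :=
    Set.isClosed_centralizer (K : Set V)
  refine ⟨Subgroup.centralizer (K : Set V), inferInstance, hBc, le_top,
    habV _ inferInstance fun x hx y hy => Subgroup.mem_centralizer_iff.1 hy.2 x hx.1, ?_⟩
  set D := K ⊔ Subgroup.centralizer (K : Set V) with hD
  rw [Subgroup.relIndex_top_right]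
  have hDc : IsClosed (D : Set V) := isClosed_sup_of_normal hKc hBc
  have hDt : Subgroup.centralizer (D : Set V) = ⊥ := by
    have hle : Subgroup.centralizer (D : Set V) ≤ Subgroup.centralizer (K : Set V) :=
      Subgroup.centralizer_le (le_sup_left : K ≤ D)
    refine habV _ inferInstance fun x hx y hy => ?_
    exact Subgroup.mem_centralizer_iff.1 hy x ((le_sup_right : _ ≤ D) (hle hx))
  set 𝒟 := Set.range fun g : L => D.map (MulAut.conjNormal g : V ≃* V).toMonoidHom with h𝒟
  have hfin : 𝒟.Finite := finite_range_map_conjNormal (index_ne_zero_of_isOpen hV) D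
  have hn : ∀ X ∈ 𝒟, X.Normal ∧ Subgroup.centralizer (X : Set V) = ⊥ ∧ IsClosed (X : Set V) := by
    rintro _ ⟨g, rfl⟩
    refine ⟨Subgroup.Normal.map inferInstance _ (MulEquiv.surjective _), ?_,
      (hDc.isCompact.image (continuous_conjNormal g)).isClosed⟩
    rw [Subgroup.eq_bot_iff_forall]
    intro x hx
    have : (MulAut.conjNormal g : V ≃* V).symm x ∈ Subgroup.centralizer (D : Set V) := by
      rw [Subgroup.mem_centralizer_iff] at hx ⊢
      intro d hd
      have := congrArg (MulAut.conjNormal g : V ≃* V).symm (hx _ ⟨d, hd, rfl⟩)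
      simpa using this
    rw [hDt, Subgroup.mem_bot] at this
    simpa using this
  have key : ∀ 𝒮 : Set (Subgroup V), 𝒮.Finite → 𝒮 ⊆ 𝒟 →
      (sInf 𝒮).Normal ∧ Subgroup.centralizer ((sInf 𝒮 : Subgroup V) : Set V) = ⊥ := by
    intro 𝒮 h𝒮
    induction 𝒮, h𝒮 using Set.Finite.induction_on with
    | empty =>
      intro _
      rw [sInf_empty]
      refine ⟨inferInstance, habV _ inferInstance fun x _ y hy => ?_⟩
      exact Subgroup.mem_centralizer_iff.1 hy x trivial
    | @insert X 𝒮 _ _ ih =>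
      intro h
      obtain ⟨h1, h2⟩ := ih ((Set.subset_insert _ _).trans h)
      obtain ⟨h3, h4, -⟩ := hn X (h (Set.mem_insert _ _))
      rw [sInf_insert]
      exact ⟨inferInstance, centralizer_inf_eq_bot habV h4 h2⟩
  have hNt := (key 𝒟 hfin le_rfl).2
  have hNi : (sInf 𝒟).index ≠ 0 := by
    refine hL.index_ne_zero_of_conj_invariant hV ?_ ?_ ?_
    · rw [Subgroup.coe_sInf]
      exact isClosed_biInter fun X hX => (hn X hX).2.2
    · intro g x hx
      rw [Subgroup.mem_sInf] at hx ⊢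
      rintro _ ⟨h, rfl⟩
      obtain ⟨d, hd, hdx⟩ := hx _ ⟨g⁻¹ * h, rfl⟩
      refine ⟨d, hd, ?_⟩
      rw [← hdx]
      ext; simp [mul_assoc]
    · intro hbot
      rw [hbot] at hNt
      obtain ⟨x, hx⟩ := exists_ne (1 : V)
      have : x ∈ Subgroup.centralizer ((⊥ : Subgroup V) : Set V) := by
        rw [Subgroup.mem_centralizer_iff]
        rintro y rfl
        simp
      rw [hNt] at this
      exact hx this
  refine fun h0 => hNi (Nat.eq_zero_of_zero_dvd (h0 ▸ Subgroup.index_dvd_of_le (sInf_le ?_)))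
  exact ⟨1, by ext; simp [Subgroup.mem_map]⟩

theorem IsJustInfinite.exists_normallyComplemented [TotallyDisconnectedSpace L]
    (hL : IsJustInfinite L) {u : Set L} (hu : IsOpen u) (h1 : 1 ∈ u) :
    ∃ V : Subgroup L, IsOpen (V : Set L) ∧ (V : Set L) ⊆ u ∧ NormallyComplemented V := by
  by_cases hab : ∀ M : Subgroup L, M.Normal → IsOpen (M : Set L) →
      ¬ ∀ x ∈ M, ∀ y ∈ M, x * y = y * x
  · obtain ⟨V, hV⟩ := ProfiniteGrp.exist_openNormalSubgroup_sub_open_nhds_of_one hu h1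
    exact ⟨V, V.isOpen, hV, hL.normallyComplemented_of_not_commute hab V.isOpen⟩
  · push Not at hab
    obtain ⟨M, hM, hMo, hMc⟩ := hab
    obtain ⟨V, hV⟩ := ProfiniteGrp.exist_openNormalSubgroup_sub_open_nhds_of_one (hu.inter hMo)
      ⟨h1, M.one_mem⟩
    exact ⟨V, V.isOpen, hV.trans Set.inter_subset_left, hL.normallyComplemented_of_commute V.isOpen
      fun x hx y hy => hMc x (hV hx).2 y (hV hy).2⟩

end JustInfinite

/-- A product of finitely many just infinite and arbitrarily many finite simple profinite groups
has local complements. -/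
theorem hasLocalComplements_pi {I : Type*} {L : I → ProfiniteGrp} {J : Set I} (hJ : J.Finite)
    (hL : ∀ i ∈ J, IsJustInfinite (L i)) (hS : ∀ i ∉ J, Finite (L i) ∧ IsSimpleGroup (L i)) :
    HasLocalComplements (∀ i, L i) := by
  classical
  refine HasLocalComplements.of_basis fun O hO => ?_
  obtain ⟨F, u, hu, hFO⟩ := isOpen_pi_iff.1 hO 1 O.one_mem
  have hV : ∀ i, ∃ V : Subgroup (L i), IsOpen (V : Set (L i)) ∧ (i ∈ F → (V : Set (L i)) ⊆ u i) ∧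
      (i ∉ F → i ∉ J → V = ⊤) ∧ (i ∈ J → NormallyComplemented V) ∧
      (i ∉ J → ∀ N : Subgroup V, N.Normal → N = ⊥ ∨ N = ⊤) := by
    intro i
    by_cases hiJ : i ∈ J
    · obtain ⟨V, hV, hVu, hVc⟩ := (hL i hiJ).exists_normallyComplemented
        (u := if i ∈ F then u i else Set.univ) (by split_ifs with h <;> simp [hu _ , h])
        (by split_ifs with h; exacts [(hu i h).2, trivial])
      exact ⟨V, hV, fun h => by simpa [h] using hVu, fun _ h => (h hiJ).elim, fun _ => hVc,
        fun h => (h hiJ).elim⟩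
    · obtain ⟨hfin, hsim⟩ := hS i hiJ
      by_cases hiF : i ∈ F
      · refine ⟨⊥, isOpen_discrete _, fun _ => ?_, fun h => (h hiF).elim, fun h => (hiJ h).elim,
          fun _ N _ => Or.inl (Subsingleton.elim _ _)⟩
        rintro _ rfl
        exact (hu i hiF).2
      · refine ⟨⊤, isOpen_univ, fun h => (hiF h).elim, fun _ _ => rfl, fun h => (hiJ h).elim,
          fun _ N hN => ?_⟩
        have : IsSimpleGroup (⊤ : Subgroup (L i)) :=
          IsSimpleGroup.isSimpleGroup_of_surjective
            (Subgroup.topEquiv (G := L i)).symm.toMonoidHom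
            (Subgroup.topEquiv (G := L i)).symm.surjective
        exact this.eq_bot_or_eq_top_of_normal N hN
  choose V hVo hVu hVtop hVJ hVS using hV
  have hcV : ∀ i, CompactSpace (V i) := fun i =>
    isCompact_iff_compactSpace.1 (Subgroup.isClosed_of_isOpen _ (hVo i)).isCompact
  let ι : (∀ i, V i) →* ∀ i, L i :=
    MonoidHom.pi fun i => (V i).subtype.comp (Pi.evalMonoidHom (fun i => V i) i)
  have hιc : Continuous ι :=
    continuous_pi fun i => continuous_subtype_val.comp (continuous_apply i)
  have hιi : Function.Injective ι := fun x y h => funext fun i => Subtype.ext (congrFun h i)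
  have hr : Set.range ι = (F ∪ hJ.toFinset : Set I).pi fun i => (V i : Set (L i)) := by
    ext x
    constructor
    · rintro ⟨y, rfl⟩ i _
      exact (y i).2
    · intro hx
      have hx' : ∀ i, x i ∈ V i := by
        intro i
        by_cases hi : i ∈ F ∨ i ∈ J
        · exact hx i (by simpa using hi)
        · push Not at hi
          rw [hVtop i hi.1 hi.2]
          trivial
      exact ⟨fun i => ⟨x i, hx' i⟩, rfl⟩
  refine ⟨∀ i, V i, inferInstance, inferInstance, inferInstance, inferInstance, inferInstance, ι,
    hιc, hιi, isOpenMap_of_injective_of_isOpen_range hιc hιi ?_, ?_,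
    normallyComplemented_pi hJ hVJ hVS⟩
  · rw [hr]
    exact isOpen_set_pi (by rw [← Finset.coe_union]; exact Finset.finite_toSet _)
      fun i _ => hVo i
  · rintro _ ⟨y, rfl⟩
    exact hFO fun i hi => hVu i hi (y i).2

/-! ### The intersection of the maximal open normal subgroups -/

section Melnikov

/-- A maximal open normal subgroup; the quotient by it is a finite simple group if the ambient group
is compact. -/
structure IsMaxOpenNormal {V : Type*} [Group V] [TopologicalSpace V] (M : Subgroup V) : Prop where
  normal : M.Normal
  isOpen : IsOpen (M : Set V)
  ne_top : M ≠ ⊤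
  eq_or_eq : ∀ N : Subgroup V, N.Normal → M ≤ N → N = M ∨ N = ⊤

/-- The Melnikov subgroup of a profinite group, the intersection of its maximal open normal
subgroups. -/
def melnikov (V : Type*) [Group V] [TopologicalSpace V] : Subgroup V :=
  sInf {M | IsMaxOpenNormal M}

theorem IsMaxOpenNormal.comap {V W : Type*} [Group V] [TopologicalSpace V] [Group W]
    [TopologicalSpace W] {M : Subgroup W} (hM : IsMaxOpenNormal M) (e : V ≃* W)
    (he : Continuous e) : IsMaxOpenNormal (M.comap e.toMonoidHom) := by
  have := hM.normal
  refine ⟨inferInstance, hM.isOpen.preimage he, fun h => hM.ne_top ?_, fun N hN hMN => ?_⟩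
  · rw [eq_top_iff]
    intro x _
    have : e.symm x ∈ M.comap e.toMonoidHom := by rw [h]; trivial
    simpa using this
  · have hle : M ≤ N.map e.toMonoidHom := by
      intro x hx
      exact ⟨e.symm x, hMN (by simpa using hx), by simp⟩
    have hinj : Function.Injective e.toMonoidHom := e.injective
    rcases hM.eq_or_eq _ (hN.map _ e.surjective) hle with h | h
    · left
      rw [← h, Subgroup.comap_map_eq_self_of_injective hinj]
    · right
      rw [← Subgroup.comap_map_eq_self_of_injective hinj N, h, Subgroup.comap_top]

variable {V : Type u} [Group V] [TopologicalSpace V]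

instance : (melnikov V).Normal :=
  ⟨fun x hx g => Subgroup.mem_sInf.2 fun M hM =>
    hM.normal.conj_mem x (Subgroup.mem_sInf.1 hx M hM) g⟩

theorem IsMaxOpenNormal.isSimpleGroup {M : Subgroup V} [M.Normal] (hM : IsMaxOpenNormal M) :
    IsSimpleGroup (V ⧸ M) := by
  have : Nontrivial (V ⧸ M) := by
    rw [QuotientGroup.nontrivial_iff]; exact hM.ne_top
  refine ⟨fun N hN => ?_⟩
  rcases hM.eq_or_eq (N.comap (QuotientGroup.mk' M)) inferInstance (by
    intro x hx
    rw [Subgroup.mem_comap, QuotientGroup.mk'_apply, (QuotientGroup.eq_one_iff x).2 hx]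
    exact one_mem N) with h | h
  · left
    rw [eq_bot_iff]
    intro y hy
    obtain ⟨x, rfl⟩ := QuotientGroup.mk'_surjective M y
    have : x ∈ N.comap (QuotientGroup.mk' M) := hy
    rw [h] at this
    exact (QuotientGroup.eq_one_iff x).2 this
  · right
    rw [eq_top_iff]
    intro y _
    obtain ⟨x, rfl⟩ := QuotientGroup.mk'_surjective M y
    have : x ∈ N.comap (QuotientGroup.mk' M) := by rw [h]; trivial
    exact this

/-- A maximal independent family of maximal open normal subgroups has the same intersection as the
family of all of them. -/
theorem exists_independent_isMaxOpenNormal :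
    ∃ 𝓘 : Set (Subgroup V), (∀ M ∈ 𝓘, IsMaxOpenNormal M) ∧ sInf 𝓘 = melnikov V ∧
      ∀ M ∈ 𝓘, ∀ F : Set (Subgroup V), F.Finite → F ⊆ 𝓘 → M ∉ F → ¬ sInf F ≤ M := by
  obtain ⟨𝓘, -, h𝓘⟩ := zorn_subset_nonempty
    {𝓘 : Set (Subgroup V) | (∀ M ∈ 𝓘, IsMaxOpenNormal M) ∧
      ∀ M ∈ 𝓘, ∀ F : Set (Subgroup V), F.Finite → F ⊆ 𝓘 → M ∉ F → ¬ sInf F ≤ M} (by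
      intro c hc hchain hne
      refine ⟨⋃₀ c, ⟨?_, ?_⟩, fun s hs => Set.subset_sUnion_of_mem hs⟩
      · rintro M ⟨s, hs, hM⟩
        exact (hc hs).1 M hM
      · rintro M ⟨s, hs, hM⟩ F hF hFc hMF
        obtain ⟨t, ht, hFt⟩ := hchain.directedOn.exists_mem_subset_of_finite_of_subset_sUnion
          hne hF hFc
        obtain ⟨r, hr, hsr, htr⟩ := hchain.directedOn s hs t ht
        exact (hc hr).2 M (hsr hM) F hF (hFt.trans htr) hMF)
    ∅ ⟨by simp, by simp⟩
  refine ⟨𝓘, h𝓘.prop.1, le_antisymm ?_ (sInf_le_sInf fun M hM => h𝓘.prop.1 M hM), h𝓘.prop.2⟩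
  have hnormal : ∀ F ⊆ {M : Subgroup V | IsMaxOpenNormal M}, (sInf F).Normal := fun F hF =>
    ⟨fun x hx g => Subgroup.mem_sInf.2 fun X hX =>
      (hF hX).normal.conj_mem x (Subgroup.mem_sInf.1 hx X hX) g⟩
  refine le_sInf fun M hM => ?_
  by_contra hle
  have hM𝓘 : M ∉ 𝓘 := fun h => hle (sInf_le h)
  have := hM.normal
  refine hM𝓘 (h𝓘.le_of_ge (y := insert M 𝓘) ⟨?_, ?_⟩ (Set.subset_insert _ _)
    (Set.mem_insert _ _))
  · rintro X (rfl | hX)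
    exacts [hM, h𝓘.prop.1 X hX]
  have hstep : ∀ F ⊆ 𝓘, ¬ sInf F ≤ M := fun F hF h => hle ((sInf_le_sInf hF).trans h)
  rintro X (rfl | hX) F hF hFM hXF
  · refine hstep F fun Y hY => (hFM hY).resolve_left ?_
    rintro rfl
    exact hXF hY
  · intro hFX
    set F' := F \ {M} with hF'
    have hF'𝓘 : F' ⊆ 𝓘 := fun Y hY => (hFM hY.1).resolve_left hY.2
    have hF'n : (sInf F').Normal := hnormal _ fun Y hY => h𝓘.prop.1 Y (hF'𝓘 hY)
    have hXn := (h𝓘.prop.1 X hX).normal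
    have h1 : ¬ sInf F' ≤ X := h𝓘.prop.2 X hX F' (hF.subset Set.sdiff_subset) hF'𝓘
      fun h => hXF h.1
    have h2 : ¬ sInf F' ⊓ X ≤ M := by
      have := hstep (insert X F') (Set.insert_subset hX hF'𝓘)
      rwa [sInf_insert, inf_comm] at this
    have h3 : (sInf F' ⊓ X) ⊔ M = ⊤ := by
      refine (hM.eq_or_eq _ inferInstance le_sup_right).resolve_left fun h => h2 ?_
      exact h ▸ le_sup_left
    have h4 : sInf F' ⊓ M ≤ X := by
      refine le_trans (le_sInf fun Y hY => ?_) hFX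
      by_cases hYM : Y = M
      · rw [hYM]; exact inf_le_right
      · exact inf_le_left.trans (sInf_le ⟨hY, hYM⟩)
    refine h1 ?_
    have h5 := inf_sup_eq_sup_inf_of_le M (inf_le_left : sInf F' ⊓ X ≤ sInf F')
    rw [h3, inf_top_eq] at h5
    rw [h5]
    exact sup_le inf_le_right h4

variable [IsTopologicalGroup V]

theorem isClosed_melnikov : IsClosed (melnikov V : Set V) := by
  rw [melnikov, Subgroup.coe_sInf]
  exact isClosed_biInter fun _ hM => Subgroup.isClosed_of_isOpen _ hM.isOpen

theorem conjNormal_mem_melnikov {U : Type*} [Group U] [TopologicalSpace U] [IsTopologicalGroup U]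
    {W : Subgroup U} [W.Normal] (g : U) {x : W} (hx : x ∈ melnikov W) :
    MulAut.conjNormal g x ∈ melnikov W :=
  Subgroup.mem_sInf.2 fun _ hM =>
    Subgroup.mem_sInf.1 hx _ (IsMaxOpenNormal.comap hM (MulAut.conjNormal g)
      (continuous_conjNormal g))

variable [CompactSpace V]

/-- The quotient of a profinite group by the Melnikov subgroup is a product of simple groups. -/
theorem exists_surjective_pi_isMaxOpenNormal :
    ∃ 𝓘 : Set (Subgroup V), (∀ M ∈ 𝓘, IsMaxOpenNormal M) ∧ sInf 𝓘 = melnikov V ∧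
      ∀ t : 𝓘 → V, ∃ v : V, ∀ M : 𝓘, (t M)⁻¹ * v ∈ (M : Subgroup V) := by
  obtain ⟨𝓘, hmax, hinf, hind⟩ := exists_independent_isMaxOpenNormal (V := V)
  refine ⟨𝓘, hmax, hinf, fun t => ?_⟩
  classical
  have hfin : ∀ F : Finset 𝓘, ∃ v : V, ∀ M ∈ F, (t M)⁻¹ * v ∈ (M : Subgroup V) := by
    intro F
    induction F using Finset.induction_on with
    | empty => exact ⟨1, by simp⟩
    | insert M F hMF ih =>
      obtain ⟨v, hv⟩ := ih
      have hMm := hmax M M.2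
      set X : Subgroup V := sInf (Subtype.val '' (F : Set 𝓘)) with hX
      have hXn : X.Normal := ⟨fun x hx g => Subgroup.mem_sInf.2 (by
        rintro _ ⟨N, hN, rfl⟩
        exact (hmax N N.2).normal.conj_mem x (Subgroup.mem_sInf.1 hx _ ⟨N, hN, rfl⟩) g)⟩
      have hMn := hMm.normal
      have hXM : X ⊔ M = ⊤ := by
        refine (hMm.eq_or_eq _ inferInstance le_sup_right).resolve_left fun h => ?_
        refine hind M M.2 _ (F.finite_toSet.image _) ?_ ?_ (h ▸ le_sup_left : X ≤ M)
        · rintro _ ⟨N, -, rfl⟩; exact N.2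
        · rintro ⟨N, hN, hNM⟩
          exact hMF (Subtype.ext hNM ▸ hN)
      obtain ⟨x, hx, m, hm, hxm⟩ := Subgroup.mem_sup_of_normal_right.1
        (show v⁻¹ * t M ∈ X ⊔ (M : Subgroup V) by rw [hXM]; trivial)
      refine ⟨v * x, fun N hN => ?_⟩
      rcases Finset.mem_insert.1 hN with rfl | hNF
      · have : (t N)⁻¹ * (v * x) = m⁻¹ := by
          rw [eq_mul_inv_of_mul_eq hxm]; group
        rw [this]
        exact inv_mem hm
      · rw [← mul_assoc]
        exact mul_mem (hv N hNF) (Subgroup.mem_sInf.1 hx _ ⟨N, hNF, rfl⟩)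
  have hcl : ∀ M : 𝓘, IsClosed {v : V | (t M)⁻¹ * v ∈ (M : Subgroup V)} := fun M =>
    (Subgroup.isClosed_of_isOpen _ (hmax M M.2).isOpen).preimage (by fun_prop)
  obtain ⟨v, hv⟩ := CompactSpace.iInter_nonempty hcl fun F => by
    obtain ⟨v, hv⟩ := hfin F
    exact ⟨v, Set.mem_iInter₂.2 hv⟩
  exact ⟨v, Set.mem_iInter.1 hv⟩

/-- Every proper closed normal subgroup of a profinite group lies in a maximal open one. -/
theorem exists_isMaxOpenNormal_ge [TotallyDisconnectedSpace V] {N : Subgroup V} [N.Normal]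
    (hN : IsClosed (N : Set V)) (hne : N ≠ ⊤) : ∃ M : Subgroup V, IsMaxOpenNormal M ∧ N ≤ M := by
  obtain ⟨x, -, hx⟩ := SetLike.exists_of_lt (lt_top_iff_ne_top.2 hne)
  obtain ⟨W, hW⟩ := ProfiniteGrp.exist_openNormalSubgroup_sub_open_nhds_of_one
    (U := (fun w => x * w⁻¹) ⁻¹' (N : Set V)ᶜ) (hN.isOpen_compl.preimage (by fun_prop)) (by simpa)
  have hxW : x ∉ N ⊔ (W : Subgroup V) := by
    intro h
    obtain ⟨n, hn, w, hw, rfl⟩ := Subgroup.mem_sup_of_normal_right.1 h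
    exact hW hw (by simpa using hn)
  have hopen : IsOpen ((N ⊔ (W : Subgroup V) : Subgroup V) : Set V) :=
    Subgroup.isOpen_mono le_sup_right W.isOpen
  -- a proper normal subgroup of smallest index above `N ⊔ W`
  have hex : ∃ n, ∃ M : Subgroup V, M.Normal ∧ N ⊔ (W : Subgroup V) ≤ M ∧ M ≠ ⊤ ∧ M.index = n :=
    ⟨_, N ⊔ (W : Subgroup V), inferInstance, le_rfl, fun h => hxW (h ▸ trivial), rfl⟩
  classical
  obtain ⟨M, hMn, hWM, hMt, hMi⟩ := Nat.find_spec hex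
  have hMo := Subgroup.isOpen_mono hWM hopen
  have hfi : M.FiniteIndex := ⟨index_ne_zero_of_isOpen hMo⟩
  refine ⟨M, ⟨hMn, hMo, hMt, fun X hX hMX => ?_⟩, le_sup_left.trans hWM⟩
  by_contra! hcon
  have hlt := Subgroup.index_strictAnti (lt_of_le_of_ne hMX hcon.1.symm)
  rw [hMi] at hlt
  exact Nat.find_min hex hlt ⟨X, hX, hWM.trans hMX, hcon.2, rfl⟩

/-- A subgroup that is a virtual complement of the Melnikov subgroup is locally isomorphic to a
product of finite simple groups. -/
theorem exists_locallyIsomorphic_pi_simple [T2Space V] {B : Subgroup V} (hB : IsClosed (B : Set V))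
    (hd : melnikov V ⊓ B = ⊥) (ho : IsOpen ((melnikov V ⊔ B : Subgroup V) : Set V)) :
    ∃ (I : Type u) (S : I → ProfiniteGrp.{u}), (∀ i, Finite (S i) ∧ IsSimpleGroup (S i)) ∧
      LocallyIsomorphic B (∀ i, S i) ∧ ((melnikov V).index = 0 → Infinite I) := by
  obtain ⟨𝓘, hmax, hinf, hsurj⟩ := exists_surjective_pi_isMaxOpenNormal (V := V)
  have hn : ∀ M : 𝓘, (M : Subgroup V).Normal := fun M => (hmax M M.2).normal
  have hsim : ∀ M : 𝓘, IsSimpleGroup (V ⧸ (M : Subgroup V)) := fun M =>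
    (hmax M M.2).isSimpleGroup
  have hdisc : ∀ M : 𝓘, DiscreteTopology (V ⧸ (M : Subgroup V)) := fun M =>
    QuotientGroup.discreteTopology (hmax M M.2).isOpen
  have hfin : ∀ M : 𝓘, Finite (V ⧸ (M : Subgroup V)) := fun M =>
    Subgroup.quotient_finite_of_isOpen _ (hmax M M.2).isOpen
  let S : 𝓘 → ProfiniteGrp.{u} := fun M => ProfiniteGrp.of (V ⧸ (M : Subgroup V))
  let θ : V →* ∀ M : 𝓘, V ⧸ (M : Subgroup V) := MonoidHom.pi fun M => QuotientGroup.mk' _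
  have hθc : Continuous θ := continuous_pi fun M => QuotientGroup.continuous_mk
  have hθs : Function.Surjective θ := by
    intro y
    obtain ⟨v, hv⟩ := hsurj fun M => (y M).out
    refine ⟨v, funext fun M => ?_⟩
    rw [← (y M).out_eq']
    exact (QuotientGroup.eq.2 (hv M)).symm
  have hker : ∀ x, θ x = 1 ↔ x ∈ melnikov V := by
    intro x
    rw [← hinf, Subgroup.mem_sInf, funext_iff]
    constructor
    · exact fun h M hM =>
        have := hn ⟨M, hM⟩
        (QuotientGroup.eq_one_iff x).1 (h ⟨M, hM⟩)
    · exact fun h M => (QuotientGroup.eq_one_iff x).2 (h M M.2)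
  have hθo : IsOpenMap θ := MonoidHom.isOpenMap_of_sigmaCompact θ hθs hθc
  have hcB : CompactSpace B := isCompact_iff_compactSpace.1 hB.isCompact
  refine ⟨𝓘, S, fun M => ⟨hfin M, hsim M⟩, ?_, fun h0 => ?_⟩
  · refine LocallyIsomorphic.of_isOpen_range (θ.comp B.subtype)
      (hθc.comp continuous_subtype_val) ?_ ?_
    · rw [injective_iff_map_eq_one]
      intro x hx
      have : (x : V) ∈ melnikov V ⊓ B := ⟨(hker x).1 hx, x.2⟩
      rw [hd] at this
      exact Subtype.ext this
    · convert hθo _ ho using 1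
      ext y
      constructor
      · rintro ⟨x, rfl⟩
        exact ⟨x, (le_sup_right : B ≤ _) x.2, rfl⟩
      · rintro ⟨_, hx, rfl⟩
        obtain ⟨m, hm, b, hb, rfl⟩ := Subgroup.mem_sup_of_normal_left.1 hx
        exact ⟨⟨b, hb⟩, by rw [map_mul, (hker m).2 hm, one_mul]; rfl⟩
  · by_contra hI
    rw [not_infinite_iff_finite] at hI
    refine Subgroup.index_iInf_ne_zero (f := fun M : 𝓘 => (M : Subgroup V))
      (fun M => index_ne_zero_of_isOpen (hmax M M.2).isOpen) ?_
    rw [← sInf_eq_iInf', hinf, h0]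

end Melnikov

/-- A group locally isomorphic to an infinite product of finite simple groups has quasi-central
torsion. -/
theorem not_noQuasiCentralTorsion_of_locallyIsomorphic_pi {B : Type*} [Group B] [TopologicalSpace B]
    [IsTopologicalGroup B] {I : Type*} [Infinite I] {S : I → ProfiniteGrp}
    (hS : ∀ i, Finite (S i) ∧ IsSimpleGroup (S i)) (h : LocallyIsomorphic B (∀ i, S i)) :
    ¬ NoQuasiCentralTorsion B := by
  classical
  intro hB
  obtain ⟨U, hU, θ, -, hi, ho⟩ := h.symm
  obtain ⟨F, u, hu, hFU⟩ := isOpen_pi_iff.1 hU 1 U.one_mem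
  obtain ⟨i, hi'⟩ := Infinite.exists_notMem_finset F
  have := (hS i).1
  have := (hS i).2
  obtain ⟨s, hs⟩ := exists_ne (1 : S i)
  have hsU : Pi.mulSingle i s ∈ U := hFU fun j hj => by
    have hji : j ≠ i := by rintro rfl; exact hi' hj
    rw [Pi.mulSingle_eq_of_ne hji]
    exact (hu j hj).2
  have hord : IsOfFinOrder (θ ⟨Pi.mulSingle i s, hsU⟩) := by
    refine MonoidHom.isOfFinOrder _ (isOfFinOrder_coe_iff.1 ?_)
    exact MonoidHom.isOfFinOrder (MonoidHom.mulSingle (fun i => S i) i) (isOfFinOrder_of_finite s)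
  have hqc : θ ⟨Pi.mulSingle i s, hsU⟩ ∈ quasiCenter B := by
    have hV : IsOpen {x : ∀ i, S i | x i = 1} :=
      (isOpen_discrete ({1} : Set (S i))).preimage
        (continuous_apply (A := fun i => S i) i)
    have h1 := ho _ (hV.preimage continuous_subtype_val)
    refine Subgroup.isOpen_of_mem_nhds (g := 1) _ (Filter.mem_of_superset
      (h1.mem_nhds ⟨1, rfl, map_one θ⟩) ?_)
    rintro _ ⟨x, hx, rfl⟩
    refine Subgroup.mem_centralizer_singleton_iff.2 ?_
    rw [← map_mul, ← map_mul]
    refine congrArg θ (Subtype.ext (funext fun j => ?_))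
    rcases eq_or_ne j i with rfl | hij
    · have : (x : ∀ i, S i) j = 1 := hx
      simp [this]
    · simp [Pi.mulSingle_eq_of_ne hij]
  have := hB _ hqc hord
  rw [← map_one θ] at this
  exact hs (by simpa using congrArg (fun z : U => (z : ∀ i, S i) i) (hi this))

/-! ### Groups with dense quasi-central torsion -/

section DenseTorsion

variable {U : Type u} [Group U] [TopologicalSpace U] [IsTopologicalGroup U] [CompactSpace U]
  [T2Space U]

theorem finite_of_inf_eq_bot {G : Type*} [Group G] {A B : Subgroup G} (hB : B.relIndex A ≠ 0)
    (h : A ⊓ B = ⊥) : Finite A := by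
  have h1 : B.subgroupOf A = ⊥ := by
    rw [Subgroup.subgroupOf_eq_bot, disjoint_iff, inf_comm, h]
  rw [Subgroup.relIndex, h1, Subgroup.index_bot] at hB
  exact Nat.finite_of_card_ne_zero hB

theorem le_normalizer_of_conj_mem {G : Type*} [Group G] {S R : Subgroup G}
    (h : ∀ g ∈ S, ∀ x ∈ R, g * x * g⁻¹ ∈ R) : S ≤ Subgroup.normalizer (R : Set G) := by
  intro g hg
  rw [Subgroup.mem_normalizer_iff]
  refine fun x => ⟨h g hg x, fun hx => ?_⟩
  have := h g⁻¹ (inv_mem hg) _ hx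
  simpa [mul_assoc] using this

/-- If quasi-central torsion is dense, then infinite closed normal subgroups contain nontrivial
finite normal ones. -/
theorem HasLocalComplements.exists_finite_normal (hU : HasLocalComplements U)
    (hD : Dense {x : U | x ∈ quasiCenter U ∧ IsOfFinOrder x}) {K : Subgroup U} [K.Normal]
    (hK : IsClosed (K : Set U)) (hinf : Infinite K) :
    ∃ E : Subgroup U, E.Normal ∧ Finite E ∧ E ≠ ⊥ ∧ E ≤ K := by
  obtain ⟨L, B, hLK, hKB, hLB⟩ := hU K hK (by rw [Subgroup.normalizer_eq_top]; exact isOpen_univ)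
  have hex : ∃ d ∈ L ⊔ B, d ∈ quasiCenter U ∧ IsOfFinOrder d ∧ d ∉ B := by
    by_contra! hcon
    have hle : ((L ⊔ B : Subgroup U) : Set U) ⊆ B := by
      refine (hD.open_subset_closure_inter hLB.isOpen_sup).trans
        (closure_minimal ?_ hLB.2.isClosed)
      rintro d ⟨hd, hdq, hdo⟩
      exact hcon d hd hdq hdo
    have hBo : IsOpen (B : Set U) := Subgroup.isOpen_mono hle hLB.isOpen_sup
    exact hinf.not_finite (finite_of_inf_eq_bot
      (relIndex_ne_zero_of_index (index_ne_zero_of_isOpen hBo) K) hKB)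
  obtain ⟨d, hdO, hdq, hdo, hdB⟩ := hex
  obtain ⟨l, hl, b, hb, rfl⟩ := hLB.mem_sup.1 hdO
  have hl1 : l ≠ 1 := by
    rintro rfl
    exact hdB (by simpa using hb)
  have hlo : IsOfFinOrder l := by
    obtain ⟨n, hn, hdn⟩ := isOfFinOrder_iff_pow_eq_one.1 hdo
    rw [(show Commute l b from hLB.comm l hl b hb).mul_pow] at hdn
    refine isOfFinOrder_iff_pow_eq_one.2 ⟨n, hn, ?_⟩
    exact (eq_and_eq_of_mul_eq_mul hLB.disjoint (pow_mem hl n) (one_mem L) (pow_mem hb n)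
      (one_mem B) (by rw [hdn, one_mul])).1
  have hlq : l ∈ quasiCenter U := by
    refine Subgroup.isOpen_mono (H₁ := Subgroup.centralizer {l * b} ⊓ (L ⊔ B)) ?_
      (IsOpen.inter hdq hLB.isOpen_sup)
    rintro x ⟨hx, hxO⟩
    obtain ⟨l', hl', b', hb', rfl⟩ := hLB.mem_sup.1 hxO
    have hx := Subgroup.mem_centralizer_singleton_iff.1 hx
    have e : (l' * l) * (b' * b) = (l * l') * (b * b') := by
      calc (l' * l) * (b' * b) = l' * (l * b') * b := by group
        _ = l' * b' * (l * b) := by rw [hLB.comm l hl b' hb']; group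
        _ = l * (b * l') * b' := by rw [hx]; group
        _ = (l * l') * (b * b') := by rw [← hLB.comm l' hl' b hb]; group
    have h1 := (eq_and_eq_of_mul_eq_mul hLB.disjoint (mul_mem hl' hl) (mul_mem hl hl')
      (mul_mem hb' hb) (mul_mem hb hb') e).1
    rw [Subgroup.mem_centralizer_singleton_iff, mul_assoc, ← hLB.comm l hl b' hb', ← mul_assoc, h1,
      mul_assoc]
  refine ⟨Subgroup.normalClosure {l}, Subgroup.normalClosure_normal,
    finite_normalClosure_singleton (index_ne_zero_of_isOpen hlq) hlo, fun hbot => hl1 ?_,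
    Subgroup.normalClosure_le_normal (Set.singleton_subset_iff.2 (hLK hl))⟩
  have : l ∈ Subgroup.normalClosure {l} := Subgroup.subset_normalClosure rfl
  rwa [hbot] at this

instance {W : Subgroup U} [W.Normal] : ((melnikov W).map W.subtype).Normal := by
  refine ⟨?_⟩
  rintro _ ⟨x, hx, rfl⟩ g
  exact ⟨_, conjNormal_mem_melnikov g hx, by simp⟩

variable [TotallyDisconnectedSpace U]

/-- A profinite group with local complements and dense quasi-central torsion has an open normal
subgroup `V` with finite Melnikov subgroup. Otherwise there are a decreasing sequence of open normal
subgroups `V n` and nontrivial finite normal subgroups `E n` in the Melnikov subgroup of `V n` such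
that `V (n + 1)` avoids the product `P (n + 1)` of the subgroups `E i` with `i ≤ n`. A local
complement of `⨅ n, P n ⊔ V n` then yields a normal complement of some `E m` in `V m`, which is
impossible for a subgroup of the Melnikov subgroup. -/
theorem HasLocalComplements.exists_finite_melnikov (hU : HasLocalComplements U)
    (hD : Dense {x : U | x ∈ quasiCenter U ∧ IsOfFinOrder x}) :
    ∃ V : Subgroup U, V.Normal ∧ IsOpen (V : Set U) ∧ Finite (melnikov V) := by
  by_contra! hcon
  let T := {p : Subgroup U × Subgroup U // p.1.Normal ∧ IsOpen (p.1 : Set U) ∧ p.2.Normal ∧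
    Finite p.2 ∧ p.1 ⊓ p.2 = ⊥}
  have hstep : ∀ p : T, ∃ (E : Subgroup U) (q : T), E.Normal ∧ Finite E ∧ E ≠ ⊥ ∧
      E ≤ (melnikov p.1.1).map p.1.1.subtype ∧ q.1.1 ≤ p.1.1 ∧ q.1.2 = p.1.2 ⊔ E := by
    rintro ⟨⟨V, P⟩, hVn, hVo, hPn, hPf, hVP⟩
    have hVc : IsClosed (V : Set U) := Subgroup.isClosed_of_isOpen _ hVo
    have hinf : Infinite ((melnikov V).map V.subtype) := by
      have := hcon V hVn hVo
      refine Infinite.of_injective (fun x : melnikov V => (⟨x.1.1, x.1, x.2, rfl⟩ :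
        (melnikov V).map V.subtype)) fun x y h => ?_
      have h' : (x.1 : U) = y.1 :=
        congrArg (fun z : (melnikov V).map V.subtype => (z : U)) h
      exact Subtype.ext (Subtype.ext h')
    obtain ⟨E, hEn, hEf, hE1, hEM⟩ := hU.exists_finite_normal hD
      (hVc.isClosedMap_subtype_val _ (isClosed_melnikov (V := V))) hinf
    have hPE : ((P ⊔ E : Subgroup U) : Set U).Finite := by
      rw [Subgroup.mul_normal]
      exact (Set.toFinite (P : Set U)).mul (Set.toFinite (E : Set U))
    obtain ⟨V', hV'⟩ := ProfiniteGrp.exist_openNormalSubgroup_sub_open_nhds_of_one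
      (hVo.inter (hPE.subset (Set.sdiff_subset (t := {1}))).isClosed.isOpen_compl)
      ⟨V.one_mem, by simp⟩
    refine ⟨E, ⟨⟨V', P ⊔ E⟩, inferInstance, V'.isOpen, inferInstance, hPE.to_subtype, ?_⟩, hEn,
      hEf, hE1, hEM, fun x hx => (hV' hx).1, rfl⟩
    rw [Subgroup.eq_bot_iff_forall]
    rintro x ⟨hxV, hxP⟩
    by_contra hx1
    exact (hV' hxV).2 ⟨hxP, hx1⟩
  choose e f he using hstep
  let s : ℕ → T := fun n => f^[n] ⟨⟨⊤, ⊥⟩, inferInstance, isOpen_univ, inferInstance,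
    inferInstance, by simp⟩
  have hs : ∀ n, s (n + 1) = f (s n) := fun n => Function.iterate_succ_apply' _ _ _
  set V : ℕ → Subgroup U := fun n => (s n).1.1 with hV
  set P : ℕ → Subgroup U := fun n => (s n).1.2 with hP
  set E : ℕ → Subgroup U := fun n => e (s n) with hE
  have hVn : ∀ n, (V n).Normal := fun n => (s n).2.1
  have hVo : ∀ n, IsOpen (V n : Set U) := fun n => (s n).2.2.1
  have hVc : ∀ n, IsClosed (V n : Set U) := fun n => Subgroup.isClosed_of_isOpen _ (hVo n)
  have hPn : ∀ n, (P n).Normal := fun n => (s n).2.2.2.1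
  have hPc : ∀ n, IsClosed (P n : Set U) := fun n =>
    have := (s n).2.2.2.2.1
    (Set.toFinite (P n : Set U)).isClosed
  have hVP : ∀ n, V n ⊓ P n = ⊥ := fun n => (s n).2.2.2.2.2
  have hEn : ∀ n, (E n).Normal := fun n => (he (s n)).1
  have hE1 : ∀ n, E n ≠ ⊥ := fun n => (he (s n)).2.2.1
  have hEM : ∀ n, E n ≤ (melnikov (V n)).map (V n).subtype := fun n => (he (s n)).2.2.2.1
  have hEV : ∀ n, E n ≤ V n := fun n => (hEM n).trans (Subgroup.map_subtype_le _)
  have hVa : Antitone V := antitone_nat_of_succ_le fun n => by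
    simp only [hV, hs n]
    exact (he (s n)).2.2.2.2.1
  have hPs : ∀ n, P (n + 1) = P n ⊔ E n := fun n => by
    simp only [hP, hs n]
    exact (he (s n)).2.2.2.2.2
  have hPm : Monotone P := monotone_nat_of_le_succ fun n => by rw [hPs n]; exact le_sup_left
  set K : Subgroup U := ⨅ n, P n ⊔ V n with hK
  set Z : Subgroup U := ⨅ n, V n with hZ
  have hKn : K.Normal := Subgroup.normal_iInf_normal fun n => inferInstance
  have hZn : Z.Normal := Subgroup.normal_iInf_normal hVn
  have hKc : IsClosed (K : Set U) := by
    rw [hK, Subgroup.coe_iInf]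
    exact isClosed_iInter fun n => isClosed_sup_of_normal (hPc n) (hVc n)
  obtain ⟨L, B, hLK, hKB, hLB⟩ := hU K hKc (by
    rw [Subgroup.normalizer_eq_top]; exact isOpen_univ)
  obtain ⟨m, hm⟩ : ∃ m, (V m : Set U) ⊆ ((L ⊔ B ⊔ Z : Subgroup U) : Set U) := by
    refine exists_subset_nhds_of_compactSpace (directed_of_isDirected_le fun i j hij => hVa hij) hVc
      fun x hx => (Subgroup.isOpen_mono le_sup_left hLB.isOpen_sup).mem_nhds ?_
    rw [← Subgroup.coe_iInf] at hx
    exact (le_sup_right : Z ≤ L ⊔ B ⊔ Z) hx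
  set W : Subgroup U := K ⊓ (P m ⊔ V (m + 1)) with hW
  have hWn : W.Normal := inferInstance
  have hWc : IsClosed (W : Set U) := hKc.inter (isClosed_sup_of_normal (hPc m) (hVc (m + 1)))
  have hEK : E m ≤ K := by
    refine le_iInf fun n => ?_
    rcases le_or_gt n m with hnm | hnm
    · exact ((hEV m).trans (hVa hnm)).trans le_sup_right
    · refine le_trans ?_ ((hPm hnm).trans le_sup_left)
      rw [Nat.succ_eq_add_one, hPs m]
      exact le_sup_right
  have hKEW : K ≤ E m ⊔ W := by
    rw [hW, ← inf_sup_eq_sup_inf_of_le _ hEK]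
    refine le_inf le_rfl ((iInf_le _ (m + 1)).trans ?_)
    rw [hPs m, sup_comm (P m), sup_assoc]
  have hZW : Z ≤ W := le_inf (le_iInf fun n => (iInf_le _ n).trans le_sup_right)
    ((iInf_le _ (m + 1)).trans le_sup_right)
  have hEW : ∀ x ∈ E m, x ∈ W → x = 1 := by
    rintro x hxE ⟨-, hx⟩
    obtain ⟨p, hp, v, hv, rfl⟩ := Subgroup.mem_sup_of_normal_right.1 hx
    have hv1 : v ∈ V (m + 1) ⊓ P (m + 1) := by
      refine ⟨hv, ?_⟩
      rw [hPs m]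
      have := mul_mem ((le_sup_left : P m ≤ P m ⊔ E m) (inv_mem hp))
        ((le_sup_right : E m ≤ P m ⊔ E m) hxE)
      rwa [inv_mul_cancel_left] at this
    rw [hVP, Subgroup.mem_bot] at hv1
    subst hv1
    rw [mul_one] at hxE ⊢
    have : p ∈ V m ⊓ P m := ⟨hEV m hxE, hp⟩
    rwa [hVP, Subgroup.mem_bot] at this
  set R : Subgroup U := W ⊔ B with hR
  have hRc : IsClosed (R : Set U) := by
    rw [hR, sup_comm]; exact isClosed_sup_of_normal hLB.2.isClosed hWc
  have hnorm : V m ≤ Subgroup.normalizer (R : Set U) := by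
    refine le_trans hm (sup_le (sup_le ?_ ?_) ?_)
    · refine le_normalizer_of_conj_mem fun g hg x hx => ?_
      obtain ⟨w, hw, b, hb, rfl⟩ := Subgroup.mem_sup_of_normal_left.1 hx
      have : g * (w * b) * g⁻¹ = (g * w * g⁻¹) * b := by
        calc g * (w * b) * g⁻¹ = g * w * g⁻¹ * (g * b) * g⁻¹ := by group
          _ = (g * w * g⁻¹) * b := by rw [hLB.comm g hg b hb]; group
      rw [this]
      exact Subgroup.mul_mem_sup (hWn.conj_mem w hw g) hb
    · exact (le_sup_right : B ≤ R).trans Subgroup.le_normalizer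
    · exact (hZW.trans (le_sup_left : W ≤ R)).trans Subgroup.le_normalizer
  have hVER : V m ≤ E m ⊔ R := by
    refine le_trans hm (sup_le (sup_le (hLK.trans (hKEW.trans ?_)) ?_) ?_)
    · exact sup_le_sup_left le_sup_left _
    · exact le_sup_right.trans le_sup_right
    · exact (hZW.trans le_sup_left).trans le_sup_right
  have hR'n : (R.subgroupOf (V m)).Normal :=
    Subgroup.normal_subgroupOf_of_le_normalizer hnorm
  have hne : R.subgroupOf (V m) ≠ ⊤ := by
    intro htop
    obtain ⟨⟨x, hxE⟩, hx1⟩ := (E m).ne_bot_iff_exists_ne_one.1 (hE1 m)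
    refine hx1 (Subtype.ext ?_)
    have hxR : x ∈ R := Subgroup.subgroupOf_eq_top.1 htop (hEV m hxE)
    obtain ⟨w, hw, b, hb, hwb⟩ := Subgroup.mem_sup_of_normal_left.1 hxR
    have hbK : b ∈ K ⊓ B := by
      refine ⟨?_, hb⟩
      rw [show b = w⁻¹ * x by rw [← hwb]; group]
      exact K.mul_mem (K.inv_mem hw.1) (hEK hxE)
    rw [hKB, Subgroup.mem_bot] at hbK
    subst hbK
    rw [mul_one] at hwb
    exact hEW x hxE (hwb ▸ hw)
  have hcV : CompactSpace (V m) := isCompact_iff_compactSpace.1 (hVc m).isCompact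
  obtain ⟨M, hM, hRM⟩ := exists_isMaxOpenNormal_ge (hRc.preimage continuous_subtype_val) hne
  refine hM.ne_top (eq_top_iff.2 fun x _ => ?_)
  obtain ⟨y, hy, r, hr, hyr⟩ := Subgroup.mem_sup_of_normal_left.1 (hVER x.2)
  obtain ⟨y', hy', rfl⟩ := hEM m hy
  have hrV : r ∈ V m := ((V m).mul_mem_cancel_left y'.2).1 (hyr ▸ x.2)
  rw [show x = y' * ⟨r, hrV⟩ from Subtype.ext hyr.symm]
  exact mul_mem (Subgroup.mem_sInf.1 hy' M hM) (hRM hr)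

/-- A profinite group with local complements and dense quasi-central torsion is locally a product
of finite simple groups. -/
theorem HasLocalComplements.exists_locallyIsomorphic_pi_simple_of_dense
    (hU : HasLocalComplements U)
    (hD : Dense {x : U | x ∈ quasiCenter U ∧ IsOfFinOrder x}) :
    ∃ (I : Type u) (S : I → ProfiniteGrp.{u}), (∀ i, Finite (S i) ∧ IsSimpleGroup (S i)) ∧
      LocallyIsomorphic U (∀ i, S i) := by
  obtain ⟨V, hVn, hVo, hfin⟩ := hU.exists_finite_melnikov hD
  have hVc : IsClosed (V : Set U) := Subgroup.isClosed_of_isOpen _ hVo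
  have hcV : CompactSpace V := isCompact_iff_compactSpace.1 hVc.isCompact
  obtain ⟨W, hW⟩ := ProfiniteGrp.exist_openNormalSubgroup_sub_open_nhds_of_one
    (((Set.toFinite (melnikov V : Set V)).subset
      (Set.sdiff_subset (t := {1}))).isClosed.isOpen_compl) (by simp)
  obtain ⟨I, S, hS, hiso, -⟩ := exists_locallyIsomorphic_pi_simple (B := (W : Subgroup V))
    (Subgroup.isClosed_of_isOpen _ W.isOpen) (by
      rw [Subgroup.eq_bot_iff_forall]
      rintro x ⟨hxM, hxW⟩
      by_contra hx1
      exact hW hxW ⟨hxM, hx1⟩) (Subgroup.isOpen_mono le_sup_right W.isOpen)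
  refine ⟨I, S, hS, LocallyIsomorphic.trans (LocallyIsomorphic.symm ?_) hiso⟩
  exact .of_isOpenMap (V.subtype.comp (W : Subgroup V).subtype)
    (continuous_subtype_val.comp continuous_subtype_val)
    (Subtype.val_injective.comp Subtype.val_injective)
    (hVo.isOpenMap_subtype_val.comp W.isOpen.isOpenMap_subtype_val)

end DenseTorsion

/-! ### Profinite groups without quasi-central torsion -/

section NormalComplements

variable {U : Type*} [Group U] [TopologicalSpace U] [IsTopologicalGroup U] [CompactSpace U]
  [T2Space U]

theorem HasLocalComplements.normallyComplemented_of_comm (h : HasLocalComplements U)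
    (hc : ∀ x y : U, x * y = y * x) : NormallyComplemented U := by
  intro K hK hKc _
  obtain ⟨L, B, hLK, hKB, hLB⟩ := h K hKc (by rw [Subgroup.normalizer_eq_top]; exact isOpen_univ)
  refine ⟨B, ⟨fun b hb g => by rwa [hc g b, mul_inv_cancel_right]⟩, hLB.2.isClosed, le_top, hKB, ?_⟩
  rw [Subgroup.relIndex_top_right]
  exact index_ne_zero_of_isOpen (Subgroup.isOpen_mono (sup_le_sup_right hLK B) hLB.isOpen_sup)

/-- With trivial quasi-center there are no abelian normal subgroups: a local direct factor in such a
subgroup is central in an open subgroup, so the abelian subgroup is finite. -/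
theorem HasLocalComplements.eq_bot_of_comm (h : HasLocalComplements U) (hq : quasiCenter U = ⊥)
    {Z : Subgroup U} [Z.Normal] (hZ : IsClosed (Z : Set U))
    (hcomm : ∀ x ∈ Z, ∀ y ∈ Z, x * y = y * x) : Z = ⊥ := by
  obtain ⟨L, B, hLZ, hZB, hLB⟩ := h Z hZ (by rw [Subgroup.normalizer_eq_top]; exact isOpen_univ)
  have hL : L = ⊥ := by
    rw [eq_bot_iff, ← hq]
    intro l hl
    refine mem_quasiCenter_of_commute hLB.isOpen_sup fun o ho => ?_
    obtain ⟨l', hl', b, hb, rfl⟩ := hLB.mem_sup.1 ho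
    rw [mul_assoc, ← hLB.comm l hl b hb, ← mul_assoc, hcomm l' (hLZ hl') l (hLZ hl), mul_assoc]
  have hB : IsOpen (B : Set U) := by
    have := hLB.isOpen_sup
    rwa [hL, bot_sup_eq] at this
  have hfin : Finite Z := finite_of_inf_eq_bot
    (relIndex_ne_zero_of_index (index_ne_zero_of_isOpen hB) Z) hZB
  rw [eq_bot_iff, ← hq]
  exact fun x hx => mem_quasiCenter_of_finite_normal hx

/-- With trivial quasi-center, closed normal subgroups are virtually complemented by their
centralizers. -/
theorem HasLocalComplements.normallyComplemented_of_quasiCenter_eq_bot [TotallyDisconnectedSpace U]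
    (h : HasLocalComplements U) (hq : quasiCenter U = ⊥) : NormallyComplemented U := by
  intro K hK hKc _
  obtain ⟨L, B, hLK, hKB, hLB⟩ := h K hKc (by rw [Subgroup.normalizer_eq_top]; exact isOpen_univ)
  obtain ⟨W, hW⟩ := ProfiniteGrp.exist_openNormalSubgroup_sub_open_nhds_of_one
    hLB.isOpen_sup (one_mem _)
  have hWc : IsClosed ((W : Subgroup U) : Set U) := Subgroup.isClosed_of_isOpen _ W.isOpen
  have hKWL : ∀ y ∈ K, y ∈ W → y ∈ L := by
    intro y hy hyW
    obtain ⟨l, hl, b, hb, rfl⟩ := hLB.mem_sup.1 (hW hyW)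
    have : b ∈ K ⊓ B := ⟨(K.mul_mem_cancel_left (hLK hl)).1 hy, hb⟩
    rw [hKB, Subgroup.mem_bot] at this
    rwa [this, mul_one]
  set Y : Subgroup U := K ⊓ (W : Subgroup U) with hY
  have hYn : Y.Normal := inferInstance
  have hYZ : Y ⊓ Subgroup.centralizer (Y : Set U) = ⊥ :=
    h.eq_bot_of_comm hq ((hKc.inter hWc).inter (Set.isClosed_centralizer _)) fun x hx y hy =>
      (Subgroup.mem_centralizer_iff.1 hx.2 y hy.1).symm
  have hKZ : K ⊓ Subgroup.centralizer (K : Set U) = ⊥ :=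
    h.eq_bot_of_comm hq (hKc.inter (Set.isClosed_centralizer _)) fun x hx y hy =>
      (Subgroup.mem_centralizer_iff.1 hx.2 y hy.1).symm
  have hBW : B ⊓ (W : Subgroup U) ≤ Subgroup.centralizer (K : Set U) := by
    rintro b ⟨hb, hbW⟩
    rw [Subgroup.mem_centralizer_iff]
    intro k hk
    -- the commutator of `k` and `b` lies in the center of `K ⊓ W`
    have hcW : k * b * k⁻¹ * b⁻¹ ∈ (W : Subgroup U) :=
      mul_mem (W.isNormal'.conj_mem b hbW k) (inv_mem hbW)
    have hcK : k * b * k⁻¹ * b⁻¹ ∈ K := by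
      have := K.mul_mem hk (hK.conj_mem _ (K.inv_mem hk) b)
      simpa [mul_assoc] using this
    have hc : k * b * k⁻¹ * b⁻¹ ∈ Y ⊓ Subgroup.centralizer (Y : Set U) := by
      refine ⟨⟨hcK, hcW⟩, Subgroup.mem_centralizer_iff.2 fun y hy => ?_⟩
      have h1 : Commute y b := hLB.comm y (hKWL y hy.1 hy.2) b hb
      have h2 : Commute (k⁻¹ * y * k) b := by
        have := hYn.conj_mem y hy k⁻¹
        rw [inv_inv] at this
        exact hLB.comm _ (hKWL _ this.1 this.2) b hb
      have h3 : Commute y (k * b * k⁻¹) := by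
        have := (Commute.conj_iff k).2 h2
        simpa [mul_assoc] using this
      exact h3.mul_right h1.inv_right
    rw [hYZ, Subgroup.mem_bot, mul_inv_eq_one, mul_inv_eq_iff_eq_mul] at hc
    exact hc
  refine ⟨Subgroup.centralizer (K : Set U), inferInstance, Set.isClosed_centralizer _, le_top,
    hKZ, ?_⟩
  rw [Subgroup.relIndex_top_right]
  have := (hLB.shrink le_rfl (inf_le_left : B ⊓ (W : Subgroup U) ≤ B) W.isOpen (one_mem _)
    Set.inter_subset_left le_rfl).isOpen_sup
  exact index_ne_zero_of_isOpen (Subgroup.isOpen_mono (sup_le_sup hLK hBW) this)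

end NormalComplements

section Reduction

theorem NormallyComplemented.prod {A N : Type*} [Group A] [TopologicalSpace A]
    [IsTopologicalGroup A] [CompactSpace A] [T2Space A] [Group N] [TopologicalSpace N]
    [IsTopologicalGroup N] [CompactSpace N] [T2Space N] (hA : NormallyComplemented A)
    (hN : NormallyComplemented N) : NormallyComplemented (A × N) := by
  have hil : Continuous (MonoidHom.inl A N) := continuous_id.prodMk continuous_const
  have hir : Continuous (MonoidHom.inr A N) := continuous_const.prodMk continuous_id
  have h1 := hA.range hil (fun x y h => congrArg Prod.fst h)
    (fun u => ⟨u.1, fun x => by ext <;> simp⟩)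
  have h2 := hN.range hir (fun x y h => congrArg Prod.snd h)
    (fun u => ⟨u.2, fun x => by ext <;> simp⟩)
  have hn1 : (MonoidHom.inl A N).range.Normal := by
    refine ⟨?_⟩
    rintro _ ⟨x, rfl⟩ u
    exact ⟨u.1 * x * u.1⁻¹, by ext <;> simp⟩
  have hn2 : (MonoidHom.inr A N).range.Normal := by
    refine ⟨?_⟩
    rintro _ ⟨x, rfl⟩ u
    exact ⟨u.2 * x * u.2⁻¹, by ext <;> simp⟩
  have h3 := NormallyComplementedIn.sup (isCompact_range hil).isClosed
    (isCompact_range hir).isClosed h1 h2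
  have htop : (MonoidHom.inl A N).range ⊔ (MonoidHom.inr A N).range = ⊤ := by
    rw [eq_top_iff]
    intro x _
    have : x = (x.1, 1) * (1, x.2) := by ext <;> simp
    rw [this]
    exact Subgroup.mul_mem_sup ⟨x.1, rfl⟩ ⟨x.2, rfl⟩
  rwa [htop] at h3

theorem NoQuasiCentralTorsion.prod {A N : Type*} [Group A] [TopologicalSpace A]
    [IsTopologicalGroup A] [Group N] [TopologicalSpace N] [IsTopologicalGroup N]
    (hA : NoQuasiCentralTorsion A) (hN : NoQuasiCentralTorsion N) :
    NoQuasiCentralTorsion (A × N) := by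
  intro x hx ho
  have h1 : x.1 ∈ quasiCenter A := by
    have : IsOpen ((fun a : A => (a, (1 : N))) ⁻¹' (Subgroup.centralizer {x} : Set (A × N))) :=
      IsOpen.preimage (by fun_prop) (mem_quasiCenter.1 hx)
    refine mem_quasiCenter_of_commute
      (O := (Subgroup.centralizer {x}).comap (MonoidHom.inl A N)) this fun a ha => ?_
    exact congrArg Prod.fst (Subgroup.mem_centralizer_singleton_iff.1 ha)
  have h2 : x.2 ∈ quasiCenter N := by
    have : IsOpen ((fun a : N => ((1 : A), a)) ⁻¹' (Subgroup.centralizer {x} : Set (A × N))) :=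
      IsOpen.preimage (by fun_prop) (mem_quasiCenter.1 hx)
    refine mem_quasiCenter_of_commute
      (O := (Subgroup.centralizer {x}).comap (MonoidHom.inr A N)) this fun a ha => ?_
    exact congrArg Prod.snd (Subgroup.mem_centralizer_singleton_iff.1 ha)
  exact Prod.ext (hA _ h1 (MonoidHom.isOfFinOrder (MonoidHom.fst A N) ho))
    (hN _ h2 (MonoidHom.isOfFinOrder (MonoidHom.snd A N) ho))

variable {U : Type u} [Group U] [TopologicalSpace U] [IsTopologicalGroup U] [CompactSpace U]
  [T2Space U] [TotallyDisconnectedSpace U]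

/-- Up to local isomorphism, local complements may be taken normal: the closure of the quasi-center
is abelian, and its local complement has trivial quasi-center. -/
theorem HasLocalComplements.exists_normallyComplemented (h : HasLocalComplements U)
    (ht : NoQuasiCentralTorsion U) :
    ∃ (H : Type u) (_ : Group H) (_ : TopologicalSpace H) (_ : IsTopologicalGroup H)
      (_ : CompactSpace H) (_ : T2Space H) (_ : TotallyDisconnectedSpace H),
      HasLocalComplements H ∧ NoQuasiCentralTorsion H ∧ NormallyComplemented H ∧
      LocallyIsomorphic H U := by
  set Q : Subgroup U := (quasiCenter U).topologicalClosure with hQ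
  have hQn : Q.Normal := Subgroup.is_normal_topologicalClosure _
  have hQZ : Q ≤ Subgroup.centralizer (Q : Set U) := by
    have h1 : quasiCenter U ≤ Subgroup.centralizer (quasiCenter U : Set U) := fun x hx =>
      Subgroup.mem_centralizer_iff.2 fun y hy => ht.commute hy hx
    have h2 : Q ≤ Subgroup.centralizer (quasiCenter U : Set U) :=
      Subgroup.topologicalClosure_minimal _ h1 (Set.isClosed_centralizer _)
    have h3 : quasiCenter U ≤ Subgroup.centralizer (Q : Set U) := Subgroup.le_centralizer_iff.1 h2
    exact Subgroup.topologicalClosure_minimal _ h3 (Set.isClosed_centralizer _)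
  obtain ⟨A, N, hAQ, hQN, hAN⟩ := h Q (Subgroup.isClosed_topologicalClosure _)
    (by rw [Subgroup.normalizer_eq_top]; exact isOpen_univ)
  have hcA : CompactSpace A := isCompact_iff_compactSpace.1 hAN.1
  have hcN : CompactSpace N := isCompact_iff_compactSpace.1 hAN.2
  have hqN : quasiCenter N = ⊥ := by
    rw [Subgroup.eq_bot_iff_forall]
    intro x hx
    have : (x : U) ∈ Q ⊓ N :=
      ⟨Subgroup.le_topologicalClosure _ (hAN.symm.coe_mem_quasiCenter hx), x.2⟩
    rw [hQN, Subgroup.mem_bot] at this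
    exact Subtype.ext this
  refine ⟨A × N, inferInstance, inferInstance, inferInstance, inferInstance, inferInstance,
    inferInstance, h.of_locallyIsomorphic hAN.locallyIsomorphic.symm,
    (ht.of_isOpenDirectProduct hAN).prod (ht.of_isOpenDirectProduct hAN.symm),
    ((h.factor hAN).normallyComplemented_of_comm fun x y => ?_).prod
      ((h.factor hAN.symm).normallyComplemented_of_quasiCenter_eq_bot hqN),
    hAN.locallyIsomorphic⟩
  exact Subtype.ext (Subgroup.mem_centralizer_iff.1 (hQZ (hAQ y.2)) x (hAQ x.2))

/-- A directed family of closed normal subgroups that generates a dense subgroup of an open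
subgroup `V` contains `V`: some member supplements the Melnikov subgroup of `V`, which is open. -/
theorem HasLocalComplements.exists_isOpen_of_directedOn (h : HasLocalComplements U)
    (ht : NoQuasiCentralTorsion U) {𝓕 : Set (Subgroup U)} (hne : 𝓕.Nonempty)
    (hdir : DirectedOn (· ≤ ·) 𝓕) (hn : ∀ F ∈ 𝓕, F.Normal) (hc : ∀ F ∈ 𝓕, IsClosed (F : Set U))
    (ho : IsOpen ((sSup 𝓕).topologicalClosure : Set U)) : ∃ F ∈ 𝓕, IsOpen (F : Set U) := by
  set V : Subgroup U := (sSup 𝓕).topologicalClosure with hV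
  have hFV : ∀ F ∈ 𝓕, F ≤ V := fun F hF =>
    (le_sSup hF).trans (Subgroup.le_topologicalClosure _)
  have hVc : IsClosed (V : Set U) := Subgroup.isClosed_topologicalClosure _
  have hcV : CompactSpace V := isCompact_iff_compactSpace.1 hVc.isCompact
  have hVprod : IsOpenDirectProduct V ⊥ := by
    refine ⟨hVc.isCompact, by simp, fun l _ b hb => ?_, inf_bot_eq _, by rwa [sup_bot_eq]⟩
    rw [Subgroup.mem_bot.1 hb, one_mul, mul_one]
  have hVh : HasLocalComplements V := h.factor hVprod
  have hVt : NoQuasiCentralTorsion V := ht.of_isOpenDirectProduct hVprod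
  have hindex : (melnikov V).index ≠ 0 := by
    intro h0
    obtain ⟨L, B, hL, hMB, hLB⟩ := hVh (melnikov V) isClosed_melnikov
      (by rw [Subgroup.normalizer_eq_top]; exact isOpen_univ)
    obtain ⟨I, S, hS, hiso, hI⟩ := exists_locallyIsomorphic_pi_simple hLB.2.isClosed hMB
      (Subgroup.isOpen_mono (sup_le_sup_right hL B) hLB.isOpen_sup)
    have := hI h0
    exact not_noQuasiCentralTorsion_of_locallyIsomorphic_pi hS hiso
      (hVt.of_isOpenDirectProduct hLB.symm)
  have hMo : IsOpen (melnikov V : Set V) :=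
    isOpen_of_isClosed_of_index_ne_zero isClosed_melnikov hindex
  set M : Subgroup U := (melnikov V).map V.subtype with hM
  have hMoU : IsOpen (M : Set U) := ho.isOpenMap_subtype_val _ hMo
  have : Nonempty 𝓕 := hne.to_subtype
  obtain ⟨⟨F, hF⟩, hVF⟩ := hVc.isCompact.elim_directed_cover
    (fun F : 𝓕 => ((F.1 ⊔ M : Subgroup U) : Set U))
    (fun F => Subgroup.isOpen_mono le_sup_right hMoU) (by
      intro x hx
      have hopen : IsOpen ((fun y => y⁻¹ * x) ⁻¹' (M : Set U)) := hMoU.preimage (by fun_prop)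
      obtain ⟨y, hyM, hy⟩ := mem_closure_iff.1 hx _ hopen (by simp)
      obtain ⟨F, hF, hyF⟩ := (Subgroup.mem_sSup_of_directedOn hne hdir).1 hy
      refine Set.mem_iUnion.2 ⟨⟨F, hF⟩, ?_⟩
      simpa using Subgroup.mul_mem_sup hyF hyM) (by
      intro F G
      obtain ⟨E, hE, h1, h2⟩ := hdir F.1 F.2 G.1 G.2
      exact ⟨⟨E, hE⟩, sup_le_sup_right h1 M, sup_le_sup_right h2 M⟩)
  refine ⟨F, hF, Subgroup.isOpen_mono (H₁ := V) ?_ ho⟩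
  by_contra hVF'
  have hFn : F.Normal := hn F hF
  obtain ⟨N, hN, hFN⟩ := exists_isMaxOpenNormal_ge (N := F.subgroupOf V)
    ((hc F hF).preimage continuous_subtype_val) (fun h => hVF' (Subgroup.subgroupOf_eq_top.1 h))
  refine hN.ne_top (eq_top_iff.2 fun x _ => ?_)
  obtain ⟨y, hy, m, hm, hym⟩ := Subgroup.mem_sup_of_normal_left.1 (hVF x.2)
  obtain ⟨m', hm', rfl⟩ := hm
  rw [show x = ⟨y, hFV F hF hy⟩ * m' from Subtype.ext hym.symm]
  exact mul_mem (hFN hy) (Subgroup.mem_sInf.1 hm' N hN)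

end Reduction

/-! ### Just infinite quotients -/

section JustInfinite

theorem totallyDisconnectedSpace_quotient {H : Type*} [Group H] [TopologicalSpace H]
    [IsTopologicalGroup H] [CompactSpace H] [TotallyDisconnectedSpace H] (N : Subgroup H) [N.Normal]
    [hN : IsClosed (N : Set H)] :
    TotallyDisconnectedSpace (H ⧸ N) := by
  refine (totallySeparatedSpace_iff_exists_isClopen.2 fun x y hxy => ?_).totallyDisconnectedSpace
  obtain ⟨a, rfl⟩ := QuotientGroup.mk'_surjective N x
  obtain ⟨b, rfl⟩ := QuotientGroup.mk'_surjective N y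
  have hab : a⁻¹ * b ∉ N := fun h => hxy (QuotientGroup.eq.2 h)
  obtain ⟨W, hW⟩ := ProfiniteGrp.exist_openNormalSubgroup_sub_open_nhds_of_one
    (U := (fun w => w⁻¹ * (a⁻¹ * b)) ⁻¹' (N : Set H)ᶜ) (hN.isOpen_compl.preimage (by fun_prop))
    (by simpa using hab)
  have hWo : IsOpen (((W : Subgroup H).map (QuotientGroup.mk' N) : Subgroup (H ⧸ N)) :
      Set (H ⧸ N)) := QuotientGroup.isOpenMap_coe _ W.isOpen
  have hWclopen : IsClopen (((W : Subgroup H).map (QuotientGroup.mk' N) : Subgroup (H ⧸ N)) :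
      Set (H ⧸ N)) := ⟨Subgroup.isClosed_of_isOpen _ hWo, hWo⟩
  refine ⟨(fun q => (QuotientGroup.mk' N a)⁻¹ * q) ⁻¹' _, hWclopen.preimage (by fun_prop),
    by rw [Set.mem_preimage, inv_mul_cancel]; exact one_mem _, ?_⟩
  rintro ⟨w, hw, hwab⟩
  exact hW hw (QuotientGroup.eq.1 hwab)

variable {H : Type u} [Group H] [TopologicalSpace H]

/-- Closed normal subgroups of infinite index; the index of such a subgroup is `0` by convention. -/
def IsClosedNormalOfInfiniteIndex (N : Subgroup H) : Prop :=
  N.Normal ∧ IsClosed (N : Set H) ∧ N.index = 0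

/-- The quotient by a maximal closed normal subgroup of infinite index is just infinite. -/
theorem isJustInfinite_quotient {N : Subgroup H} [N.Normal]
    (hN : Maximal IsClosedNormalOfInfiniteIndex N) : IsJustInfinite (H ⧸ N) := by
  refine ⟨Subgroup.index_eq_zero_iff_infinite.1 hN.prop.2.2, fun M hM hMc hM1 => ?_⟩
  have hsurj := QuotientGroup.mk'_surjective N
  refine ⟨?_⟩
  rw [← Subgroup.index_comap_of_surjective M hsurj]
  intro h0
  have hle : N ≤ M.comap (QuotientGroup.mk' N) := by
    intro x hx
    have : QuotientGroup.mk' N x = 1 := (QuotientGroup.eq_one_iff x).2 hx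
    rw [Subgroup.mem_comap, this]
    exact M.one_mem
  have hge := hN.le_of_ge ⟨inferInstance, hMc.preimage QuotientGroup.continuous_mk, h0⟩ hle
  refine hM1 ((Subgroup.eq_bot_iff_forall _).2 fun x hx => ?_)
  obtain ⟨y, rfl⟩ := hsurj x
  exact (QuotientGroup.eq_one_iff y).2 (hge hx)

variable [IsTopologicalGroup H] [CompactSpace H] [T2Space H]

/-- The closed normal subgroups that are virtually complementary to a maximal closed normal subgroup
of infinite index; these are, up to finite index, the just infinite direct factors. -/
def justInfiniteFactors (H : Type*) [Group H] [TopologicalSpace H] : Set (Subgroup H) :=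
  {A | A.Normal ∧ IsClosed (A : Set H) ∧
    ∃ N, Maximal IsClosedNormalOfInfiniteIndex N ∧ A ⊓ N = ⊥ ∧ (A ⊔ N).index ≠ 0}

theorem normal_and_isClosed_sup {s : Finset (Subgroup H)}
    (hs : (s : Set (Subgroup H)) ⊆ justInfiniteFactors H) :
    (s.sup id).Normal ∧ IsClosed ((s.sup id : Subgroup H) : Set H) := by
  classical
  induction s using Finset.induction_on with
  | empty => exact ⟨by rw [Finset.sup_empty]; infer_instance, by simp⟩
  | insert A s hA ih =>
    rw [Finset.coe_insert, Set.insert_subset_iff] at hs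
    obtain ⟨h1, h2⟩ := ih hs.2
    have := hs.1.1
    rw [Finset.sup_insert, id]
    exact ⟨inferInstance, isClosed_sup_of_normal hs.1.2.1 h2⟩

/-- A closed normal subgroup of infinite index in a just infinite factor `A` is trivial. -/
theorem inf_eq_bot_of_mem_justInfiniteFactors {A M : Subgroup H} (hA : A ∈ justInfiniteFactors H)
    (hM : M.Normal) (hMc : IsClosed (M : Set H)) (hMA : M.relIndex A = 0) : M ⊓ A = ⊥ := by
  obtain ⟨hAn, hAc, N, hN, hAN, -⟩ := hA
  have hNn := hN.prop.1
  have h0 : ((M ⊓ A) ⊔ N).index = 0 := by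
    by_contra hi
    have h1 := relIndex_ne_zero_of_index hi A
    rw [← Subgroup.inf_relIndex_left, inf_sup_eq_sup_inf_of_le N inf_le_right, hAN,
      sup_bot_eq, Subgroup.inf_relIndex_right] at h1
    exact h1 hMA
  have hle := hN.le_of_ge ⟨inferInstance,
    isClosed_sup_of_normal (hMc.inter hAc) hN.prop.2.1, h0⟩ le_sup_right
  rw [eq_bot_iff, ← hAN]
  exact le_inf inf_le_right (le_sup_left.trans hle)

variable [TotallyDisconnectedSpace H]

/-- Closed normal subgroups of infinite index lie in maximal ones: the closure of the union of a
chain of such subgroups has infinite index, since otherwise some member would be open. -/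
theorem HasLocalComplements.exists_maximal (h : HasLocalComplements H)
    (ht : NoQuasiCentralTorsion H) {N₀ : Subgroup H} (hN₀ : IsClosedNormalOfInfiniteIndex N₀) :
    ∃ N, N₀ ≤ N ∧ Maximal IsClosedNormalOfInfiniteIndex N := by
  refine zorn_le_nonempty₀ {N | IsClosedNormalOfInfiniteIndex N} (fun c hc hchain F hF => ?_) N₀ hN₀
  have hcn : ∀ N ∈ c, N.Normal := fun N hN => (hc hN).1
  have hsn : (sSup c).Normal := Subgroup.sSup_normal c hcn
  refine ⟨(sSup c).topologicalClosure, ⟨Subgroup.is_normal_topologicalClosure _,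
    Subgroup.isClosed_topologicalClosure _, ?_⟩,
    fun N hN => (le_sSup hN).trans (Subgroup.le_topologicalClosure _)⟩
  by_contra hi
  obtain ⟨N, hN, hNo⟩ := h.exists_isOpen_of_directedOn ht ⟨F, hF⟩ hchain.directedOn hcn
    (fun N hN => (hc hN).2.1)
    (isOpen_of_isClosed_of_index_ne_zero (Subgroup.isClosed_topologicalClosure _) hi)
  exact index_ne_zero_of_isOpen hNo (hc hN).2.2

/-- Finitely many just infinite factors generate a subgroup of finite index. Indeed, if `C` is a
normal complement of the closure `K` of the subgroup generated by all of them, then finitely many of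
them generate an open subgroup together with `C`. If their product had infinite index, a normal
complement of a maximal closed normal subgroup of infinite index containing it would be an infinite
just infinite factor meeting that open subgroup trivially. -/
theorem HasLocalComplements.exists_finset_justInfiniteFactors (h : HasLocalComplements H)
    (ht : NoQuasiCentralTorsion H) (hc : NormallyComplemented H) :
    ∃ s : Finset (Subgroup H), (s : Set (Subgroup H)) ⊆ justInfiniteFactors H ∧
      (s.sup id).index ≠ 0 := by
  classical
  set K : Subgroup H := (sSup (justInfiniteFactors H)).topologicalClosure with hK
  have hKn : K.Normal := by
    have : (sSup (justInfiniteFactors H)).Normal := Subgroup.sSup_normal _ fun A hA => hA.1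
    exact Subgroup.is_normal_topologicalClosure _
  have hle : ∀ A ∈ justInfiniteFactors H, A ≤ K := fun A hA =>
    (le_sSup hA).trans (Subgroup.le_topologicalClosure _)
  obtain ⟨C, hCn, hCc, -, hKC, hKCi⟩ := hc K hKn (Subgroup.isClosed_topologicalClosure _) le_top
  rw [Subgroup.relIndex_top_right] at hKCi
  set 𝓕 : Set (Subgroup H) := {F | ∃ s : Finset (Subgroup H),
    (s : Set (Subgroup H)) ⊆ justInfiniteFactors H ∧ F = s.sup id ⊔ C} with h𝓕
  have hsub : K ⊔ C ≤ (sSup 𝓕).topologicalClosure := by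
    refine sup_le (Subgroup.topologicalClosure_mono (sSup_le fun A hA => ?_))
      (le_trans ?_ (Subgroup.le_topologicalClosure _))
    · refine le_sSup_of_le ⟨{A}, by simpa using hA, rfl⟩ ?_
      simp
    · refine le_sSup_of_le ⟨∅, by simp, rfl⟩ le_sup_right
  obtain ⟨_, ⟨s, hs, rfl⟩, hso⟩ := h.exists_isOpen_of_directedOn ht (𝓕 := 𝓕)
    ⟨_, ∅, by simp, rfl⟩ (by
      rintro _ ⟨s, hs, rfl⟩ _ ⟨t, ht, rfl⟩
      refine ⟨_, ⟨s ∪ t, by simpa using ⟨hs, ht⟩, rfl⟩, ?_, ?_⟩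
      · exact sup_le_sup_right (Finset.sup_mono Finset.subset_union_left) C
      · exact sup_le_sup_right (Finset.sup_mono Finset.subset_union_right) C) (by
      rintro _ ⟨s, hs, rfl⟩
      have := (normal_and_isClosed_sup hs).1
      infer_instance) (by
      rintro _ ⟨s, hs, rfl⟩
      exact isClosed_sup_of_normal (normal_and_isClosed_sup hs).2 hCc)
    (Subgroup.isOpen_mono hsub (isOpen_of_isClosed_of_index_ne_zero
      (isClosed_sup_of_normal (Subgroup.isClosed_topologicalClosure _) hCc) hKCi))
  refine ⟨s, hs, fun h0 => ?_⟩
  obtain ⟨hsn, hsc⟩ := normal_and_isClosed_sup hs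
  obtain ⟨N, hsN, hN⟩ := h.exists_maximal ht ⟨hsn, hsc, h0⟩
  obtain ⟨A, hAn, hAc, -, hNA, hNAi⟩ := hc N hN.prop.1 hN.prop.2.1 le_top
  rw [Subgroup.relIndex_top_right] at hNAi
  have hA : A ∈ justInfiniteFactors H :=
    ⟨hAn, hAc, N, hN, by rwa [inf_comm], by rwa [sup_comm]⟩
  have hfin : Finite A := by
    refine finite_of_inf_eq_bot (relIndex_ne_zero_of_index (index_ne_zero_of_isOpen hso) A) ?_
    rw [eq_bot_iff, ← hNA]
    refine le_inf ?_ inf_le_left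
    have hsK : s.sup id ≤ K := Finset.sup_le fun B hB => hle B (hs hB)
    have := inf_le_inf_right (s.sup id ⊔ C) (hle A hA)
    rw [inf_sup_eq_sup_inf_of_le C hsK, hKC, sup_bot_eq] at this
    exact this.trans hsN
  rw [ht.eq_bot_of_finite A, sup_bot_eq] at hNAi
  exact hNAi hN.prop.2.2

/-- In the absence of quasi-central torsion, a profinite group with local and normal complements is
locally a finite product of just infinite groups. For a minimal set of just infinite factors that
generates a subgroup of finite index, these are the quotients by maximal closed normal subgroups
that contain all but one of the factors. -/
theorem HasLocalComplements.exists_locallyIsomorphic_pi_justInfinite (h : HasLocalComplements H)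
    (ht : NoQuasiCentralTorsion H) (hc : NormallyComplemented H) :
    ∃ (I : Type u) (L : I → ProfiniteGrp.{u}), Finite I ∧ (∀ i, IsJustInfinite (L i)) ∧
      LocallyIsomorphic H (∀ i, L i) := by
  classical
  obtain ⟨s, hs⟩ := exists_minimal_of_wellFoundedLT
    (fun s : Finset (Subgroup H) => (s : Set (Subgroup H)) ⊆ justInfiniteFactors H ∧
      (s.sup id).index ≠ 0) (h.exists_finset_justInfiniteFactors ht hc)
  obtain ⟨hsJ, hsi⟩ := hs.prop
  have hex : ∀ A : s, ∃ N : Subgroup H, (s.erase A).sup id ≤ N ∧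
      Maximal IsClosedNormalOfInfiniteIndex N := by
    intro A
    have hsub : ((s.erase A : Finset (Subgroup H)) : Set (Subgroup H)) ⊆ justInfiniteFactors H :=
      (Finset.coe_subset.2 (Finset.erase_subset _ _)).trans hsJ
    obtain ⟨h1, h2⟩ := normal_and_isClosed_sup hsub
    refine h.exists_maximal ht ⟨h1, h2, ?_⟩
    by_contra hi
    exact Finset.notMem_erase A.1 s (hs.le_of_le ⟨hsub, hi⟩ (Finset.erase_subset _ _) A.2)
  choose N hsN hN using hex
  have hNn : ∀ A, (N A).Normal := fun A => (hN A).prop.1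
  have hNc : ∀ A, IsClosed (N A : Set H) := fun A => (hN A).prop.2.1
  have hsA : ∀ A : s, s.sup id ≤ (A : Subgroup H) ⊔ N A := fun A => by
    refine Finset.sup_le fun B hB => ?_
    rcases eq_or_ne B A.1 with rfl | hBA
    · exact le_sup_left
    · exact ((Finset.le_sup (f := id) (Finset.mem_erase.2 ⟨hBA, hB⟩)).trans (hsN A)).trans
        le_sup_right
  have hAB : ∀ A B : s, B ≠ A → (B : Subgroup H) ≤ N A := fun A B hBA =>
    (Finset.le_sup (f := id) (Finset.mem_erase.2 ⟨fun h => hBA (Subtype.ext h), B.2⟩)).trans (hsN A)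
  have hNA : ∀ A : s, N A ⊓ A = ⊥ := by
    intro A
    refine inf_eq_bot_of_mem_justInfiniteFactors (hsJ A.2) (hNn A) (hNc A) ?_
    by_contra hi
    rw [← Subgroup.relIndex_sup_right] at hi
    refine Nat.mul_ne_zero hi (fun h0 => hsi (Nat.eq_zero_of_zero_dvd
      (h0 ▸ Subgroup.index_dvd_of_le (hsA A)))) ?_
    rw [Subgroup.relIndex_mul_index le_sup_right]
    exact (hN A).prop.2.2
  have htd : ∀ A, TotallyDisconnectedSpace (H ⧸ N A) := fun A => totallyDisconnectedSpace_quotient _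
  refine ⟨s, fun A => ProfiniteGrp.of (H ⧸ N A), inferInstance,
    fun A => isJustInfinite_quotient (hN A), ?_⟩
  let θ : H →* ∀ A : s, H ⧸ N A := MonoidHom.pi fun A => QuotientGroup.mk' (N A)
  have hθ : Continuous θ := continuous_pi fun A => QuotientGroup.continuous_mk
  have hθi : Function.Injective θ := by
    rw [← MonoidHom.ker_eq_bot_iff]
    have hker : ∀ x ∈ θ.ker, ∀ A, x ∈ N A := fun x hx A =>
      (QuotientGroup.eq_one_iff x).1 (congrFun hx A)
    have key : ∀ t : Finset (Subgroup H), t ⊆ s → ∀ x ∈ t.sup id, x ∈ θ.ker → x = 1 := by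
      intro t
      induction t using Finset.induction_on with
      | empty => intro _ x hx _; simpa using hx
      | insert A t hA ih =>
        intro hts x hx hxk
        rw [Finset.insert_subset_iff] at hts
        rw [Finset.sup_insert, id] at hx
        have htn := (normal_and_isClosed_sup ((Finset.coe_subset.2 hts.2).trans hsJ)).1
        obtain ⟨a, ha, y, hy, rfl⟩ := Subgroup.mem_sup_of_normal_right.1 hx
        have hyN : y ∈ N ⟨A, hts.1⟩ := by
          have hsub : t ⊆ s.erase A := fun B hB =>
            Finset.mem_erase.2 ⟨fun h => hA (h ▸ hB), hts.2 hB⟩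
          exact hsN ⟨A, hts.1⟩ ((Finset.sup_mono hsub : t.sup id ≤ _) hy)
        have haN : a ∈ N ⟨A, hts.1⟩ ⊓ A :=
          ⟨((N ⟨A, hts.1⟩).mul_mem_cancel_right hyN).1 (hker _ hxk _), ha⟩
        rw [hNA ⟨A, hts.1⟩, Subgroup.mem_bot] at haN
        subst haN
        rw [one_mul] at hxk ⊢
        exact ih hts.2 y hy hxk
    have hfin : Finite θ.ker := by
      refine finite_of_inf_eq_bot (relIndex_ne_zero_of_index hsi _) ?_
      rw [Subgroup.eq_bot_iff_forall]
      exact fun x hx => key s subset_rfl x hx.2 hx.1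
    exact ht.eq_bot_of_finite _
  refine .of_isOpen_range θ hθ hθi ?_
  let D : ∀ A : s, Subgroup (H ⧸ N A) := fun A => (A : Subgroup H).map (QuotientGroup.mk' (N A))
  have hD : ∀ A, IsOpen (D A : Set (H ⧸ N A)) := by
    intro A
    have hAn := (hsJ A.2).1
    have h1 : IsOpen (((A : Subgroup H) ⊔ N A : Subgroup H) : Set H) :=
      isOpen_of_isClosed_of_index_ne_zero (isClosed_sup_of_normal (hsJ A.2).2.1 (hNc A))
        fun h0 => hsi (Nat.eq_zero_of_zero_dvd (h0 ▸ Subgroup.index_dvd_of_le (hsA A)))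
    have h2 := QuotientGroup.isOpenMap_coe (N := N A) _ h1
    refine Subgroup.isOpen_of_mem_nhds (g := 1) _ (Filter.mem_of_superset (h2.mem_nhds
      ⟨1, one_mem _, rfl⟩) ?_)
    rintro _ ⟨x, hx, rfl⟩
    obtain ⟨a, ha, n, hn, rfl⟩ := Subgroup.mem_sup_of_normal_right.1 hx
    exact ⟨a, ha, (QuotientGroup.mk_mul_of_mem a hn).symm⟩
  have hDo : IsOpen ((Subgroup.pi Set.univ D : Subgroup (∀ A : s, H ⧸ N A)) :
      Set (∀ A : s, H ⧸ N A)) := by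
    rw [Subgroup.coe_pi]
    exact isOpen_set_pi Set.finite_univ fun A _ => hD A
  rw [← MonoidHom.coe_range]
  refine Subgroup.isOpen_mono (fun x hx => ?_) hDo
  refine Subgroup.pi_mem_of_mulSingle_mem x fun A => ?_
  obtain ⟨a, ha, hax⟩ := hx A trivial
  refine ⟨a, funext fun B => ?_⟩
  rcases eq_or_ne B A with rfl | hBA
  · rw [Pi.mulSingle_eq_same, ← hax]; rfl
  · rw [Pi.mulSingle_eq_of_ne hBA]
    exact (QuotientGroup.eq_one_iff a).2 (hAB B A hBA.symm ha)

end JustInfinite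

/-! ### Splitting off the quasi-central torsion -/

section QuasiCentralTorsion

/-- The elements of finite order in the quasi-center of a compact group; they form a subgroup by
Dicman's lemma. -/
def quasiCentralTorsion (U : Type*) [Group U] [TopologicalSpace U] [IsTopologicalGroup U]
    [CompactSpace U] : Subgroup U where
  carrier := {x | x ∈ quasiCenter U ∧ IsOfFinOrder x}
  one_mem' := ⟨one_mem _, IsOfFinOrder.one⟩
  inv_mem' hx := ⟨inv_mem hx.1, hx.2.inv⟩
  mul_mem' {x y} hx hy := by
    refine ⟨mul_mem hx.1 hy.1, ?_⟩
    have hfin : Finite (Subgroup.closure {x, y}) := finite_closure_of_isOfFinOrder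
      (Set.toFinite _) (by
        rintro z (rfl | rfl)
        · exact index_ne_zero_of_isOpen hx.1
        · exact index_ne_zero_of_isOpen hy.1) (by
        rintro z (rfl | rfl)
        · exact hx.2
        · exact hy.2)
    have hxy : x * y ∈ Subgroup.closure {x, y} :=
      mul_mem (Subgroup.subset_closure (by simp)) (Subgroup.subset_closure (by simp))
    exact isOfFinOrder_coe_iff.2 (isOfFinOrder_of_finite (⟨x * y, hxy⟩ : Subgroup.closure {x, y}))

instance {U : Type*} [Group U] [TopologicalSpace U] [IsTopologicalGroup U] [CompactSpace U] :
    (quasiCentralTorsion U).Normal :=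
  ⟨fun x hx g => ⟨Subgroup.Normal.conj_mem inferInstance x hx.1 g,
    MonoidHom.isOfFinOrder (MulAut.conj g).toMonoidHom hx.2⟩⟩

variable {U : Type u} [Group U] [TopologicalSpace U] [IsTopologicalGroup U] [CompactSpace U]
  [T2Space U]

/-- A compact group with local complements is locally the product of a group with dense
quasi-central torsion and a group without quasi-central torsion. -/
theorem HasLocalComplements.exists_isOpenDirectProduct (h : HasLocalComplements U) :
    ∃ L B : Subgroup U, IsOpenDirectProduct L B ∧
      Dense {x : L | x ∈ quasiCenter L ∧ IsOfFinOrder x} ∧ NoQuasiCentralTorsion B := by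
  set D := quasiCentralTorsion U with hD
  have hn : D.topologicalClosure.Normal := Subgroup.is_normal_topologicalClosure _
  obtain ⟨L, B, hLK, hKB, hLB⟩ := h D.topologicalClosure (Subgroup.isClosed_topologicalClosure _)
    (by rw [Subgroup.normalizer_eq_top]; exact isOpen_univ)
  refine ⟨L, B, hLB, ?_, fun x hx ho => Subtype.ext ?_⟩
  · rw [dense_iff_inter_open]
    rintro _ ⟨W, hW, rfl⟩ ⟨l, hl⟩
    obtain ⟨d, ⟨hdW, hdO⟩, hd⟩ := mem_closure_iff.1 (hLK l.2) _ (hW.inter hLB.isOpen_sup)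
      ⟨hl, (le_sup_left : L ≤ L ⊔ B) l.2⟩
    have hdL : d ∈ L := by
      obtain ⟨l', hl', b, hb, rfl⟩ := hLB.mem_sup.1 hdO
      have : b ∈ D.topologicalClosure ⊓ B :=
        ⟨(Subgroup.mul_mem_cancel_left _ (hLK hl')).1 (Subgroup.le_topologicalClosure _ hd), hb⟩
      rw [hKB, Subgroup.mem_bot] at this
      rwa [this, mul_one]
    have hO : IsOpen (((Subgroup.centralizer {d}).subgroupOf L : Subgroup L) : Set L) :=
      hd.1.preimage continuous_subtype_val
    refine ⟨⟨d, hdL⟩, hdW, mem_quasiCenter_of_commute hO fun o ho => Subtype.ext ?_,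
      isOfFinOrder_coe_iff.1 hd.2⟩
    exact Subgroup.mem_centralizer_singleton_iff.1 ho
  · have : (x : U) ∈ D.topologicalClosure ⊓ B :=
      ⟨Subgroup.le_topologicalClosure _
        ⟨hLB.symm.coe_mem_quasiCenter hx, isOfFinOrder_coe_iff.2 ho⟩, x.2⟩
    rw [hKB, Subgroup.mem_bot] at this
    exact this

end QuasiCentralTorsion

/-! ### The structure of groups with property (LD) -/

theorem locallyIsomorphic_pi_sumElim {I J : Type*} (S : I → ProfiniteGrp.{u})
    (T : J → ProfiniteGrp.{u}) :
    LocallyIsomorphic ((∀ i, S i) × (∀ j, T j))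
      (∀ k : I ⊕ J, (Sum.elim S T k : ProfiniteGrp.{u})) := by
  let f : (∀ i, S i) × (∀ j, T j) →* ∀ k : I ⊕ J, (Sum.elim S T k : ProfiniteGrp.{u}) :=
    { toFun := fun p k => match k with
        | Sum.inl i => p.1 i
        | Sum.inr j => p.2 j
      map_one' := by ext (i | j) <;> rfl
      map_mul' := fun p q => by ext (i | j) <;> rfl }
  refine .of_isOpen_range f (continuous_pi ?_) (fun p q h => ?_) ?_
  · rintro (i | j)
    · exact (continuous_apply i).comp continuous_fst
    · exact (continuous_apply j).comp continuous_snd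
  · exact Prod.ext (funext fun i => congrFun h (Sum.inl i)) (funext fun j => congrFun h (Sum.inr j))
  · rw [Set.range_eq_univ.2 fun x => ⟨(fun i => x (Sum.inl i), fun j => x (Sum.inr j)), ?_⟩]
    · exact isOpen_univ
    · ext (i | j) <;> rfl

theorem theorem1p4 (G : Type u) [Group G] [TopologicalSpace G] [IsTopologicalGroup G]
    [T2Space G] [LocallyCompactSpace G] [TotallyDisconnectedSpace G] :
    PropertyLD G ↔
      ∃ (I : Type u) (L : I → ProfiniteGrp.{u}) (J : Set I),
        J.Finite ∧
        (∀ i ∈ J, IsJustInfinite (L i)) ∧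
        (∀ i ∉ J, Finite (L i) ∧ IsSimpleGroup (L i)) ∧
        LocallyIsomorphic G (∀ i, L i) := by
  constructor
  · intro hG
    obtain ⟨U, hUc, hUo, -⟩ := exists_isCompact_isOpen_subgroup (G := G) Filter.univ_mem
    have hcU : CompactSpace U := isCompact_iff_compactSpace.1 hUc
    have hUG : LocallyIsomorphic G U := (LocallyIsomorphic.of_isOpenMap U.subtype
      continuous_subtype_val Subtype.val_injective hUo.isOpenMap_subtype_val).symm
    have hU : HasLocalComplements U := hG.hasLocalComplements.of_locallyIsomorphic hUG
    obtain ⟨A, B, hAB, hA, hB⟩ := hU.exists_isOpenDirectProduct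
    have hcA : CompactSpace A := isCompact_iff_compactSpace.1 hAB.1
    have hcB : CompactSpace B := isCompact_iff_compactSpace.1 hAB.2
    obtain ⟨I, S, hS, hAS⟩ := (hU.factor hAB).exists_locallyIsomorphic_pi_simple_of_dense hA
    obtain ⟨H, _, _, _, _, _, _, hH, hHt, hHc, hHB⟩ :=
      (hU.factor hAB.symm).exists_normallyComplemented hB
    obtain ⟨J, T, hJ, hT, hHT⟩ := hH.exists_locallyIsomorphic_pi_justInfinite hHt hHc
    refine ⟨I ⊕ J, Sum.elim S T, Set.range Sum.inr, Set.finite_range _, ?_, ?_, ?_⟩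
    · rintro _ ⟨j, rfl⟩
      exact hT j
    · rintro (i | j) hk
      · exact hS i
      · exact absurd ⟨j, rfl⟩ hk
    · exact ((hUG.trans hAB.locallyIsomorphic.symm).trans
        (hAS.prod (hHB.symm.trans hHT))).trans (locallyIsomorphic_pi_sumElim S T)
  · rintro ⟨I, L, J, hJ, hL, hS, hiso⟩
    exact ((hasLocalComplements_pi hJ hL hS).of_locallyIsomorphic hiso.symm).propertyLD
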